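/- Let $d\ge 2$. For $n\in\mathbb N$ let $E_n=\ker\big((-\Delta+|x|^2)-(2n+d)\big)$ be the $n$-th eigenspace of the harmonic oscillator in $L^2(\mathbb R^d)$, i.e. the space of those $f\in L^2(\mathbb R^d)$ (real-valued) that satisfy $-\Delta f+|x|^2f=(2n+d)f$ in the sense of tempered distributions. Each $E_n$ is finite-dimensional and has an orthonormal basis consisting of (classes of) real-valued continuous functions. For such a basis $(\varphi_{n,k})_{1\le k\le \dim E_n}$ put, for $x,y\in\mathbb R^d$, $$\delta_n(x,y)=\Big(\frac1{\dim E_n}\sum_{k=1}^{\dim E_n}\big(\varphi_{n,k}(x)-\varphi_{n,k}(y)\big)^2\Big)^{1/2}.$$ Then there are constants $0<c\le C<\infty$ and an integer $N\ge 1$, depending only on $d$ (and not on the choice of the bases), such that for all $n\ge N$ and all $x,y$ in the unit sphere $\mathbb S^{d-1}\subset\mathbb R^d$ with $|x-y|\le 1$, $$c\,n^{-d/4}\min\big(1,\sqrt n\,|x-y|\big)\;\le\;\delta_n(x,y)\;\le\; C\,n^{-d/4}\min\big(1,\sqrt n\,|x-y|\big).$$ -/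

import Mathlib

open MeasureTheory
open scoped SchwartzMap Laplacian

noncomputable section

/-- The harmonic oscillator `-Δ + |x|²` on Schwartz functions. -/
def harmonicOscillator {d : ℕ} (φ : 𝓢(EuclideanSpace ℝ (Fin d), ℝ)) :
    𝓢(EuclideanSpace ℝ (Fin d), ℝ) :=
  -(Δ φ) + SchwartzMap.smulLeftCLM ℝ (fun x : EuclideanSpace ℝ (Fin d) => ‖x‖ ^ 2) φ

theorem harmonicOscillator_apply {d : ℕ} (φ : 𝓢(EuclideanSpace ℝ (Fin d), ℝ))
    (x : EuclideanSpace ℝ (Fin d)) :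
    harmonicOscillator φ x
      = -(Δ (φ : EuclideanSpace ℝ (Fin d) → ℝ) x) + ‖x‖ ^ 2 * φ x := by
  have h : Function.HasTemperateGrowth (fun x : EuclideanSpace ℝ (Fin d) => ‖x‖ ^ 2) := by
    fun_prop
  simp [harmonicOscillator, SchwartzMap.smulLeftCLM_apply_apply h, SchwartzMap.laplacian_apply]

theorem integrable_Lp_two_mul_schwartz {d : ℕ}
    (f : Lp ℝ 2 (volume : Measure (EuclideanSpace ℝ (Fin d))))
    (φ : 𝓢(EuclideanSpace ℝ (Fin d), ℝ)) : Integrable (fun x => f x * φ x) :=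
  (Lp.memLp f).integrable_mul (φ.memLp 2)

/-- The eigenspace `E_n = ker ((-Δ + |x|²) - (2n + d))` in the real space `L²(ℝ^d)`:
the `f ∈ L²(ℝ^d)` with `-Δ f + |x|² f = (2n + d) f` in the sense of tempered distributions. -/
def oscEigenspace (d n : ℕ) :
    Submodule ℝ (Lp ℝ 2 (volume : Measure (EuclideanSpace ℝ (Fin d)))) where
  carrier := {f | ∀ φ : 𝓢(EuclideanSpace ℝ (Fin d), ℝ),
    ∫ x, f x * harmonicOscillator φ x = (2 * (n : ℝ) + d) * ∫ x, f x * φ x}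
  zero_mem' := by
    intro φ
    have h (ψ : 𝓢(EuclideanSpace ℝ (Fin d), ℝ)) :
        ∫ x, (0 : Lp ℝ 2 (volume : Measure (EuclideanSpace ℝ (Fin d)))) x * ψ x = 0 := by
      rw [← integral_zero (EuclideanSpace ℝ (Fin d)) ℝ]
      refine integral_congr_ae ?_
      filter_upwards [Lp.coeFn_zero ℝ 2 (volume : Measure (EuclideanSpace ℝ (Fin d)))] with x hx
      rw [hx, Pi.zero_apply, zero_mul]
    rw [h, h, mul_zero]
  add_mem' := by
    intro f g hf hg φ
    have h (ψ : 𝓢(EuclideanSpace ℝ (Fin d), ℝ)) :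
        ∫ x, (f + g) x * ψ x = (∫ x, f x * ψ x) + ∫ x, g x * ψ x := by
      rw [← integral_add (integrable_Lp_two_mul_schwartz f ψ)
        (integrable_Lp_two_mul_schwartz g ψ)]
      refine integral_congr_ae ?_
      filter_upwards [Lp.coeFn_add f g] with x hx
      rw [hx, Pi.add_apply, add_mul]
    rw [h, h, hf φ, hg φ, mul_add]
  smul_mem' := by
    intro c f hf φ
    have h (ψ : 𝓢(EuclideanSpace ℝ (Fin d), ℝ)) :
        ∫ x, (c • f) x * ψ x = c * ∫ x, f x * ψ x := by
      rw [← integral_const_mul]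
      refine integral_congr_ae ?_
      filter_upwards [Lp.coeFn_smul c f] with x hx
      rw [hx, Pi.smul_apply, smul_eq_mul, mul_assoc]
    rw [h, h, hf φ]
    ring

/-- `dim E_n`. -/
def oscDim (d n : ℕ) : ℕ := Module.finrank ℝ (oscEigenspace d n)

/-- `(φ k)` is a Hilbert basis of `E_n` made of real-valued functions, each given by its continuous
representative (so that point values make sense). -/
def IsOscEigenbasis (d n : ℕ)
    (φ : Fin (oscDim d n) → EuclideanSpace ℝ (Fin d) → ℝ) : Prop :=
  (∀ k, Continuous (φ k)) ∧
    ∃ b : OrthonormalBasis (Fin (oscDim d n)) ℝ (oscEigenspace d n),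
      ∀ k, ((b k : Lp ℝ 2 (volume : Measure (EuclideanSpace ℝ (Fin d)))) :
        EuclideanSpace ℝ (Fin d) → ℝ) =ᵐ[volume] φ k

/-- The Dudley pseudo-distance `δ_n` of `E_n`, computed in a basis `φ` of `E_n`. -/
def dudleyDist (d n : ℕ) (φ : Fin (oscDim d n) → EuclideanSpace ℝ (Fin d) → ℝ)
    (x y : EuclideanSpace ℝ (Fin d)) : ℝ :=
  Real.sqrt ((1 / (oscDim d n : ℝ)) * ∑ k, (φ k x - φ k y) ^ 2)

end

/-! Hermite functions of degree `n` form an orthonormal basis of `E_n`. By Parseval the sum defining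
`δ_n²` does not depend on the basis, so it can be computed from the kernel `∑_{|a| = n} h_a(x)
h_a(y)`. The generating series in `n` of this kernel is a product of Mehler series. On the unit
sphere it depends only on `s = |x - y|² / 2` and equals, up to a constant factor, `(1 - X²)^(-d/2)
exp((2(1 - s)X - 2X²) / (1 - X²))`. This factors as `planarSeries s * (1 - X²)^(-(d-2)/2)`, where
`planarSeries s` is the two-dimensional series and splits further as `(∑ (-1)^k L_k(2 - s) X^k) (∑
L_k(s) X^k)` with Laguerre polynomials `L_k`. Closed forms are never used: each series is
characterised by a first-order linear differential equation and its constant term.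

The core is the planar case: `planarGap n s`, half the squared distance on the circle, is comparable
to `min(1, n s)`. For the lower bound, separating the singularities at `X = 1` and `X = -1` shows
that the `n`-th planar coefficient is `e^(1 - s/2)/2 · L_n(s) + o(1)`, uniformly in `s ∈ [0, 1/2]`
(`coeff_planarSeries_asymp`). Since `|L_n(s)|` stays below `127/128` once `n s ≥ 1`
(`abs_lag_le_of_one_le_mul`), the gap is then bounded below. Smaller `s` is reached by angle
doubling: by rotation invariance and the triangle inequality, doubling the angle multiplies the gap
by at most `4` (`exists_planarGap_lower`). For the upper bound, `planarSeries s / planarSeries 0 =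
exp(-2sX / (1 - X²))`, whose coefficients of positive degree up to `n` are `O(s)` when `4 n s ≤ 1`
(`exists_planarGap_upper`).

In dimension `d` the gap is the convolution of planar gaps with the nonnegative coefficients of `(1
- X²)^(-(d-2)/2)`, whose partial sums have order `n^((d-2)/2)`. Dividing by `dim E_n`, which has
order `n^(d-1)`, gives `δ_n²` of order `n^(-d/2) min(1, n |x - y|²)`. -/

/-! ### Uniqueness for first-order linear differential equations in formal power series. -/

section PowerSeriesODE

open PowerSeries

/-- `U` is a unit, so the equation reads `F' = U⁻¹ P F`; its coefficient of degree `n` determines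
coefficient `n + 1` of `F` from the lower ones, which vanish by induction. -/
theorem PowerSeries.eq_zero_of_mul_derivative_eq {K : Type*} [Field K] [CharZero K]
    {U P F : K⟦X⟧} (hU : constantCoeff U ≠ 0) (h0 : constantCoeff F = 0)
    (h : U * d⁄dX K F = P * F) : F = 0 := by
  have hF : d⁄dX K F = U⁻¹ * P * F := by
    rw [mul_assoc, ← h, ← mul_assoc, PowerSeries.inv_mul_cancel _ hU, one_mul]
  have key : ∀ n, ∀ m ≤ n, coeff m F = 0 := by
    intro n
    induction n with
    | zero =>
      intro m hm
      obtain rfl : m = 0 := by omega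
      simpa using h0
    | succ n ih =>
      intro m hm
      rcases Nat.lt_or_ge m (n + 1) with h1 | h1
      · exact ih m (by omega)
      obtain rfl : m = n + 1 := by omega
      have h2 : coeff n (d⁄dX K F) = 0 := by
        rw [hF, coeff_mul]
        refine Finset.sum_eq_zero fun p hp => ?_
        rw [ih p.2 (by have := Finset.HasAntidiagonal.mem_antidiagonal.1 hp; omega), mul_zero]
      rw [coeff_derivative] at h2
      have h3 : ((n : K) + 1) ≠ 0 := by exact_mod_cast Nat.succ_ne_zero n
      exact (mul_eq_zero.1 h2).resolve_right h3
  ext n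
  simpa using key n n le_rfl

theorem PowerSeries.eq_of_mul_derivative_eq {K : Type*} [Field K] [CharZero K]
    {U P F G : K⟦X⟧} (hU : constantCoeff U ≠ 0) (h0 : constantCoeff F = constantCoeff G)
    (hF : U * d⁄dX K F = P * F) (hG : U * d⁄dX K G = P * G) : F = G := by
  refine sub_eq_zero.1 (PowerSeries.eq_zero_of_mul_derivative_eq (U := U) (P := P) hU ?_ ?_)
  · simp [h0]
  · rw [map_sub, mul_sub, mul_sub, hF, hG]

end PowerSeriesODE

/-! ### Laguerre polynomials, their generating series and the planar series. -/

section Laguerre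

open PowerSeries

noncomputable section

/-- The pair `(L_k(x), k (L_k(x) - L_{k-1}(x)))` of Laguerre values. -/
def laguerrePair (x : ℝ) : ℕ → ℝ × ℝ
  | 0 => (1, 0)
  | k + 1 =>
    ((laguerrePair x k).1 + ((laguerrePair x k).2 - x * (laguerrePair x k).1) / (k + 1),
      (laguerrePair x k).2 - x * (laguerrePair x k).1)

/-- The Laguerre polynomial `L_k` evaluated at `x`. -/
def lag (x : ℝ) (k : ℕ) : ℝ := (laguerrePair x k).1

/-- The weighted backward difference `k (L_k(x) - L_{k-1}(x))` of the Laguerre polynomials. -/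
def lagDiff (x : ℝ) (k : ℕ) : ℝ := (laguerrePair x k).2

theorem lag_zero (x : ℝ) : lag x 0 = 1 := rfl

theorem lagDiff_zero (x : ℝ) : lagDiff x 0 = 0 := rfl

theorem lagDiff_succ (x : ℝ) (k : ℕ) : lagDiff x (k + 1) = lagDiff x k - x * lag x k := rfl

theorem lag_succ (x : ℝ) (k : ℕ) : lag x (k + 1) = lag x k + lagDiff x (k + 1) / (k + 1) := rfl

theorem lag_succ_mul (x : ℝ) (k : ℕ) :
    ((k : ℝ) + 1) * lag x (k + 1) = (k + 1) * lag x k + lagDiff x (k + 1) := by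
  rw [lag_succ]
  field_simp

theorem lag_one (x : ℝ) : lag x 1 = 1 - x := by
  simp [lag_succ, lagDiff_succ, lag_zero, lagDiff_zero, sub_eq_add_neg]

/-- The classical three-term recurrence, which identifies these values with those of the Laguerre
polynomials. -/
theorem lag_rec (x : ℝ) (k : ℕ) :
    ((k : ℝ) + 2) * lag x (k + 2) = (2 * k + 3 - x) * lag x (k + 1) - (k + 1) * lag x k := by
  have h1 := lag_succ_mul x k
  have h2 := lag_succ_mul x (k + 1)
  have h3 := lagDiff_succ x (k + 1)
  push_cast at h2
  linear_combination h2 + h3 - h1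

/-- The generating series `∑ L_k(s) X^k`. -/
def lagSeries (s : ℝ) : ℝ⟦X⟧ := mk (lag s)

/-- The alternating generating series `∑ (-1)^k L_k(x) X^k`. -/
def altLagSeries (x : ℝ) : ℝ⟦X⟧ := mk fun k => (-1) ^ k * lag x k

/-- The equation of `(1 - X)⁻¹ exp(-sX / (1 - X))`. Coefficient by coefficient it is `lag_rec`; the
two lowest degrees are separate because of the shifts by `X` and `X²`. -/
theorem lagSeries_ode (s : ℝ) :
    (1 - X) ^ 2 * d⁄dX ℝ (lagSeries s) = ((1 - X) - C s) * lagSeries s := by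
  have e1 : (1 - X) ^ 2 * d⁄dX ℝ (lagSeries s) = d⁄dX ℝ (lagSeries s)
      - (X * d⁄dX ℝ (lagSeries s) + X * d⁄dX ℝ (lagSeries s))
      + X * (X * d⁄dX ℝ (lagSeries s)) := by ring
  have e2 : ((1 - X) - C s) * lagSeries s = lagSeries s - X * lagSeries s - C s * lagSeries s := by
    ring
  rw [e1, e2]
  ext n
  rcases n with _ | _ | n
  · simp only [map_sub, map_add, coeff_zero_X_mul, coeff_C_mul, coeff_mk,
      coeff_derivative, lagSeries, lag_zero]
    norm_num [lag_one]
  · have h := lag_rec s 0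
    simp only [map_sub, map_add, coeff_succ_X_mul, coeff_zero_X_mul, coeff_C_mul, coeff_mk,
      coeff_derivative, lagSeries, lag_zero] at h ⊢
    push_cast at h ⊢
    linear_combination h
  · have h := lag_rec s (n + 1)
    simp only [map_sub, map_add, coeff_succ_X_mul, lagSeries, coeff_derivative, coeff_mk,
      coeff_C_mul] at h ⊢
    push_cast at h ⊢
    linear_combination h

theorem altLagSeries_ode (x : ℝ) :
    (1 + X) ^ 2 * d⁄dX ℝ (altLagSeries x) = (C x - (1 + X)) * altLagSeries x := by
  have e1 : (1 + X) ^ 2 * d⁄dX ℝ (altLagSeries x) = d⁄dX ℝ (altLagSeries x)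
      + (X * d⁄dX ℝ (altLagSeries x) + X * d⁄dX ℝ (altLagSeries x))
      + X * (X * d⁄dX ℝ (altLagSeries x)) := by ring
  have e2 : (C x - (1 + X)) * altLagSeries x
      = C x * altLagSeries x - altLagSeries x - X * altLagSeries x := by
    ring
  rw [e1, e2]
  ext n
  rcases n with _ | _ | n
  · simp only [map_sub, map_add, coeff_zero_X_mul, coeff_C_mul, coeff_mk,
      coeff_derivative, altLagSeries, lag_zero]
    norm_num [lag_one]
  · have h := lag_rec x 0
    simp only [map_sub, map_add, coeff_succ_X_mul, coeff_zero_X_mul, coeff_C_mul, coeff_mk,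
      coeff_derivative, altLagSeries, lag_zero] at h ⊢
    push_cast at h ⊢
    linear_combination h
  · have h := lag_rec x (n + 1)
    simp only [map_sub, map_add, coeff_succ_X_mul, altLagSeries, coeff_derivative, coeff_mk,
      coeff_C_mul] at h ⊢
    push_cast at h ⊢
    linear_combination (-1 : ℝ) ^ (n + 1) * h

/-- The generating series of the planar oscillator kernel at two points of the unit circle with
inner product `1 - s`, up to the factor `π⁻¹ e⁻¹`. -/
def planarSeries (s : ℝ) : ℝ⟦X⟧ := altLagSeries (2 - s) * lagSeries s

theorem constantCoeff_planarSeries (s : ℝ) : constantCoeff (planarSeries s) = 1 := by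
  rw [planarSeries, map_mul, ← coeff_zero_eq_constantCoeff_apply,
    ← coeff_zero_eq_constantCoeff_apply]
  simp [altLagSeries, lagSeries, lag_zero]

/-- Logarithmic derivatives of the two factors add. The closed form behind this is `(1 - X²)⁻¹
exp((2(1 - s)X - 2X²) / (1 - X²))`. -/
theorem planarSeries_ode (s : ℝ) :
    (1 - X ^ 2) ^ 2 * d⁄dX ℝ (planarSeries s)
      = (2 * (1 - X) ^ 2 - 2 * C s * (1 + X ^ 2) + 2 * X * (1 - X ^ 2)) * planarSeries s := by
  have hA := altLagSeries_ode (2 - s)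
  have hB := lagSeries_ode s
  have h2 : (C (2 - s) : ℝ⟦X⟧) = 2 - C s := by
    rw [map_sub, map_ofNat (C (R := ℝ)) 2]
  rw [h2] at hA
  rw [planarSeries, Derivation.leibniz]
  simp only [smul_eq_mul]
  linear_combination (1 + X) ^ 2 * altLagSeries (2 - s) * hB
    + (1 - X) ^ 2 * lagSeries s * hA

end

end Laguerre

/-! ### Hermite polynomials and Mehler's formula as a differential equation. -/

section Mehler

open PowerSeries

noncomputable section

/-- The physicists' Hermite polynomials. -/
def hermiteH : ℕ → Polynomial ℝ
  | 0 => 1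
  | n + 1 => 2 * Polynomial.X * hermiteH n - Polynomial.derivative (hermiteH n)

theorem hermiteH_succ (n : ℕ) :
    hermiteH (n + 1) = 2 * Polynomial.X * hermiteH n - Polynomial.derivative (hermiteH n) := rfl

theorem derivative_hermiteH_succ (n : ℕ) :
    Polynomial.derivative (hermiteH (n + 1)) = 2 * ((n : Polynomial ℝ) + 1) * hermiteH n := by
  induction n with
  | zero => simp [hermiteH]
  | succ n ih =>
    rw [hermiteH_succ (n + 1), Polynomial.derivative_sub, ih]
    simp only [Polynomial.derivative_mul, Polynomial.derivative_X, Polynomial.derivative_ofNat,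
      Polynomial.derivative_add, Polynomial.derivative_natCast, Polynomial.derivative_one]
    rw [ih, hermiteH_succ n]
    push_cast
    ring

theorem hermiteH_succ_succ (n : ℕ) :
    hermiteH (n + 2) = 2 * Polynomial.X * hermiteH (n + 1)
      - 2 * ((n : Polynomial ℝ) + 1) * hermiteH n := by
  rw [hermiteH_succ (n + 1), derivative_hermiteH_succ]

theorem eval_hermiteH_succ_succ (n : ℕ) (x : ℝ) :
    (hermiteH (n + 2)).eval x = 2 * x * (hermiteH (n + 1)).eval x
      - 2 * ((n : ℝ) + 1) * (hermiteH n).eval x := by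
  simp [hermiteH_succ_succ]

/-- The summand `H_m(x) H_m(y) / (2^m m!)` of the Mehler kernel. -/
def mehlerCoeff (x y : ℝ) (m : ℕ) : ℝ :=
  (hermiteH m).eval x * (hermiteH m).eval y / (2 ^ m * m.factorial)

/-- The Mehler series `∑ H_m(x) H_m(y) / (2^m m!) X^m`. -/
def mehlerSeries (x y : ℝ) : ℝ⟦X⟧ := mk (mehlerCoeff x y)

theorem constantCoeff_mehlerSeries (x y : ℝ) : constantCoeff (mehlerSeries x y) = 1 := by
  rw [← coeff_zero_eq_constantCoeff_apply]
  simp [mehlerSeries, mehlerCoeff, hermiteH]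

/-- The three-term recurrence reduces all values to those of `H_m` and `H_{m+1}` at `x` and `y`, and
a polynomial identity remains. It is the coefficient of degree `m + 3` in `mehlerSeries_ode`. -/
theorem mehlerCoeff_rec (x y : ℝ) (m : ℕ) :
    ((m : ℝ) + 4) * mehlerCoeff x y (m + 4) - 2 * (m + 2) * mehlerCoeff x y (m + 2)
        + m * mehlerCoeff x y m
      = mehlerCoeff x y (m + 2) - mehlerCoeff x y m
        + 2 * x * y * (mehlerCoeff x y (m + 3) + mehlerCoeff x y (m + 1))
        - 2 * (x ^ 2 + y ^ 2) * mehlerCoeff x y (m + 2) := by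
  simp only [mehlerCoeff, eval_hermiteH_succ_succ, Nat.factorial_succ, pow_succ]
  push_cast
  field_simp
  ring

/-- Mehler's formula in differential form: the equation of `(1 - X²)^(-1/2) exp((2xyX - (x² + y²)X²)
/ (1 - X²))`. -/
theorem mehlerSeries_ode (x y : ℝ) :
    (1 - X ^ 2) ^ 2 * d⁄dX ℝ (mehlerSeries x y)
      = (X * (1 - X ^ 2) + C (2 * x * y) * (1 + X ^ 2) - C (2 * (x ^ 2 + y ^ 2)) * X)
        * mehlerSeries x y := by
  set M := mehlerSeries x y with hM
  have e1 : (1 - X ^ 2) ^ 2 * d⁄dX ℝ M = d⁄dX ℝ M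
      - (X * (X * d⁄dX ℝ M) + X * (X * d⁄dX ℝ M)) + X * (X * (X * (X * d⁄dX ℝ M))) := by ring
  have e2 : (X * (1 - X ^ 2) + C (2 * x * y) * (1 + X ^ 2) - C (2 * (x ^ 2 + y ^ 2)) * X) * M
      = X * M - X * (X * (X * M)) + C (2 * x * y) * M + C (2 * x * y) * (X * (X * M))
        - C (2 * (x ^ 2 + y ^ 2)) * (X * M) := by
    ring
  have c0 : mehlerCoeff x y 0 = 1 := by simp [mehlerCoeff, hermiteH]
  have c1 : mehlerCoeff x y 1 = 2 * x * y := by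
    simp [mehlerCoeff, hermiteH]; ring
  have c2 : mehlerCoeff x y 2 = (2 * x ^ 2 - 1) * (2 * y ^ 2 - 1) / 2 := by
    simp [mehlerCoeff, hermiteH, Nat.factorial]; ring
  have c3 : mehlerCoeff x y 3 = (2 * x ^ 2 - 3) * (2 * y ^ 2 - 3) * x * y / 3 := by
    simp [mehlerCoeff, hermiteH, Nat.factorial]; ring
  rw [e1, e2]
  ext n
  rcases n with _ | _ | _ | n
  · simp only [map_sub, map_add, coeff_zero_X_mul, coeff_C_mul, coeff_mk,
      coeff_derivative, hM, mehlerSeries]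
    norm_num [c0, c1]
  · simp only [map_sub, map_add, coeff_succ_X_mul, coeff_zero_X_mul, coeff_C_mul, coeff_mk,
      coeff_derivative, hM, mehlerSeries]
    norm_num [c0, c1, c2]
    ring
  · simp only [map_sub, map_add, coeff_succ_X_mul, coeff_zero_X_mul, coeff_C_mul, coeff_mk,
      coeff_derivative, hM, mehlerSeries]
    norm_num [c0, c1, c2, c3]
    ring
  · have h := mehlerCoeff_rec x y n
    rcases n with _ | n
    · simp only [map_sub, map_add, coeff_succ_X_mul, coeff_zero_X_mul, coeff_C_mul, coeff_mk,
      coeff_derivative, hM, mehlerSeries] at h ⊢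
      norm_num [c0, c1, c2, c3] at h ⊢
      linear_combination h
    · simp only [map_sub, map_add, coeff_succ_X_mul, hM, mehlerSeries, coeff_derivative, coeff_mk,
        coeff_C_mul] at h ⊢
      push_cast at h ⊢
      linear_combination h

/-- Logarithmic derivatives add, so the equation sees the two points only through their squared
lengths and their inner product. This is the source of rotation invariance. -/
theorem prod_mehlerSeries_ode {ι : Type*} (t : Finset ι) (x y : ι → ℝ) :
    (1 - X ^ 2) ^ 2 * d⁄dX ℝ (∏ i ∈ t, mehlerSeries (x i) (y i))
      = (C (t.card : ℝ) * X * (1 - X ^ 2) + C (2 * ∑ i ∈ t, x i * y i) * (1 + X ^ 2)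
        - C (2 * (∑ i ∈ t, x i ^ 2 + ∑ i ∈ t, y i ^ 2)) * X)
        * ∏ i ∈ t, mehlerSeries (x i) (y i) := by
  classical
  induction t using Finset.induction_on with
  | empty => simp
  | insert i t hi ih =>
    rw [Finset.prod_insert hi, Derivation.leibniz, Finset.sum_insert hi, Finset.sum_insert hi,
      Finset.sum_insert hi, Finset.card_insert_of_notMem hi]
    have h := mehlerSeries_ode (x i) (y i)
    simp only [smul_eq_mul, map_add, map_mul, Nat.cast_add, Nat.cast_one, map_one] at h ih ⊢
    linear_combination mehlerSeries (x i) (y i) * ih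
      + (∏ i ∈ t, mehlerSeries (x i) (y i)) * h

/-- Two unit vectors in dimension `d ≥ 2`: the product of the Mehler series is the planar series
times a power of the diagonal series at the origin. -/
theorem prod_mehlerSeries_eq {d : ℕ} (hd : 2 ≤ d) {x y : Fin d → ℝ} {s : ℝ}
    (hx : ∑ i, x i ^ 2 = 1) (hy : ∑ i, y i ^ 2 = 1) (hxy : ∑ i, x i * y i = 1 - s) :
    ∏ i, mehlerSeries (x i) (y i) = planarSeries s * mehlerSeries 0 0 ^ (d - 2) := by
  obtain ⟨m, rfl⟩ := Nat.exists_eq_add_of_le hd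
  have h1 := prod_mehlerSeries_ode Finset.univ x y
  have h2 := prod_mehlerSeries_ode (Finset.univ : Finset (Fin m)) (fun _ => 0) (fun _ => 0)
  have h3 := planarSeries_ode s
  simp only [Finset.prod_const, Finset.card_univ, Fintype.card_fin] at h1 h2
  rw [hx, hy, hxy] at h1
  refine PowerSeries.eq_of_mul_derivative_eq (U := (1 - X ^ 2) ^ 2) ?_ ?_ h1 ?_
  · simp
  · simp [map_prod, constantCoeff_mehlerSeries, constantCoeff_planarSeries]
  · rw [Nat.add_sub_cancel_left, Derivation.leibniz]
    simp only [smul_eq_mul]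
    simp only [map_add, map_sub, map_mul, map_one, map_ofNat, Nat.cast_add, Nat.cast_ofNat,
      ne_eq, OfNat.ofNat_ne_zero, not_false_eq_true, zero_pow, mul_zero, Finset.sum_const_zero,
      map_zero, add_zero, zero_mul, sub_zero] at h2 ⊢
    linear_combination mehlerSeries 0 0 ^ m * h3 + planarSeries s * h2

theorem sum_prod_mehlerCoeff {d : ℕ} (hd : 2 ≤ d) {x y : Fin d → ℝ} {s : ℝ}
    (hx : ∑ i, x i ^ 2 = 1) (hy : ∑ i, y i ^ 2 = 1) (hxy : ∑ i, x i * y i = 1 - s) (n : ℕ) :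
    ∑ a ∈ Finset.finsuppAntidiag Finset.univ n, ∏ i, mehlerCoeff (x i) (y i) (a i)
      = coeff n (planarSeries s * mehlerSeries 0 0 ^ (d - 2)) := by
  rw [← prod_mehlerSeries_eq hd hx hy hxy, coeff_prod]
  simp [mehlerSeries]

end

end Mehler

/-! ### Laguerre values for `s ∈ [0, 1/2]`: a decreasing energy. -/

section LaguerreSmallArgument

noncomputable section

/-- A discrete energy for the recursion of Laguerre values. -/
def lagEnergy (s : ℝ) (k : ℕ) : ℝ := s * lag s k ^ 2 + lagDiff s k ^ 2 / k

theorem lagEnergy_succ_sub (s : ℝ) {k : ℕ} (hk : 1 ≤ k) :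
    lagEnergy s (k + 1) - lagEnergy s k
      = s * lagDiff s (k + 1) ^ 2 / ((k : ℝ) + 1) ^ 2 - s ^ 2 * lag s k ^ 2 / (k + 1)
        - lagDiff s k ^ 2 / (k * (k + 1)) := by
  have hk0 : (k : ℝ) ≠ 0 := by positivity
  have hk1 : (k : ℝ) + 1 ≠ 0 := by positivity
  simp only [lagEnergy, lag_succ, lagDiff_succ]
  push_cast
  field_simp
  ring

/-- In the exact increment, `lagDiff s (k + 1) = lagDiff s k - s * lag s k` and `(a - b)² ≤ 2a² +
2b²` split the positive term. As `2s ≤ 1`, its `lag` part is cancelled by the negative term in `s²`,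
and its `lagDiff` part takes only a fraction `2s` of the loss. -/
theorem lagEnergy_succ_sub_le {s : ℝ} (hs0 : 0 ≤ s) (hs : s ≤ 1 / 2) {k : ℕ} (hk : 1 ≤ k) :
    lagEnergy s (k + 1) - lagEnergy s k ≤ -((1 - 2 * s) * (lagDiff s k ^ 2 / (k * (k + 1)))) := by
  have hk1 : (1 : ℝ) ≤ k := by exact_mod_cast hk
  rw [lagEnergy_succ_sub s hk]
  have h1 : s * lagDiff s (k + 1) ^ 2 / ((k : ℝ) + 1) ^ 2
      ≤ 2 * s * (lagDiff s k ^ 2 / (k * (k + 1))) + s ^ 2 * lag s k ^ 2 / (k + 1) := by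
    have h2 : lagDiff s (k + 1) ^ 2 ≤ 2 * lagDiff s k ^ 2 + 2 * (s ^ 2 * lag s k ^ 2) := by
      rw [lagDiff_succ]
      nlinarith [sq_nonneg (lagDiff s k + s * lag s k)]
    calc s * lagDiff s (k + 1) ^ 2 / ((k : ℝ) + 1) ^ 2
        ≤ s * (2 * lagDiff s k ^ 2 + 2 * (s ^ 2 * lag s k ^ 2)) / ((k : ℝ) + 1) ^ 2 := by gcongr
      _ = 2 * s * (lagDiff s k ^ 2 / ((k + 1) * (k + 1)))
          + (2 * s) * (s ^ 2 * lag s k ^ 2) / ((k + 1) * (k + 1)) := by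
        field_simp
      _ ≤ 2 * s * (lagDiff s k ^ 2 / (k * (k + 1)))
          + 1 * (s ^ 2 * lag s k ^ 2) / (1 * (k + 1)) := by
        gcongr <;> linarith
      _ = _ := by rw [one_mul, one_mul]
  linarith

theorem lagEnergy_succ_le {s : ℝ} (hs0 : 0 ≤ s) (hs : s ≤ 1 / 2) {k : ℕ} (hk : 1 ≤ k) :
    lagEnergy s (k + 1) ≤ lagEnergy s k := by
  have h := lagEnergy_succ_sub_le hs0 hs hk
  have h2 : 0 ≤ (1 - 2 * s) * (lagDiff s k ^ 2 / (k * (k + 1))) :=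
    mul_nonneg (by linarith) (by positivity)
  linarith

theorem lagEnergy_anti {s : ℝ} (hs0 : 0 ≤ s) (hs : s ≤ 1 / 2) {j k : ℕ} (hj : 1 ≤ j)
    (hjk : j ≤ k) : lagEnergy s k ≤ lagEnergy s j := by
  induction k, hjk using Nat.le_induction with
  | base => exact le_rfl
  | succ k hk ih => exact (lagEnergy_succ_le hs0 hs (hj.trans hk)).trans ih

theorem lagEnergy_one (s : ℝ) : lagEnergy s 1 = s * (1 - s + s ^ 2) := by
  simp [lagEnergy, lag_one, lagDiff_succ, lag_zero, lagDiff_zero]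
  ring

theorem lagEnergy_le {s : ℝ} (hs0 : 0 ≤ s) (hs : s ≤ 1 / 2) {k : ℕ} (hk : 1 ≤ k) :
    lagEnergy s k ≤ s := by
  refine (lagEnergy_anti hs0 hs le_rfl hk).trans ?_
  rw [lagEnergy_one]
  nlinarith

theorem mul_lag_sq_le_lagEnergy (s : ℝ) (k : ℕ) : s * lag s k ^ 2 ≤ lagEnergy s k := by
  have : 0 ≤ lagDiff s k ^ 2 / k := by positivity
  rw [lagEnergy]
  linarith

theorem lagDiff_zero_left (k : ℕ) : lagDiff 0 k = 0 := by
  induction k with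
  | zero => rfl
  | succ k ih => rw [lagDiff_succ, ih]; simp

theorem lag_zero_left (k : ℕ) : lag 0 k = 1 := by
  induction k with
  | zero => rfl
  | succ k ih => rw [lag_succ, ih, lagDiff_zero_left]; simp

theorem abs_lag_le_one {s : ℝ} (hs0 : 0 ≤ s) (hs : s ≤ 1 / 2) (k : ℕ) : |lag s k| ≤ 1 := by
  rcases Nat.eq_zero_or_pos k with rfl | hk
  · simp [lag_zero]
  rcases hs0.eq_or_lt with rfl | hs1
  · simp [lag_zero_left]
  have h1 := (mul_lag_sq_le_lagEnergy s k).trans (lagEnergy_le hs0 hs hk)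
  have h2 : lag s k ^ 2 ≤ 1 := by
    by_contra h
    push Not at h
    nlinarith
  exact abs_le_one_iff_mul_self_le_one.2 (by nlinarith)

theorem lagDiff_sq_le {s : ℝ} (hs0 : 0 ≤ s) (hs : s ≤ 1 / 2) (k : ℕ) :
    lagDiff s k ^ 2 ≤ s * k := by
  rcases Nat.eq_zero_or_pos k with rfl | hk
  · simp [lagDiff_zero]
  have h1 := lagEnergy_le hs0 hs hk
  have h2 : 0 ≤ s * lag s k ^ 2 := by positivity
  have hk' : (0 : ℝ) < k := by exact_mod_cast hk
  rw [lagEnergy] at h1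
  have h3 : lagDiff s k ^ 2 / k ≤ s := by linarith
  rwa [div_le_iff₀ hk'] at h3

/-- The energy bound gives `lagDiff² ≤ s (k + 1)` at index `k + 1`, and the increment is `lagDiff`
divided by `k + 1`. The point is slow variation in `k`, uniformly in `s`. -/
theorem abs_lag_succ_sub_le {s : ℝ} (hs0 : 0 ≤ s) (hs : s ≤ 1 / 2) (k : ℕ) :
    |lag s (k + 1) - lag s k| ≤ 1 / Real.sqrt (k + 1) := by
  have h := lagDiff_sq_le hs0 hs (k + 1)
  rw [lag_succ, add_sub_cancel_left]
  push_cast at h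
  refine abs_le_of_sq_le_sq ?_ (by positivity)
  rw [div_pow, div_pow, Real.sq_sqrt (by positivity), one_pow, div_le_div_iff₀ (by positivity)
    (by positivity)]
  nlinarith

theorem abs_lagDiff_le {s : ℝ} (hs0 : 0 ≤ s) (hs : s ≤ 1 / 2) (k : ℕ) :
    |lagDiff s k| ≤ s * k := by
  induction k with
  | zero => simp [lagDiff_zero]
  | succ k ih =>
    rw [lagDiff_succ]
    have h := abs_lag_le_one hs0 hs k
    calc |lagDiff s k - s * lag s k| ≤ |lagDiff s k| + |s * lag s k| := abs_sub _ _
      _ ≤ s * k + s * 1 := by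
        rw [abs_mul, abs_of_nonneg hs0]
        gcongr
      _ = _ := by push_cast; ring

theorem one_sub_le_lag {s : ℝ} (hs0 : 0 ≤ s) (hs : s ≤ 1 / 2) (k : ℕ) :
    1 - s * k ≤ lag s k := by
  induction k with
  | zero => simp [lag_zero]
  | succ k ih =>
    have h := (abs_le.1 (abs_lagDiff_le hs0 hs (k + 1))).1
    have h2 : -s ≤ lagDiff s (k + 1) / (k + 1) := by
      rw [le_div_iff₀ (by positivity)]
      push_cast at h
      linarith
    rw [lag_succ]
    push_cast
    linarith

/-- As long as `s k ≤ 1/2` the values stay at least `1/2`, so each step lowers `lagDiff` by at least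
`s / 2`. -/
theorem lagDiff_le_of_small {s : ℝ} (hs0 : 0 ≤ s) (hs : s ≤ 1 / 2) {k : ℕ}
    (hk : s * k ≤ 1 / 2) : lagDiff s k ≤ -(s * k / 2) := by
  induction k with
  | zero => simp [lagDiff_zero]
  | succ k ih =>
    push_cast at hk ⊢
    have h1 := ih (by nlinarith)
    have h2 := one_sub_le_lag hs0 hs k
    rw [lagDiff_succ]
    nlinarith

/-- Away from the peak at the origin, the Laguerre values stay uniformly below their maximum. -/
theorem abs_lag_le_of_one_le_mul {s : ℝ} (hs0 : 0 ≤ s) (hs : s ≤ 1 / 2) {n : ℕ}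
    (hn : 1 ≤ n * s) : |lag s n| ≤ 127 / 128 := by
  have hs1 : 0 < s := by
    rcases hs0.eq_or_lt with rfl | h
    · norm_num at hn
    · exact h
  have hn1 : 1 ≤ n := by
    rcases Nat.eq_zero_or_pos n with rfl | h
    · norm_num at hn
    · exact h
  -- It suffices that the energy has lost a fixed proportion of its bound `s`; note `63/64 ≤
  -- (127/128)²`.
  suffices h : lagEnergy s n ≤ s * (63 / 64) by
    have h1 := (mul_lag_sq_le_lagEnergy s n).trans h
    have h2 : lag s n ^ 2 ≤ 63 / 64 := le_of_mul_le_mul_left h1 hs1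
    refine abs_le_of_sq_le_sq ?_ (by norm_num)
    norm_num
    linarith
  -- For `s ≥ 1/8` the energy at index `1`, namely `s (1 - s + s²)`, is already small enough.
  rcases le_total (1 / 8) s with h8 | h8
  · refine (lagEnergy_anti hs0 hs le_rfl hn1).trans ?_
    rw [lagEnergy_one]
    gcongr
    nlinarith
  -- While `s (k + 1) ≤ 1/2`, each step loses at least `(1 - 2s) s²/8 ≥ (3/4)(s²/8)`, because
  -- `lagDiff` has grown linearly in the index.
  · have hdec : ∀ k : ℕ, s * ((k : ℝ) + 1) ≤ 1 / 2 →
        lagEnergy s (k + 1) ≤ s - 3 / 32 * s ^ 2 * k := by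
      intro k
      induction k with
      | zero =>
        intro _
        simpa using lagEnergy_le hs0 hs (k := 0 + 1) le_rfl
      | succ k ih =>
        intro hk
        push_cast at hk ⊢
        have h1 := ih (by nlinarith)
        have h2 := lagEnergy_succ_sub_le hs0 hs (k := k + 1) (by omega)
        have h3 := lagDiff_le_of_small hs0 hs (k := k + 1) (by push_cast; nlinarith)
        push_cast at h2 h3
        have h4 : (s * (k + 1) / 2) ^ 2 ≤ lagDiff s (k + 1) ^ 2 := by
          rw [← neg_sq (lagDiff s (k + 1))]
          exact pow_le_pow_left₀ (by positivity) (by linarith) 2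
        have h5 : s ^ 2 / 8 ≤ lagDiff s (k + 1) ^ 2 / (((k : ℝ) + 1) * (k + 1 + 1)) := by
          rw [le_div_iff₀ (by positivity)]
          have hk0 : (0 : ℝ) ≤ k := by positivity
          nlinarith [sq_nonneg s, mul_nonneg (sq_nonneg s) hk0]
        have h6 : (3 / 4) * (s ^ 2 / 8)
            ≤ (1 - 2 * s) * (lagDiff s (k + 1) ^ 2 / (((k : ℝ) + 1) * (k + 1 + 1))) := by
          gcongr <;> linarith
        nlinarith
    -- About `1/(2s)` such steps are available, for a total loss of at least `(3/32) s (1/2 - 2s) ≥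
    -- s/64`; the assumption `n s ≥ 1` places `K` below `n`.
    set K := ⌊1 / (2 * s)⌋₊ with hK
    have hK1 : (K : ℝ) ≤ 1 / (2 * s) := Nat.floor_le (by positivity)
    have hK2 : 1 / (2 * s) < K + 1 := Nat.lt_floor_add_one _
    rw [le_div_iff₀ (by positivity)] at hK1
    rw [div_lt_iff₀ (by positivity)] at hK2
    obtain ⟨m, hm⟩ : ∃ m, K = m + 1 := by
      refine Nat.exists_eq_succ_of_ne_zero fun h0 => ?_
      rw [h0] at hK2
      norm_num at hK2
      linarith
    have hKn : K ≤ n := by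
      have : (K : ℝ) ≤ n := by
        by_contra hc
        push Not at hc
        nlinarith
      exact_mod_cast this
    refine (lagEnergy_anti hs0 hs (by omega) hKn).trans ?_
    rw [hm] at hK1 hK2 ⊢
    push_cast at hK1 hK2
    refine (hdec m (by linarith)).trans ?_
    nlinarith

end

end LaguerreSmallArgument

/-! ### Power decay of Laguerre values for `x ∈ [1, 2]`. -/

section LaguerreDecay

noncomputable section

/-- An energy for the recursion of Laguerre values which decays like a negative power. -/
def lagDecayEnergy (x : ℝ) (k : ℕ) : ℝ :=
  x * lag x k ^ 2 + lagDiff x k ^ 2 / k + (1 / 2 - x) * (lag x k * lagDiff x k) / k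

/-- The sum of the first two terms damps only `lagDiff` to leading order; the cross term `(1/2 - x)
lag lagDiff / k` shares the damping with `lag`. Both squares then decay at relative rate about
`1/(2k)`, and claiming only `1/(4k)` leaves room to absorb the mixed terms for `k ≥ 32`. -/
theorem lagDecayEnergy_succ_le {x : ℝ} (hx1 : 1 ≤ x) (hx2 : x ≤ 2) {k : ℕ} (hk : 32 ≤ k) :
    lagDecayEnergy x (k + 1) ≤ (1 - 1 / (4 * k)) * lagDecayEnergy x k := by
  have hk' : (32 : ℝ) ≤ k := by exact_mod_cast hk
  set v := lag x k with hv
  set w := lagDiff x k with hw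
  set K : ℝ := (k : ℝ) with hK
  have key : lagDecayEnergy x (k + 1) - (1 - 1 / (4 * k)) * lagDecayEnergy x k
      = -(x * (K ^ 3 - 2 * x * K ^ 2 - K) * v ^ 2 + (K ^ 2 + 2 * K - 1) * w ^ 2
        + (x * K ^ 2 + 3 / 2 * K ^ 2 + 2 * (1 / 2 - x) * K - (1 / 2 - x)) * (v * w))
        / (4 * K ^ 2 * (K + 1) ^ 2) := by
    simp only [lagDecayEnergy, lag_succ, lagDiff_succ, ← hv, ← hw, ← hK]
    push_cast
    rw [← hK]
    have h0 : K ≠ 0 := by positivity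
    have h1 : K + 1 ≠ 0 := by positivity
    field_simp
    ring
  have hco : |x * K ^ 2 + 3 / 2 * K ^ 2 + 2 * (1 / 2 - x) * K - (1 / 2 - x)| ≤ 4 * K ^ 2 := by
    rw [abs_le]
    constructor <;> nlinarith
  -- Young's inequality from `K (K|v| - 4|w|)² ≥ 0`, with weights chosen so that both resulting
  -- squares fit under the diagonal terms.
  have h1 : 4 * K ^ 2 * |v * w| ≤ 4 * K ^ 3 * (v ^ 2) / 8 + 8 * K * w ^ 2 := by
    rw [abs_mul]
    have := sq_nonneg (K * |v| - 4 * |w|)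
    have h3 : K * (K * |v| - 4 * |w|) ^ 2 = K ^ 3 * v ^ 2 + 16 * K * w ^ 2 - 8 * K ^ 2 * (|v| * |w|) := by
      rw [← sq_abs v, ← sq_abs w]
      ring
    nlinarith
  have h2 : -(4 * K ^ 2 * |v * w|)
      ≤ (x * K ^ 2 + 3 / 2 * K ^ 2 + 2 * (1 / 2 - x) * K - (1 / 2 - x)) * (v * w) := by
    have h3 := neg_abs_le
      ((x * K ^ 2 + 3 / 2 * K ^ 2 + 2 * (1 / 2 - x) * K - (1 / 2 - x)) * (v * w))
    rw [abs_mul] at h3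
    nlinarith [abs_nonneg (v * w)]
  have h3 : K ^ 3 / 2 * v ^ 2 ≤ x * (K ^ 3 - 2 * x * K ^ 2 - K) * v ^ 2 := by
    have h4 : K ^ 3 / 2 ≤ K ^ 3 - 2 * x * K ^ 2 - K := by
      have : 2 * x * K ^ 2 ≤ 4 * K ^ 2 := by nlinarith
      nlinarith
    have h5 : K ^ 3 / 2 ≤ x * (K ^ 3 - 2 * x * K ^ 2 - K) := by
      have : 0 ≤ K ^ 3 / 2 := by positivity
      nlinarith
    gcongr
  have h4 : 8 * K * w ^ 2 ≤ (K ^ 2 + 2 * K - 1) * w ^ 2 := by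
    gcongr
    nlinarith
  have h5 : 0 ≤ x * (K ^ 3 - 2 * x * K ^ 2 - K) * v ^ 2 + (K ^ 2 + 2 * K - 1) * w ^ 2
        + (x * K ^ 2 + 3 / 2 * K ^ 2 + 2 * (1 / 2 - x) * K - (1 / 2 - x)) * (v * w) := by
    linarith
  have h6 : lagDecayEnergy x (k + 1) - (1 - 1 / (4 * k)) * lagDecayEnergy x k ≤ 0 := by
    rw [key]
    exact div_nonpos_of_nonpos_of_nonneg (by linarith) (by positivity)
  linarith

theorem half_le_lagDecayEnergy {x : ℝ} (hx1 : 1 ≤ x) (hx2 : x ≤ 2) {k : ℕ} (hk : 32 ≤ k) :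
    (lag x k ^ 2 + lagDiff x k ^ 2 / k) / 2 ≤ lagDecayEnergy x k := by
  have hk' : (32 : ℝ) ≤ k := by exact_mod_cast hk
  set v := lag x k with hv
  set w := lagDiff x k with hw
  have h1 : -((v ^ 2 + w ^ 2 / k) / 2) ≤ (1 / 2 - x) * (v * w) / k := by
    rw [show (v ^ 2 + w ^ 2 / k) / 2 = (v ^ 2 * k + w ^ 2) / (2 * k) by field_simp,
      ← neg_div, div_le_div_iff₀ (by positivity)
      (by positivity)]
    have h2 : |(1 / 2 - x) * (v * w)| ≤ 3 / 2 * (|v| * |w|) := by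
      rw [abs_mul, abs_mul]
      gcongr
      rw [abs_le]
      constructor <;> linarith
    have h3 := neg_abs_le ((1 / 2 - x) * (v * w))
    have h4 : 3 * (|v| * |w|) ≤ v ^ 2 * k + w ^ 2 := by
      rw [← sq_abs v, ← sq_abs w]
      nlinarith [sq_nonneg (3 * |v| - |w|), sq_nonneg (|v|), sq_nonneg (|w|)]
    have h5 : -(v ^ 2 * k + w ^ 2) ≤ 2 * ((1 / 2 - x) * (v * w)) := by linarith
    have h0 : (0:ℝ) ≤ k := by positivity
    nlinarith
  have h6 : v ^ 2 ≤ x * v ^ 2 := by nlinarith [sq_nonneg v]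
  rw [lagDecayEnergy, ← hv, ← hw]
  linarith

theorem exists_lag_bound (k : ℕ) : ∃ M : ℝ, 0 ≤ M ∧ ∀ x : ℝ, 1 ≤ x → x ≤ 2 →
    |lag x k| ≤ M ∧ |lagDiff x k| ≤ M := by
  induction k with
  | zero => exact ⟨1, zero_le_one, fun x _ _ => by simp [lag_zero, lagDiff_zero]⟩
  | succ k ih =>
    obtain ⟨M, hM, h⟩ := ih
    refine ⟨4 * M, by positivity, fun x h1 h2 => ?_⟩
    obtain ⟨h3, h4⟩ := h x h1 h2
    have h5 : |lagDiff x (k + 1)| ≤ 3 * M := by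
      rw [lagDiff_succ]
      calc |lagDiff x k - x * lag x k| ≤ |lagDiff x k| + |x * lag x k| := abs_sub _ _
        _ ≤ M + 2 * M := by
          rw [abs_mul, abs_of_nonneg (by linarith : 0 ≤ x)]
          gcongr
        _ = 3 * M := by ring
    refine ⟨?_, by linarith⟩
    rw [lag_succ]
    calc |lag x k + lagDiff x (k + 1) / (k + 1)| ≤ |lag x k| + |lagDiff x (k + 1) / (k + 1)| :=
          abs_add_le _ _
      _ ≤ M + 3 * M / 1 := by
        rw [abs_div, abs_of_nonneg (by positivity : (0 : ℝ) ≤ k + 1)]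
        gcongr
        simp
      _ = 4 * M := by ring

theorem exists_lag_bound_of_lt (m : ℕ) : ∃ M : ℝ, 0 ≤ M ∧ ∀ k < m, ∀ x : ℝ, 1 ≤ x → x ≤ 2 →
    |lag x k| ≤ M ∧ |lagDiff x k| ≤ M := by
  induction m with
  | zero => exact ⟨0, le_rfl, by simp⟩
  | succ m ih =>
    obtain ⟨M, hM, h⟩ := ih
    obtain ⟨M', hM', h'⟩ := exists_lag_bound m
    refine ⟨max M M', le_max_of_le_left hM, fun k hk x h1 h2 => ?_⟩
    rcases Nat.lt_succ_iff_lt_or_eq.1 hk with hk | rfl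
    · exact ⟨(h k hk x h1 h2).1.trans (le_max_left _ _), (h k hk x h1 h2).2.trans (le_max_left _ _)⟩
    · exact ⟨(h' x h1 h2).1.trans (le_max_right _ _), (h' x h1 h2).2.trans (le_max_right _ _)⟩

/-- The product `k^(1/4) · lagDecayEnergy x k` does not increase: Bernoulli gives `(1 + 1/k)^(1/4) ≤
1 + 1/(4k)`, and `(1 - 1/(4k))(1 + 1/(4k)) ≤ 1`. At `k = 32` a crude bound uniform in `x` starts the
induction. -/
theorem exists_lagDecayEnergy_le : ∃ M : ℝ, 0 ≤ M ∧ ∀ k : ℕ, 32 ≤ k → ∀ x : ℝ, 1 ≤ x → x ≤ 2 →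
    lagDecayEnergy x k * (k : ℝ) ^ (1 / 4 : ℝ) ≤ M := by
  obtain ⟨M, hM, h⟩ := exists_lag_bound 32
  refine ⟨5 * M ^ 2 * (32 : ℝ) ^ (1 / 4 : ℝ), by positivity, fun k hk x h1 h2 => ?_⟩
  induction k, hk using Nat.le_induction with
  | base =>
    obtain ⟨h3, h4⟩ := h x h1 h2
    have h5 : lag x 32 ^ 2 ≤ M ^ 2 := sq_le_sq' (abs_le.1 h3).1 (abs_le.1 h3).2
    have h6 : lagDiff x 32 ^ 2 ≤ M ^ 2 := sq_le_sq' (abs_le.1 h4).1 (abs_le.1 h4).2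
    push_cast
    gcongr
    rw [lagDecayEnergy]
    have h7 : (1 / 2 - x) * (lag x 32 * lagDiff x 32) ≤ 2 * M ^ 2 := by
      calc (1 / 2 - x) * (lag x 32 * lagDiff x 32) ≤ |(1 / 2 - x) * (lag x 32 * lagDiff x 32)| :=
            le_abs_self _
        _ ≤ 2 * (M * M) := by
          rw [abs_mul, abs_mul]
          gcongr
          rw [abs_le]
          constructor <;> linarith
        _ = _ := by ring
    have h8 : x * lag x 32 ^ 2 ≤ 2 * M ^ 2 := by gcongr
    push_cast
    linarith [sq_nonneg M]
  | succ k hk ih =>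
    have hk' : (32 : ℝ) ≤ k := by exact_mod_cast hk
    have hpos : 0 ≤ lagDecayEnergy x k := by
      refine le_trans ?_ (half_le_lagDecayEnergy h1 h2 hk)
      positivity
    have hb : ((k + 1 : ℕ) : ℝ) ^ (1 / 4 : ℝ) ≤ (k : ℝ) ^ (1 / 4 : ℝ) * (1 + 1 / (4 * k)) := by
      have e : ((k + 1 : ℕ) : ℝ) = k * (1 + 1 / k) := by
        push_cast
        field_simp
      rw [e, Real.mul_rpow (by positivity) (by positivity)]
      gcongr
      refine (rpow_one_add_le_one_add_mul_self (s := 1 / (k : ℝ)) ?_ (by norm_num)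
        (by norm_num)).trans_eq ?_
      · have : 0 ≤ 1 / (k : ℝ) := by positivity
        linarith
      · field_simp
    have h3 : (0 : ℝ) ≤ 1 - 1 / (4 * k) := by
      rw [sub_nonneg, div_le_one (by positivity)]
      linarith
    refine le_trans ?_ ih
    calc lagDecayEnergy x (k + 1) * ((k + 1 : ℕ) : ℝ) ^ (1 / 4 : ℝ)
        ≤ ((1 - 1 / (4 * k)) * lagDecayEnergy x k)
            * ((k : ℝ) ^ (1 / 4 : ℝ) * (1 + 1 / (4 * k))) := by
          gcongr
          exact lagDecayEnergy_succ_le h1 h2 hk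
      _ = lagDecayEnergy x k * (k : ℝ) ^ (1 / 4 : ℝ) * (1 - (1 / (4 * k)) ^ 2) := by ring
      _ ≤ lagDecayEnergy x k * (k : ℝ) ^ (1 / 4 : ℝ) * 1 := by
          gcongr
          linarith [sq_nonneg (1 / (4 * (k : ℝ)))]
      _ = _ := mul_one _

/-- The Laguerre values and their increments decay uniformly for `x ∈ [1, 2]`. -/
theorem exists_lag_decay : ∃ M : ℝ, 0 ≤ M ∧ ∀ k : ℕ, ∀ x : ℝ, 1 ≤ x → x ≤ 2 →
    |lag x k| ≤ M * ((k : ℝ) + 1) ^ (-(1 / 8) : ℝ) ∧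
      |lag x (k + 1) - lag x k| ≤ M * ((k : ℝ) + 1) ^ (-(1 / 8) : ℝ) := by
  obtain ⟨M₁, hM₁, h₁⟩ := exists_lag_bound_of_lt 33
  obtain ⟨M₂, hM₂, h₂⟩ := exists_lagDecayEnergy_le
  have hval : ∃ M : ℝ, 0 ≤ M ∧ ∀ k : ℕ, ∀ x : ℝ, 1 ≤ x → x ≤ 2 →
      |lag x k| ≤ M * ((k : ℝ) + 1) ^ (-(1 / 8) : ℝ) := by
    refine ⟨M₁ * 33 + Real.sqrt (4 * M₂), by positivity, fun k x hx1 hx2 => ?_⟩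
    rcases Nat.lt_or_ge k 33 with hk | hk
    · have hk' : ((k : ℝ) + 1) ≤ 33 := by exact_mod_cast hk
      have h4 : (1 : ℝ) ≤ 33 * ((k : ℝ) + 1) ^ (-(1 / 8) : ℝ) := by
        rw [Real.rpow_neg (by positivity), ← div_eq_mul_inv, le_div_iff₀ (by positivity), one_mul]
        refine le_trans ?_ hk'
        exact Real.rpow_le_self_of_one_le (by linarith [(Nat.cast_nonneg k : (0:ℝ) ≤ k)])
          (by norm_num)
      calc |lag x k| ≤ M₁ * 1 := by simpa using (h₁ k hk x hx1 hx2).1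
        _ ≤ M₁ * (33 * ((k : ℝ) + 1) ^ (-(1 / 8) : ℝ)) := by gcongr
        _ ≤ _ := by
          rw [add_mul, ← mul_assoc]
          exact le_add_of_nonneg_right (by positivity)
    · have hk32 : 32 ≤ k := by omega
      have hk' : (32 : ℝ) ≤ k := by exact_mod_cast hk32
      have h5 := h₂ k hk32 x hx1 hx2
      have h6 := half_le_lagDecayEnergy hx1 hx2 hk32
      have h7 : lag x k ^ 2 / 2 ≤ lagDecayEnergy x k := by
        refine le_trans ?_ h6
        have : 0 ≤ lagDiff x k ^ 2 / k := by positivity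
        linarith
      have h8 : ((k : ℝ) + 1) ^ (1 / 4 : ℝ) ≤ 2 * (k : ℝ) ^ (1 / 4 : ℝ) := by
        calc ((k : ℝ) + 1) ^ (1 / 4 : ℝ) ≤ (2 * (k : ℝ)) ^ (1 / 4 : ℝ) := by
              gcongr
              linarith
          _ = 2 ^ (1 / 4 : ℝ) * (k : ℝ) ^ (1 / 4 : ℝ) :=
              Real.mul_rpow (by norm_num) (by positivity)
          _ ≤ _ := by
              gcongr
              exact Real.rpow_le_self_of_one_le (by norm_num) (by norm_num)
      have h9 : lag x k ^ 2 * ((k : ℝ) + 1) ^ (1 / 4 : ℝ) ≤ 4 * M₂ := by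
        calc lag x k ^ 2 * ((k : ℝ) + 1) ^ (1 / 4 : ℝ)
            ≤ lag x k ^ 2 * (2 * (k : ℝ) ^ (1 / 4 : ℝ)) := by gcongr
          _ = 4 * (lag x k ^ 2 / 2 * (k : ℝ) ^ (1 / 4 : ℝ)) := by ring
          _ ≤ 4 * (lagDecayEnergy x k * (k : ℝ) ^ (1 / 4 : ℝ)) := by gcongr
          _ ≤ 4 * M₂ := by gcongr
      have h10 : |lag x k| ≤ Real.sqrt (4 * M₂) * ((k : ℝ) + 1) ^ (-(1 / 8) : ℝ) := by
        refine abs_le_of_sq_le_sq ?_ (by positivity)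
        rw [mul_pow, Real.sq_sqrt (by positivity), ← Real.rpow_natCast (_ ^ _), ← Real.rpow_mul
          (by positivity), show (-(1 / 8) : ℝ) * (2 : ℕ) = -(1 / 4) by norm_num,
          Real.rpow_neg (by positivity), ← div_eq_mul_inv, le_div_iff₀ (by positivity)]
        exact h9
      refine h10.trans ?_
      gcongr
      linarith
  obtain ⟨M, hM, h⟩ := hval
  refine ⟨2 * M, by positivity, fun k x hx1 hx2 => ⟨?_, ?_⟩⟩
  · refine (h k x hx1 hx2).trans ?_
    gcongr
    linarith
  · calc |lag x (k + 1) - lag x k| ≤ |lag x (k + 1)| + |lag x k| := abs_sub _ _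
      _ ≤ M * (((k + 1 : ℕ) : ℝ) + 1) ^ (-(1 / 8) : ℝ) + M * ((k : ℝ) + 1) ^ (-(1 / 8) : ℝ) :=
          add_le_add (h _ x hx1 hx2) (h _ x hx1 hx2)
      _ ≤ M * ((k : ℝ) + 1) ^ (-(1 / 8) : ℝ) + M * ((k : ℝ) + 1) ^ (-(1 / 8) : ℝ) := by
          gcongr M * ?_ + _
          refine Real.rpow_le_rpow_of_nonpos (by positivity) ?_ (by norm_num)
          push_cast
          linarith
      _ = _ := by ring

end

end LaguerreDecay

/-! ### Evaluating power series at real points. -/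

section PowerSeriesEvaluation

open PowerSeries

theorem PowerSeries.hasSum_X_mul {F : ℝ⟦X⟧} {r a : ℝ}
    (h : HasSum (fun k => coeff k F * r ^ k) a) :
    HasSum (fun k => coeff k (X * F) * r ^ k) (r * a) := by
  have h1 : HasSum (fun k => coeff (k + 1) (X * F) * r ^ (k + 1)) (r * a) := by
    refine (h.mul_left r).congr_fun fun k => ?_
    rw [coeff_succ_X_mul]
    ring
  simpa using h1.zero_add (f := fun k => coeff k (X * F) * r ^ k)

theorem PowerSeries.hasSum_add {F G : ℝ⟦X⟧} {r a b : ℝ}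
    (hF : HasSum (fun k => coeff k F * r ^ k) a) (hG : HasSum (fun k => coeff k G * r ^ k) b) :
    HasSum (fun k => coeff k (F + G) * r ^ k) (a + b) :=
  (hF.add hG).congr_fun fun k => by rw [map_add, add_mul]

theorem PowerSeries.hasSum_C_mul {F : ℝ⟦X⟧} {r a : ℝ} (c : ℝ)
    (h : HasSum (fun k => coeff k F * r ^ k) a) :
    HasSum (fun k => coeff k (C c * F) * r ^ k) (c * a) :=
  (h.mul_left c).congr_fun fun k => by rw [coeff_C_mul, mul_assoc]

/-- A power series with bounded coefficients can be differentiated term by term. -/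
theorem PowerSeries.hasDerivAt_tsum_of_bounded {F : ℝ⟦X⟧} {M : ℝ} (hM : ∀ k, |coeff k F| ≤ M)
    {r : ℝ} (hr : |r| < 1) :
    ∃ g, HasSum (fun k => coeff k (d⁄dX ℝ F) * r ^ k) g ∧
      HasDerivAt (fun z => ∑' k, coeff k F * z ^ k) g r := by
  obtain ⟨ρ, hρ1, hρ2⟩ := exists_between hr
  have hρ0 : 0 < ρ := (abs_nonneg r).trans_lt hρ1
  have hM0 : 0 ≤ M := (abs_nonneg _).trans (hM 0)
  have hsum : Summable fun k : ℕ => M * (((k : ℝ) + 1) * ρ ^ k) := by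
    refine Summable.mul_left M ?_
    have h1 := summable_pow_mul_geometric_of_norm_lt_one (R := ℝ) 1 (r := ρ)
      (by rwa [Real.norm_of_nonneg hρ0.le])
    have h0 := summable_geometric_of_lt_one hρ0.le hρ2
    exact (h1.add h0).congr fun k => by ring
  have hbound : ∀ (k : ℕ) (z : ℝ), |z| < ρ →
      ‖coeff (k + 1) F * (((k : ℝ) + 1) * z ^ k)‖ ≤ M * (((k : ℝ) + 1) * ρ ^ k) := by
    intro k z hz
    rw [norm_mul, norm_mul, norm_pow, Real.norm_eq_abs, Real.norm_eq_abs, Real.norm_eq_abs,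
      abs_of_nonneg (by positivity : (0 : ℝ) ≤ k + 1)]
    gcongr
    exact hM _
  have hmem : r ∈ Set.Ioo (-ρ) ρ := abs_lt.1 hρ1
  have hd := hasDerivAt_tsum_of_isPreconnected (𝕜 := ℝ) (t := Set.Ioo (-ρ) ρ)
    (g := fun (k : ℕ) z => coeff (k + 1) F * z ^ (k + 1))
    (g' := fun (k : ℕ) z => coeff (k + 1) F * (((k : ℝ) + 1) * z ^ k)) (y₀ := 0) (y := r) hsum
    isOpen_Ioo isPreconnected_Ioo
    (fun k z _ => by
      have := (hasDerivAt_pow (k + 1) z).const_mul (coeff (k + 1) F)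
      simpa using this)
    (fun k z hz => hbound k z (abs_lt.2 hz)) (by constructor <;> linarith)
    (by simp) hmem
  refine ⟨∑' k : ℕ, coeff (k + 1) F * (((k : ℝ) + 1) * r ^ k), ?_, ?_⟩
  · refine HasSum.congr_fun (Summable.hasSum
      (Summable.of_norm_bounded hsum fun k => hbound k r hρ1)) fun k => ?_
    rw [coeff_derivative]
    ring
  · refine (hd.const_add (coeff 0 F)).congr_of_eventuallyEq ?_
    filter_upwards [Ioo_mem_nhds hmem.1 hmem.2] with z hz
    have hz' : |z| < 1 := (abs_lt.2 hz).trans hρ2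
    have hs : Summable fun k : ℕ => coeff k F * z ^ k := by
      refine Summable.of_norm_bounded (g := fun k => M * |z| ^ k)
        ((summable_geometric_of_lt_one (abs_nonneg z) hz').mul_left M) fun k => ?_
      rw [norm_mul, norm_pow]
      gcongr
      exacts [hM k, le_rfl]
    rw [hs.tsum_eq_zero_add]
    simp

end PowerSeriesEvaluation

/-! ### Second differences of Laguerre values and the regularised series. -/

section SecondDifferences

open PowerSeries

noncomputable section

/-- The recurrence rewritten: a second difference gains a factor `1/k` over the values and their
first differences. This turns decay `k^(-1/8)` into the summable `k^(-9/8)`. -/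
theorem lag_second_difference (x : ℝ) (k : ℕ) :
    lag x (k + 2) - 2 * lag x (k + 1) + lag x k
      = -(x * lag x (k + 1) + (lag x (k + 1) - lag x k)) / ((k : ℝ) + 2) := by
  have h1 := lag_succ_mul x k
  have h2 := lag_succ_mul x (k + 1)
  have h3 := lagDiff_succ x (k + 1)
  rw [eq_div_iff (by positivity)]
  push_cast at h2
  linear_combination h2 + h3 - h1

/-- The series `(1 + X)² ∑ (-1)^k L_k(x) X^k` of alternating second differences. -/
def altSecondSeries (x : ℝ) : ℝ⟦X⟧ := (1 + X) ^ 2 * altLagSeries x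

/-- The series `(1 - X)² ∑ L_k(s) X^k` of second differences. -/
def secondSeries (s : ℝ) : ℝ⟦X⟧ := (1 - X) ^ 2 * lagSeries s

theorem coeff_zero_altSecondSeries (x : ℝ) : coeff 0 (altSecondSeries x) = 1 := by
  simp [altSecondSeries, altLagSeries, lag_zero]

theorem coeff_one_altSecondSeries (x : ℝ) : coeff 1 (altSecondSeries x) = 1 + x := by
  have e : altSecondSeries x = altLagSeries x + (X * altLagSeries x + X * altLagSeries x)
      + X * (X * altLagSeries x) := by
    rw [altSecondSeries]; ring
  rw [e, show (1 : ℕ) = 0 + 1 from rfl]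
  simp only [map_add, coeff_succ_X_mul, coeff_zero_X_mul, altLagSeries, coeff_mk, lag_zero]
  norm_num [lag_one]
  ring

theorem coeff_add_two_altSecondSeries (x : ℝ) (k : ℕ) :
    coeff (k + 2) (altSecondSeries x)
      = (-1) ^ k * (lag x (k + 2) - 2 * lag x (k + 1) + lag x k) := by
  have e : altSecondSeries x = altLagSeries x + (X * altLagSeries x + X * altLagSeries x)
      + X * (X * altLagSeries x) := by
    rw [altSecondSeries]; ring
  rw [e]
  simp only [map_add, coeff_succ_X_mul, altLagSeries, coeff_mk]
  ring

theorem abs_coeff_secondSeries_le {s : ℝ} (hs0 : 0 ≤ s) (hs : s ≤ 1 / 2) (k : ℕ) :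
    |coeff k (secondSeries s)| ≤ 4 / ((k : ℝ) + 1) := by
  have e : secondSeries s = lagSeries s - (X * lagSeries s + X * lagSeries s)
      + X * (X * lagSeries s) := by
    rw [secondSeries]; ring
  rw [e]
  rcases k with _ | _ | k
  · simp only [map_add, map_sub, coeff_zero_X_mul, lagSeries, coeff_mk, lag_zero]
    norm_num
  · simp only [map_add, map_sub, coeff_succ_X_mul, coeff_zero_X_mul, lagSeries, coeff_mk, lag_zero]
    norm_num [lag_one]
    rw [abs_le]
    constructor <;> linarith
  · have h1 : coeff (k + 1 + 1) (lagSeries s - (X * lagSeries s + X * lagSeries s)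
        + X * (X * lagSeries s))
        = -(s * lag s (k + 1) + (lag s (k + 1) - lag s k)) / ((k : ℝ) + 2) := by
      simp only [map_add, map_sub, coeff_succ_X_mul, lagSeries, coeff_mk]
      rw [← lag_second_difference]
      ring
    have h2 : |lag s (k + 1) - lag s k| ≤ 1 := by
      refine (abs_lag_succ_sub_le hs0 hs k).trans ?_
      rw [div_le_one (by positivity)]
      exact Real.one_le_sqrt.2 (by linarith [(Nat.cast_nonneg k : (0 : ℝ) ≤ k)])
    have h3 := abs_lag_le_one hs0 hs (k + 1)
    have h4 : |s * lag s (k + 1) + (lag s (k + 1) - lag s k)| ≤ 2 := by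
      refine (abs_add_le _ _).trans ?_
      rw [abs_mul, abs_of_nonneg hs0]
      nlinarith [abs_nonneg (lag s (k + 1))]
    rw [h1, abs_div, abs_neg, abs_of_nonneg (by positivity : (0 : ℝ) ≤ (k : ℝ) + 2)]
    push_cast
    rw [div_le_div_iff₀ (by positivity) (by positivity)]
    have h0 : (0 : ℝ) ≤ k := by positivity
    nlinarith

/-- Multiplication by `(1 + X)²` takes second differences of the alternating sequence, up to sign.
By `lag_second_difference` and `exists_lag_decay` they are `O(k^(-9/8))`, uniformly in `x ∈ [1, 2]`.
-/
theorem exists_summable_altSecondSeries_bound : ∃ τ : ℕ → ℝ, Summable τ ∧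
    ∀ k : ℕ, ∀ x : ℝ, 1 ≤ x → x ≤ 2 → |coeff k (altSecondSeries x)| ≤ τ k := by
  obtain ⟨M, hM, h⟩ := exists_lag_decay
  have hsum : Summable fun k : ℕ => 3 * M * (1 / ((k + 1 : ℕ) : ℝ) ^ (9 / 8 : ℝ)) :=
    ((summable_nat_add_iff 1).2 (Real.summable_one_div_nat_rpow.2 (by norm_num))).mul_left _
  refine ⟨fun k => match k with
    | 0 => 1
    | 1 => 3
    | k + 2 => 3 * M * (1 / ((k + 1 : ℕ) : ℝ) ^ (9 / 8 : ℝ)),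
    (summable_nat_add_iff 2).1 hsum, fun k x h1 h2 => ?_⟩
  rcases k with _ | _ | k
  · simp [coeff_zero_altSecondSeries]
  · change |coeff 1 (altSecondSeries x)| ≤ 3
    rw [coeff_one_altSecondSeries, abs_le]
    constructor <;> linarith
  · change |coeff (k + 2) (altSecondSeries x)| ≤ 3 * M * (1 / ((k + 1 : ℕ) : ℝ) ^ (9 / 8 : ℝ))
    rw [coeff_add_two_altSecondSeries, lag_second_difference, abs_mul, abs_pow, abs_neg, abs_one,
      one_pow, one_mul, abs_div, abs_neg, abs_of_nonneg (by positivity : (0 : ℝ) ≤ (k : ℝ) + 2)]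
    have h3 : |x * lag x (k + 1) + (lag x (k + 1) - lag x k)|
        ≤ 3 * M * ((k : ℝ) + 1) ^ (-(1 / 8) : ℝ) := by
      calc |x * lag x (k + 1) + (lag x (k + 1) - lag x k)|
          ≤ |x * lag x (k + 1)| + |lag x (k + 1) - lag x k| := abs_add_le _ _
        _ ≤ 2 * (M * (((k + 1 : ℕ) : ℝ) + 1) ^ (-(1 / 8) : ℝ))
            + M * ((k : ℝ) + 1) ^ (-(1 / 8) : ℝ) := by
          rw [abs_mul, abs_of_nonneg (by linarith : 0 ≤ x)]
          gcongr
          · exact (h _ x h1 h2).1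
          · exact (h _ x h1 h2).2
        _ ≤ 2 * (M * ((k : ℝ) + 1) ^ (-(1 / 8) : ℝ))
            + M * ((k : ℝ) + 1) ^ (-(1 / 8) : ℝ) := by
          gcongr 2 * (M * ?_) + _
          refine Real.rpow_le_rpow_of_nonpos (by positivity) ?_ (by norm_num)
          push_cast
          linarith
        _ = _ := by ring
    calc |x * lag x (k + 1) + (lag x (k + 1) - lag x k)| / ((k : ℝ) + 2)
        ≤ 3 * M * ((k : ℝ) + 1) ^ (-(1 / 8) : ℝ) / ((k : ℝ) + 1) := by
          gcongr
          norm_num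
      _ = _ := by
          rw [Real.rpow_neg (by positivity), show (9 / 8 : ℝ) = 1 / 8 + 1 by norm_num,
            Real.rpow_add (by positivity), Real.rpow_one]
          push_cast
          field_simp

/-- The equation of `(1 + X) exp(xX / (1 + X))`. -/
theorem altSecondSeries_ode (x : ℝ) :
    (1 + X) ^ 2 * d⁄dX ℝ (altSecondSeries x) = ((1 + X) + C x) * altSecondSeries x := by
  have h := altLagSeries_ode x
  have e : d⁄dX ℝ ((1 + X : ℝ⟦X⟧) ^ 2) = 2 * (1 + X) := by
    rw [pow_two, Derivation.leibniz]
    simp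
    ring
  rw [altSecondSeries, Derivation.leibniz, e]
  simp only [smul_eq_mul]
  linear_combination (1 + X) ^ 2 * h

/-- The value at `1` of `∑ (1 + X)² (-1)^k L_k(x) X^k`. -/
theorem tsum_coeff_altSecondSeries {x : ℝ} (hx1 : 1 ≤ x) (hx2 : x ≤ 2) :
    ∑' k, coeff k (altSecondSeries x) = 2 * Real.exp (x / 2) := by
  obtain ⟨τ, hτ, hb⟩ := exists_summable_altSecondSeries_bound
  set D := altSecondSeries x with hD
  have hτ0 : ∀ k, 0 ≤ τ k := fun k => (abs_nonneg _).trans (hb k x hx1 hx2)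
  have hM : ∀ k, |coeff k D| ≤ ∑' j, τ j := fun k =>
    (hb k x hx1 hx2).trans (hτ.le_tsum k fun j _ => hτ0 j)
  set f : ℝ → ℝ := fun z => ∑' k, coeff k D * z ^ k with hf
  have hterm : ∀ (k : ℕ), ∀ z ∈ Set.Icc (0 : ℝ) 1, ‖coeff k D * z ^ k‖ ≤ τ k := by
    intro k z hz
    rw [norm_mul, Real.norm_eq_abs, norm_pow, Real.norm_of_nonneg hz.1]
    exact (mul_le_of_le_one_right (abs_nonneg _) (pow_le_one₀ hz.1 hz.2)).trans (hb k x hx1 hx2)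
  have hcont : ContinuousOn f (Set.Icc 0 1) :=
    continuousOn_tsum (fun k => by fun_prop) hτ hterm
  have hode : ∀ r ∈ Set.Ico (0 : ℝ) 1,
      HasDerivAt f ((1 + r + x) / (1 + r) ^ 2 * f r) r := by
    intro r hr
    obtain ⟨g, hg, hder⟩ := PowerSeries.hasDerivAt_tsum_of_bounded hM (r := r)
      (by rw [abs_of_nonneg hr.1]; exact hr.2)
    have hfr : HasSum (fun k => coeff k D * r ^ k) (f r) :=
      (Summable.of_norm_bounded hτ fun k => hterm k r ⟨hr.1, hr.2.le⟩).hasSum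
    have h1 := PowerSeries.hasSum_X_mul hg
    have h2 := PowerSeries.hasSum_add (PowerSeries.hasSum_add hg (PowerSeries.hasSum_add h1 h1))
      (PowerSeries.hasSum_X_mul h1)
    have h3 := PowerSeries.hasSum_add (PowerSeries.hasSum_add hfr (PowerSeries.hasSum_C_mul x hfr))
      (PowerSeries.hasSum_X_mul hfr)
    have e : d⁄dX ℝ D + (X * d⁄dX ℝ D + X * d⁄dX ℝ D) + X * (X * d⁄dX ℝ D)
        = D + C x * D + X * D := by
      linear_combination altSecondSeries_ode x
    rw [e] at h2
    have h4 := h2.unique h3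
    have hr0 : (0 : ℝ) < 1 + r := by linarith [hr.1]
    have h5 : g = (1 + r + x) / (1 + r) ^ 2 * f r := by
      field_simp
      linear_combination h4
    rwa [← h5]
  -- By the differential equation `f(r) exp(-xr/(1 + r)) / (1 + r)` is constant on `[0, 1]`; it
  -- equals `1` at `r = 0`. Absolute summability makes `f` continuous up to `r = 1`, where the
  -- differential equation itself is not available.
  have hconst := constant_of_has_deriv_right_zero
    (f := fun r => f r * (Real.exp (-(x * r / (1 + r))) / (1 + r))) (a := 0) (b := 1) ?_ ?_ 1
    (by simp)
  · have f0 : f 0 = 1 := by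
      rw [hf]
      simp only
      rw [tsum_eq_single 0 (fun k hk => by rw [zero_pow hk, mul_zero])]
      rw [pow_zero, mul_one, hD, coeff_zero_altSecondSeries]
    have f1 : f 1 = ∑' k, coeff k D := by simp [hf]
    simp only [f0] at hconst
    rw [← f1]
    norm_num [Real.exp_neg] at hconst
    field_simp at hconst
    linarith
  · refine hcont.mul (ContinuousOn.div ?_ (by fun_prop) fun r hr => ?_)
    · refine Real.continuous_exp.comp_continuousOn (ContinuousOn.neg
        (ContinuousOn.div (by fun_prop) (by fun_prop) fun r hr => ?_))
      linarith [hr.1]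
    · linarith [hr.1]
  · intro r hr
    have hr0 : (1 + r) ≠ 0 := by linarith [hr.1]
    have h1 : HasDerivAt (fun r : ℝ => 1 + r) 1 r := (hasDerivAt_id r).const_add 1
    have h2 : HasDerivAt (fun r : ℝ => x * r) x r := by
      simpa using (hasDerivAt_id r).const_mul x
    have h3 := (hode r hr).mul (((h2.div h1 hr0).neg.exp).div h1 hr0)
    refine (h3.congr_deriv ?_).hasDerivWithinAt
    simp only [Pi.neg_apply, Pi.div_apply]
    field_simp
    ring

end

end SecondDifferences

/-! ### Uniform asymptotics of the planar coefficients. -/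

section PlanarAsymptotics

open PowerSeries Filter Topology

noncomputable section

theorem coeff_mul_lagSeries (F : ℝ⟦X⟧) (s : ℝ) (n : ℕ) :
    coeff n (F * lagSeries s) = ∑ k ∈ Finset.range (n + 1), coeff k F * lag s (n - k) := by
  rw [coeff_mul, Finset.Nat.sum_antidiagonal_eq_sum_range_succ_mk]
  simp [lagSeries]

theorem abs_lag_add_sub_le {s : ℝ} (hs0 : 0 ≤ s) (hs : s ≤ 1 / 2) (m k : ℕ) :
    |lag s m - lag s (m + k)| ≤ k * (1 / Real.sqrt (m + 1)) := by
  induction k with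
  | zero => simp
  | succ k ih =>
    have h1 := abs_lag_succ_sub_le hs0 hs (m + k)
    have h2 : 1 / Real.sqrt (((m + k : ℕ) : ℝ) + 1) ≤ 1 / Real.sqrt (m + 1) := by
      gcongr
      simp
    calc |lag s m - lag s (m + (k + 1))|
        = |(lag s m - lag s (m + k)) - (lag s (m + k + 1) - lag s (m + k))| := by
          rw [← add_assoc]; ring_nf
      _ ≤ _ := abs_sub _ _
      _ ≤ k * (1 / Real.sqrt (m + 1)) + 1 / Real.sqrt (m + 1) := by linarith
      _ = _ := by push_cast; ring

/-- A summable sequence convolved with the bounded, slowly varying `lag s` behaves like its total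
sum times `lag s n`; the sum is `tsum_coeff_altSecondSeries` at `x = 2 - s`. -/
theorem coeff_altSecondSeries_mul_lagSeries_asymp {ε : ℝ} (hε : 0 < ε) :
    ∃ N : ℕ, ∀ n ≥ N, ∀ s : ℝ, 0 ≤ s → s ≤ 1 / 2 →
      |coeff n (altSecondSeries (2 - s) * lagSeries s)
        - 2 * Real.exp ((2 - s) / 2) * lag s n| ≤ ε := by
  obtain ⟨τ, hτ, hb⟩ := exists_summable_altSecondSeries_bound
  -- Convergence along this product filter is convergence in `n` uniformly in `s`, so dominated
  -- convergence yields the uniform statement directly.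
  set 𝓕 : Filter (ℕ × ℝ) := atTop ×ˢ 𝓟 (Set.Icc 0 (1 / 2)) with h𝓕
  have hmem : ∀ᶠ p in 𝓕, p.2 ∈ Set.Icc (0 : ℝ) (1 / 2) :=
    tendsto_snd.eventually (mem_principal_self _)
  have hD : ∀ p : ℕ × ℝ, p.2 ∈ Set.Icc (0 : ℝ) (1 / 2) → ∀ k,
      |coeff k (altSecondSeries (2 - p.2))| ≤ τ k := fun p hp k =>
    hb k _ (by linarith [hp.2]) (by linarith [hp.1])
  set f : ℕ × ℝ → ℕ → ℝ := fun p k => coeff k (altSecondSeries (2 - p.2)) *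
    ((if k < p.1 + 1 then lag p.2 (p.1 - k) else 0) - lag p.2 p.1) with hf
  have ht : Tendsto (fun p => ∑' k, f p k) 𝓕 (𝓝 (∑' _ : ℕ, (0 : ℝ))) := by
    refine tendsto_tsum_of_dominated_convergence (bound := fun k => τ k * 2) (hτ.mul_right 2)
      (fun k => ?_) ?_
    · have h0 : Tendsto (fun p : ℕ × ℝ => τ k * (k * (1 / Real.sqrt (((p.1 - k : ℕ) : ℝ) + 1))))
          𝓕 (𝓝 (τ k * (k * 0))) := by
        refine Tendsto.const_mul _ (Tendsto.const_mul _ ?_)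
        have h1 : Tendsto (fun n : ℕ => 1 / Real.sqrt (((n - k : ℕ) : ℝ) + 1)) atTop (𝓝 0) := by
          refine tendsto_const_nhds.div_atTop (Real.tendsto_sqrt_atTop.comp ?_)
          exact tendsto_atTop_add_const_right _ _
            (tendsto_natCast_atTop_atTop.comp (tendsto_sub_atTop_nat k))
        exact h1.comp tendsto_fst
      rw [mul_zero, mul_zero] at h0
      refine squeeze_zero_norm' ?_ h0
      have hge : ∀ᶠ p in 𝓕, k ≤ p.1 := tendsto_fst.eventually (eventually_ge_atTop k)
      filter_upwards [hmem, hge] with p hp hk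
      rw [hf]
      simp only
      rw [if_pos (by omega), norm_mul, Real.norm_eq_abs, Real.norm_eq_abs]
      have h3 := abs_lag_add_sub_le hp.1 hp.2 (p.1 - k) k
      rw [Nat.sub_add_cancel hk] at h3
      exact mul_le_mul (hD p hp k) h3 (abs_nonneg _) ((abs_nonneg _).trans (hD p hp k))
    · filter_upwards [hmem] with p hp k
      rw [hf]
      simp only
      rw [norm_mul, Real.norm_eq_abs, Real.norm_eq_abs]
      refine mul_le_mul (hD p hp k) ?_ (abs_nonneg _) ((abs_nonneg _).trans (hD p hp k))
      have h1 := abs_lag_le_one hp.1 hp.2 p.1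
      split_ifs
      · have h2 := abs_lag_le_one hp.1 hp.2 (p.1 - k)
        exact (abs_sub _ _).trans (by linarith)
      · rw [zero_sub, abs_neg]
        linarith
  rw [tsum_zero] at ht
  have hev := (Metric.tendsto_nhds.1 ht ε hε)
  rw [h𝓕, eventually_prod_principal_iff] at hev
  obtain ⟨N, hN⟩ := eventually_atTop.1 hev
  refine ⟨N, fun n hn s hs0 hs => ?_⟩
  have h1 := hN n hn s ⟨hs0, hs⟩
  rw [dist_zero_right, Real.norm_eq_abs] at h1
  refine le_of_eq_of_le ?_ h1.le
  congr 1
  have hsum : Summable fun k => coeff k (altSecondSeries (2 - s)) :=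
    Summable.of_norm_bounded hτ fun k => hb k _ (by linarith) (by linarith)
  have hfin : HasSum (fun k => if k < n + 1 then
      coeff k (altSecondSeries (2 - s)) * lag s (n - k) else 0)
      (coeff n (altSecondSeries (2 - s) * lagSeries s)) := by
    rw [coeff_mul_lagSeries]
    rw [Finset.sum_congr rfl fun k hk => (if_pos (c := k < n + 1) (Finset.mem_range.1 hk)
      (t := coeff k (altSecondSeries (2 - s)) * lag s (n - k)) (e := 0)).symm]
    exact hasSum_sum_of_ne_finset_zero fun k hk => if_neg (by simpa using hk)
  have h2 := hfin.sub (hsum.hasSum.mul_right (lag s n))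
  rw [tsum_coeff_altSecondSeries (by linarith) (by linarith)] at h2
  rw [← h2.tsum_eq]
  refine tsum_congr fun k => ?_
  rw [hf]
  simp only
  split_ifs <;> ring

theorem sum_antidiagonal_inv_le (n : ℕ) :
    ∑ p ∈ Finset.HasAntidiagonal.antidiagonal n, (1 / ((p.1 : ℝ) + 1) + 1 / ((p.2 : ℝ) + 1))
      ≤ 2 * (1 + Real.log (n + 1)) := by
  have h := harmonic_le_one_add_log (n + 1)
  have h1 : ∑ p ∈ Finset.HasAntidiagonal.antidiagonal n, 1 / ((p.1 : ℝ) + 1) = (harmonic (n + 1) : ℝ) := by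
    rw [Finset.Nat.sum_antidiagonal_eq_sum_range_succ_mk, harmonic]
    push_cast
    exact Finset.sum_congr rfl fun k _ => by rw [one_div]
  have h2 : ∑ p ∈ Finset.HasAntidiagonal.antidiagonal n, 1 / ((p.2 : ℝ) + 1)
      = ∑ p ∈ Finset.HasAntidiagonal.antidiagonal n, 1 / ((p.1 : ℝ) + 1) :=
    Finset.Nat.sum_antidiagonal_swap (f := fun p : ℕ × ℕ => 1 / ((p.1 : ℝ) + 1))
  rw [Finset.sum_add_distrib, h2, h1]
  push_cast at h ⊢
  linarith

/-- The larger of `a` and `b` is at least `m / 2`, so the factor `m^(-1/8)` can be extracted in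
either case; the rest is summable along the antidiagonal to a logarithm. -/
theorem rpow_div_le_of_add_eq {a b m : ℝ} (ha : 1 ≤ a) (hb : 1 ≤ b) (hm : a + b = m) :
    a ^ (-(1 / 8) : ℝ) / b ≤ 2 * m ^ (-(1 / 8) : ℝ) * (1 / a + 1 / b) := by
  have ha0 : 0 < a := by linarith
  have hb0 : 0 < b := by linarith
  have hm0 : 0 < m := by linarith
  rcases le_total a b with h | h
  · have e : ∀ c : ℝ, 0 < c → c ^ (-(1 / 8) : ℝ) = c ^ (7 / 8 : ℝ) * (1 / c) := by
      intro c hc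
      rw [show (-(1 / 8) : ℝ) = 7 / 8 - 1 by norm_num, Real.rpow_sub hc, Real.rpow_one]
      ring
    have h1 : a ^ (7 / 8 : ℝ) ≤ m ^ (7 / 8 : ℝ) := by
      gcongr
      linarith
    have h2 : 1 / b ≤ 2 * (1 / m) := by
      rw [← mul_div_assoc, mul_one, div_le_div_iff₀ hb0 hm0]
      linarith
    calc a ^ (-(1 / 8) : ℝ) / b = a ^ (7 / 8 : ℝ) * (1 / a) * (1 / b) := by
          rw [e a ha0]
          ring
      _ ≤ m ^ (7 / 8 : ℝ) * (1 / a) * (2 * (1 / m)) := by gcongr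
      _ = 2 * m ^ (-(1 / 8) : ℝ) * (1 / a) := by
          rw [e m hm0]
          ring
      _ ≤ _ := by
          gcongr
          have : 0 < 1 / b := by positivity
          linarith
  · have h1 : a ^ (-(1 / 8) : ℝ) ≤ 2 * m ^ (-(1 / 8) : ℝ) := by
      rw [Real.rpow_neg ha0.le, Real.rpow_neg hm0.le, ← div_eq_mul_inv, inv_eq_one_div,
        div_le_div_iff₀ (by positivity) (by positivity), one_mul]
      calc m ^ (1 / 8 : ℝ) ≤ (2 * a) ^ (1 / 8 : ℝ) := by
            gcongr
            linarith
        _ = 2 ^ (1 / 8 : ℝ) * a ^ (1 / 8 : ℝ) := Real.mul_rpow (by norm_num) ha0.le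
        _ ≤ 2 * a ^ (1 / 8 : ℝ) := by
            gcongr
            exact Real.rpow_le_self_of_one_le (by norm_num) (by norm_num)
    rw [div_eq_mul_one_div]
    gcongr
    have : 0 < 1 / a := by positivity
    linarith

/-- A convolution of `O(k^(-1/8))` with `O(1/k)` is `O(n^(-1/8) log n)`. -/
theorem coeff_altLagSeries_mul_secondSeries_asymp {ε : ℝ} (hε : 0 < ε) :
    ∃ N : ℕ, ∀ n ≥ N, ∀ s : ℝ, 0 ≤ s → s ≤ 1 / 2 →
      |coeff n (altLagSeries (2 - s) * secondSeries s)| ≤ ε := by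
  obtain ⟨M, hM, h⟩ := exists_lag_decay
  have hbound : ∀ n : ℕ, ∀ s : ℝ, 0 ≤ s → s ≤ 1 / 2 →
      |coeff n (altLagSeries (2 - s) * secondSeries s)|
        ≤ 16 * M * ((1 + Real.log ((n : ℝ) + 2)) * ((n : ℝ) + 2) ^ (-(1 / 8) : ℝ)) := by
    intro n s hs0 hs
    rw [coeff_mul]
    calc |∑ p ∈ Finset.HasAntidiagonal.antidiagonal n,
          coeff p.1 (altLagSeries (2 - s)) * coeff p.2 (secondSeries s)|
        ≤ ∑ p ∈ Finset.HasAntidiagonal.antidiagonal n,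
          |coeff p.1 (altLagSeries (2 - s)) * coeff p.2 (secondSeries s)| :=
          Finset.abs_sum_le_sum_abs _ _
      _ ≤ ∑ p ∈ Finset.HasAntidiagonal.antidiagonal n, 8 * M * ((n : ℝ) + 2) ^ (-(1 / 8) : ℝ)
          * (1 / ((p.1 : ℝ) + 1) + 1 / ((p.2 : ℝ) + 1)) := by
          refine Finset.sum_le_sum fun p hp => ?_
          have hp' : (p.1 : ℝ) + p.2 = n := by
            exact_mod_cast Finset.HasAntidiagonal.mem_antidiagonal.1 hp
          rw [abs_mul]
          have h1 : |coeff p.1 (altLagSeries (2 - s))|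
              ≤ M * ((p.1 : ℝ) + 1) ^ (-(1 / 8) : ℝ) := by
            rw [altLagSeries, coeff_mk, abs_mul, abs_pow, abs_neg, abs_one, one_pow, one_mul]
            exact (h p.1 _ (by linarith) (by linarith)).1
          have h2 := abs_coeff_secondSeries_le hs0 hs p.2
          have h3 := rpow_div_le_of_add_eq (a := (p.1 : ℝ) + 1) (b := (p.2 : ℝ) + 1)
            (m := (n : ℝ) + 2) (by simp) (by simp) (by linarith)
          calc _ ≤ M * ((p.1 : ℝ) + 1) ^ (-(1 / 8) : ℝ) * (4 / ((p.2 : ℝ) + 1)) := by gcongr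
            _ = 4 * M * (((p.1 : ℝ) + 1) ^ (-(1 / 8) : ℝ) / ((p.2 : ℝ) + 1)) := by ring
            _ ≤ 4 * M * (2 * ((n : ℝ) + 2) ^ (-(1 / 8) : ℝ)
                * (1 / ((p.1 : ℝ) + 1) + 1 / ((p.2 : ℝ) + 1))) := by gcongr
            _ = _ := by ring
      _ ≤ 8 * M * ((n : ℝ) + 2) ^ (-(1 / 8) : ℝ) * (2 * (1 + Real.log (n + 1))) := by
          rw [← Finset.mul_sum]
          gcongr
          exact sum_antidiagonal_inv_le n
      _ ≤ 8 * M * ((n : ℝ) + 2) ^ (-(1 / 8) : ℝ) * (2 * (1 + Real.log (n + 2))) := by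
          gcongr
          norm_num
      _ = _ := by ring
  have hlim : Tendsto (fun x : ℝ => 16 * M * ((1 + Real.log x) * x ^ (-(1 / 8) : ℝ))) atTop
      (𝓝 (16 * M * (0 + 0))) := by
    refine Tendsto.const_mul _ ?_
    have h1 : Tendsto (fun x : ℝ => x ^ (-(1 / 8) : ℝ)) atTop (𝓝 0) :=
      tendsto_rpow_neg_atTop (by norm_num)
    have h2 : Tendsto (fun x : ℝ => Real.log x / x ^ (1 / 8 : ℝ)) atTop (𝓝 0) :=
      (isLittleO_log_rpow_atTop (by norm_num : (0 : ℝ) < 1 / 8)).tendsto_div_nhds_zero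
    refine (h1.add h2).congr' ?_
    filter_upwards [eventually_gt_atTop 0] with x hx
    rw [Real.rpow_neg hx.le]
    ring
  rw [add_zero, mul_zero] at hlim
  have h2 : Tendsto (fun n : ℕ => (n : ℝ) + 2) atTop atTop :=
    tendsto_atTop_add_const_right _ _ tendsto_natCast_atTop_atTop
  obtain ⟨N, hN⟩ := eventually_atTop.1 ((hlim.comp h2).eventually (ge_mem_nhds hε))
  exact ⟨N, fun n hn s hs0 hs => (hbound n s hs0 hs).trans (hN n hn)⟩

/-- The coefficients of the planar series are asymptotically Laguerre functions, uniformly. -/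
theorem coeff_planarSeries_asymp {ε : ℝ} (hε : 0 < ε) :
    ∃ N : ℕ, ∀ n ≥ N, ∀ s : ℝ, 0 ≤ s → s ≤ 1 / 2 →
      |coeff n (planarSeries s) - Real.exp (1 - s / 2) / 2 * lag s n| ≤ ε := by
  obtain ⟨N₁, h₁⟩ := coeff_altSecondSeries_mul_lagSeries_asymp (ε := ε / 2) (by positivity)
  obtain ⟨N₂, h₂⟩ := coeff_altLagSeries_mul_secondSeries_asymp (ε := ε / 4) (by positivity)
  obtain ⟨N₃, h₃⟩ : ∃ N₃ : ℕ, ∀ n ≥ N₃, 1 / Real.sqrt (n + 1) ≤ ε / 6 := by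
    have : Tendsto (fun n : ℕ => 1 / Real.sqrt ((n : ℝ) + 1)) atTop (𝓝 0) :=
      tendsto_const_nhds.div_atTop (Real.tendsto_sqrt_atTop.comp
        (tendsto_atTop_add_const_right _ _ tendsto_natCast_atTop_atTop))
    exact eventually_atTop.1 (this.eventually (ge_mem_nhds (by positivity)))
  refine ⟨N₁ + N₂ + N₃ + 1, fun n hn s hs0 hs => ?_⟩
  obtain ⟨m, rfl⟩ : ∃ m, n = m + 1 := ⟨n - 1, by omega⟩
  -- The identity `4 = (2 - X)(1 + X)² + (2 + X)(1 - X)²` splits the series into a part with the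
  -- singularity at `-1` tamed and a part with the singularity at `1` tamed. The first gives the
  -- main term, since `2 lag s (m + 1) - lag s m` is close to `lag s (m + 1)`.
  have e : planarSeries s + planarSeries s + planarSeries s + planarSeries s
      = altSecondSeries (2 - s) * lagSeries s + altSecondSeries (2 - s) * lagSeries s
        - X * (altSecondSeries (2 - s) * lagSeries s)
        + (altLagSeries (2 - s) * secondSeries s + altLagSeries (2 - s) * secondSeries s)
        + X * (altLagSeries (2 - s) * secondSeries s) := by
    rw [planarSeries, altSecondSeries, secondSeries]
    ring
  have e2 := congrArg (coeff (m + 1)) e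
  simp only [map_add, map_sub, coeff_succ_X_mul] at e2
  have a1 := h₁ (m + 1) (by omega) s hs0 hs
  have a2 := h₁ m (by omega) s hs0 hs
  have a3 := h₂ (m + 1) (by omega) s hs0 hs
  have a4 := h₂ m (by omega) s hs0 hs
  have a5 := (abs_lag_succ_sub_le hs0 hs m).trans (h₃ m (by omega))
  rw [show (2 - s) / 2 = 1 - s / 2 by ring] at a1 a2
  set q := Real.exp (1 - s / 2) with hq
  have hq0 : 0 < q := Real.exp_pos _
  have hq3 : q ≤ 3 := by
    have : q ≤ Real.exp 1 := Real.exp_le_exp.2 (by linarith)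
    linarith [Real.exp_one_lt_d9]
  have a6 : |q * (lag s (m + 1) - lag s m)| ≤ ε / 2 := by
    rw [abs_mul, abs_of_pos hq0]
    calc q * |lag s (m + 1) - lag s m| ≤ 3 * (ε / 6) := by gcongr
      _ = ε / 2 := by ring
  rw [abs_le] at a1 a2 a3 a4 a6 ⊢
  constructor <;> linarith [a1.1, a1.2, a2.1, a2.2, a3.1, a3.2, a4.1, a4.2, a6.1, a6.2]

theorem exists_coeff_planarSeries_zero_le : ∃ M : ℝ, 0 < M ∧ ∀ n,
    coeff n (planarSeries 0) ≤ M := by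
  obtain ⟨N, hN⟩ := coeff_planarSeries_asymp (ε := 1) one_pos
  refine ⟨3 + ∑ k ∈ Finset.range N, |coeff k (planarSeries 0)|, by positivity, fun n => ?_⟩
  rcases Nat.lt_or_ge n N with h | h
  · have h1 := Finset.single_le_sum (f := fun k => |coeff k (planarSeries 0)|)
      (fun k _ => abs_nonneg _) (Finset.mem_range.2 h)
    linarith [le_abs_self (coeff n (planarSeries 0))]
  · have h1 := (abs_le.1 (hN n h 0 le_rfl (by norm_num))).2
    rw [lag_zero_left] at h1
    have h2 : 0 ≤ ∑ k ∈ Finset.range N, |coeff k (planarSeries 0)| := by positivity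
    norm_num at h1
    linarith [Real.exp_one_lt_d9]

theorem exists_coeff_planarSeries_gap : ∃ N : ℕ, ∀ n ≥ N, ∀ s : ℝ, 0 ≤ s → s ≤ 1 / 2 →
    1 ≤ n * s → 1 / 200 ≤ coeff n (planarSeries 0) - coeff n (planarSeries s) := by
  obtain ⟨N, hN⟩ := coeff_planarSeries_asymp (ε := 1 / 1000) (by norm_num)
  refine ⟨N, fun n hn s hs0 hs hns => ?_⟩
  have h1 := (abs_le.1 (hN n hn 0 le_rfl (by norm_num))).1
  have h2 := (abs_le.1 (hN n hn s hs0 hs)).2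
  have h3 := (le_abs_self _).trans (abs_lag_le_of_one_le_mul hs0 hs hns)
  rw [lag_zero_left] at h1
  norm_num at h1
  have h4 : Real.exp (1 - s / 2) ≤ Real.exp 1 := Real.exp_le_exp.2 (by linarith)
  -- The main terms differ by at least `(e/2)/128 > 0.01`; the two errors cost at most `2/1000`.
  have h5 : Real.exp (1 - s / 2) / 2 * lag s n ≤ Real.exp 1 / 2 * (127 / 128) := by
    have := Real.exp_pos (1 - s / 2)
    calc Real.exp (1 - s / 2) / 2 * lag s n ≤ Real.exp (1 - s / 2) / 2 * (127 / 128) := by gcongr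
      _ ≤ _ := by gcongr
  linarith [Real.exp_one_gt_d9]

end

end PlanarAsymptotics

/-! ### The Mehler kernel as an inner product of feature vectors. -/

section HermiteFeatures

open PowerSeries

noncomputable section

/-- The product of normalised Hermite polynomials of degrees `a i`. -/
def hermiteFeature {d : ℕ} (a : Fin d →₀ ℕ) (x : Fin d → ℝ) : ℝ :=
  ∏ i, (hermiteH (a i)).eval (x i) / Real.sqrt (2 ^ a i * (a i).factorial)

theorem hermiteFeature_mul {d : ℕ} (a : Fin d →₀ ℕ) (x y : Fin d → ℝ) :
    hermiteFeature a x * hermiteFeature a y = ∏ i, mehlerCoeff (x i) (y i) (a i) := by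
  rw [hermiteFeature, hermiteFeature, ← Finset.prod_mul_distrib]
  refine Finset.prod_congr rfl fun i _ => ?_
  rw [div_mul_div_comm, Real.mul_self_sqrt (by positivity), mehlerCoeff]

variable {d : ℕ} {x y : Fin d → ℝ} {s : ℝ}

theorem sum_hermiteFeature_mul (hd : 2 ≤ d) (hx : ∑ i, x i ^ 2 = 1) (hy : ∑ i, y i ^ 2 = 1)
    (hxy : ∑ i, x i * y i = 1 - s) (n : ℕ) :
    ∑ a ∈ Finset.finsuppAntidiag Finset.univ n, hermiteFeature a x * hermiteFeature a y
      = coeff n (planarSeries s * mehlerSeries 0 0 ^ (d - 2)) := by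
  simp only [hermiteFeature_mul]
  exact sum_prod_mehlerCoeff hd hx hy hxy n

theorem sum_hermiteFeature_sq (hd : 2 ≤ d) (hx : ∑ i, x i ^ 2 = 1) (n : ℕ) :
    ∑ a ∈ Finset.finsuppAntidiag Finset.univ n, hermiteFeature a x ^ 2
      = coeff n (planarSeries 0 * mehlerSeries 0 0 ^ (d - 2)) := by
  simp only [sq]
  exact sum_hermiteFeature_mul hd hx hx (by simpa [sq] using hx) n

/-- Expanding the square: both diagonal terms equal the coefficient at `s = 0`, since they are the
same at every unit vector. -/
theorem sum_hermiteFeature_sub_sq (hd : 2 ≤ d) (hx : ∑ i, x i ^ 2 = 1) (hy : ∑ i, y i ^ 2 = 1)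
    (hxy : ∑ i, x i * y i = 1 - s) (n : ℕ) :
    ∑ a ∈ Finset.finsuppAntidiag Finset.univ n, (hermiteFeature a x - hermiteFeature a y) ^ 2
      = 2 * coeff n ((planarSeries 0 - planarSeries s) * mehlerSeries 0 0 ^ (d - 2)) := by
  rw [sub_mul, map_sub, ← sum_hermiteFeature_mul hd hx hy hxy n]
  have h1 := sum_hermiteFeature_sq hd hx n
  have h2 := sum_hermiteFeature_sq hd hy n
  have h3 : ∑ a ∈ Finset.finsuppAntidiag Finset.univ n,
      (hermiteFeature a x - hermiteFeature a y) ^ 2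
      = ∑ a ∈ Finset.finsuppAntidiag Finset.univ n, hermiteFeature a x ^ 2
        + ∑ a ∈ Finset.finsuppAntidiag Finset.univ n, hermiteFeature a y ^ 2
        - 2 * ∑ a ∈ Finset.finsuppAntidiag Finset.univ n,
          hermiteFeature a x * hermiteFeature a y := by
    rw [Finset.mul_sum, ← Finset.sum_add_distrib, ← Finset.sum_sub_distrib]
    exact Finset.sum_congr rfl fun a _ => by ring
  rw [h3, h1, h2]
  ring

end

end HermiteFeatures

/-! ### The planar gap as a squared distance on the circle; lower bound. -/

section PlanarBounds

open PowerSeries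

noncomputable section

/-- Half the squared distance of the planar kernel at two points at angle `arccos (1 - s)`. -/
def planarGap (n : ℕ) (s : ℝ) : ℝ := coeff n (planarSeries 0 - planarSeries s)

theorem sum_planar_feature_sub_sq (n : ℕ) (t u : ℝ) :
    ∑ a ∈ Finset.finsuppAntidiag (Finset.univ : Finset (Fin 2)) n,
      (hermiteFeature a ![Real.cos t, Real.sin t] - hermiteFeature a ![Real.cos u, Real.sin u]) ^ 2
      = 2 * planarGap n (1 - Real.cos (t - u)) := by
  rw [sum_hermiteFeature_sub_sq (s := 1 - Real.cos (t - u)) le_rfl (by simp) (by simp)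
    (by simp [Real.cos_sub])]
  simp [planarGap]

theorem planarGap_cos_nonneg (n : ℕ) (t : ℝ) : 0 ≤ planarGap n (1 - Real.cos t) := by
  have h := sum_planar_feature_sub_sq n t 0
  have h1 : (0 : ℝ) ≤ ∑ a ∈ Finset.finsuppAntidiag (Finset.univ : Finset (Fin 2)) n,
      (hermiteFeature a ![Real.cos t, Real.sin t]
        - hermiteFeature a ![Real.cos 0, Real.sin 0]) ^ 2 := by positivity
  rw [sub_zero] at h
  linarith

/-- The triangle inequality through the midpoint angle `t`: by rotation invariance both halves have
the same length, whence `(2 · length)² = 4 · length²`. -/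
theorem planarGap_cos_two_mul_le (n : ℕ) (t : ℝ) :
    planarGap n (1 - Real.cos (2 * t)) ≤ 4 * planarGap n (1 - Real.cos t) := by
  have h1 := sum_planar_feature_sub_sq n (2 * t) 0
  have h2 := sum_planar_feature_sub_sq n (2 * t) t
  have h3 := sum_planar_feature_sub_sq n t 0
  rw [sub_zero] at h1 h3
  rw [show 2 * t - t = t by ring] at h2
  have h4 : ∑ a ∈ Finset.finsuppAntidiag (Finset.univ : Finset (Fin 2)) n,
      (hermiteFeature a ![Real.cos (2 * t), Real.sin (2 * t)]
        - hermiteFeature a ![Real.cos 0, Real.sin 0]) ^ 2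
      ≤ 2 * (∑ a ∈ Finset.finsuppAntidiag (Finset.univ : Finset (Fin 2)) n,
      (hermiteFeature a ![Real.cos (2 * t), Real.sin (2 * t)]
        - hermiteFeature a ![Real.cos t, Real.sin t]) ^ 2
      + ∑ a ∈ Finset.finsuppAntidiag (Finset.univ : Finset (Fin 2)) n,
      (hermiteFeature a ![Real.cos t, Real.sin t]
        - hermiteFeature a ![Real.cos 0, Real.sin 0]) ^ 2) := by
    rw [← Finset.sum_add_distrib, Finset.mul_sum]
    refine Finset.sum_le_sum fun a _ => ?_
    have := add_sq_le (a := hermiteFeature a ![Real.cos (2 * t), Real.sin (2 * t)]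
        - hermiteFeature a ![Real.cos t, Real.sin t])
      (b := hermiteFeature a ![Real.cos t, Real.sin t]
        - hermiteFeature a ![Real.cos 0, Real.sin 0])
    rwa [sub_add_sub_cancel] at this
  linarith

theorem planarGap_cos_le (n : ℕ) (t : ℝ) :
    planarGap n (1 - Real.cos t) ≤ 2 * coeff n (planarSeries 0) := by
  have h := sum_planar_feature_sub_sq n t 0
  have h1 := sum_hermiteFeature_sq (d := 2) (x := ![Real.cos t, Real.sin t]) le_rfl (by simp) n
  have h2 := sum_hermiteFeature_sq (d := 2) (x := ![Real.cos 0, Real.sin 0]) le_rfl (by simp) n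
  have h3 : ∑ a ∈ Finset.finsuppAntidiag (Finset.univ : Finset (Fin 2)) n,
      (hermiteFeature a ![Real.cos t, Real.sin t]
        - hermiteFeature a ![Real.cos 0, Real.sin 0]) ^ 2
      ≤ 2 * (∑ a ∈ Finset.finsuppAntidiag (Finset.univ : Finset (Fin 2)) n,
        hermiteFeature a ![Real.cos t, Real.sin t] ^ 2
      + ∑ a ∈ Finset.finsuppAntidiag (Finset.univ : Finset (Fin 2)) n,
        hermiteFeature a ![Real.cos 0, Real.sin 0] ^ 2) := by
    rw [← Finset.sum_add_distrib, Finset.mul_sum]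
    refine Finset.sum_le_sum fun a _ => ?_
    nlinarith [sq_nonneg (hermiteFeature a ![Real.cos t, Real.sin t]
        + hermiteFeature a ![Real.cos 0, Real.sin 0])]
  simp only [Nat.sub_self, pow_zero, mul_one] at h1 h2
  rw [h1, h2] at h3
  rw [sub_zero] at h
  linarith

theorem one_sub_cos_arccos {s : ℝ} (hs0 : 0 ≤ s) (hs : s ≤ 1 / 2) :
    1 - Real.cos (Real.arccos (1 - s)) = s := by
  rw [Real.cos_arccos (by linarith) (by linarith)]
  ring

theorem planarGap_nonneg {s : ℝ} (hs0 : 0 ≤ s) (hs : s ≤ 1 / 2) (n : ℕ) : 0 ≤ planarGap n s := by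
  simpa [one_sub_cos_arccos hs0 hs] using planarGap_cos_nonneg n (Real.arccos (1 - s))

theorem planarGap_le {s : ℝ} (hs0 : 0 ≤ s) (hs : s ≤ 1 / 2) (n : ℕ) :
    planarGap n s ≤ 2 * coeff n (planarSeries 0) := by
  simpa [one_sub_cos_arccos hs0 hs] using planarGap_cos_le n (Real.arccos (1 - s))

theorem coeff_planarSeries_zero_nonneg (n : ℕ) : 0 ≤ coeff n (planarSeries 0) := by
  have h1 := planarGap_nonneg le_rfl (by norm_num : (0 : ℝ) ≤ 1 / 2) n
  have h2 := planarGap_le le_rfl (by norm_num : (0 : ℝ) ≤ 1 / 2) n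
  linarith

theorem exists_planarGap_lower : ∃ c : ℝ, 0 < c ∧ ∃ N : ℕ, ∀ n ≥ N, ∀ s : ℝ, 0 ≤ s → s ≤ 1 / 2 →
    c * min 1 (n * s) ≤ planarGap n s := by
  obtain ⟨N, hN⟩ := exists_coeff_planarSeries_gap
  have hgap : ∀ n ≥ N, ∀ s : ℝ, 0 ≤ s → s ≤ 1 / 2 → 1 ≤ n * s → 1 / 200 ≤ planarGap n s := by
    intro n hn s h0 h1 h2
    rw [planarGap, map_sub]
    exact hN n hn s h0 h1 h2
  -- From `1 - cos t ≥ 2t²/π²` and `π² ≤ 10`.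
  have hquad : ∀ t : ℝ, |t| ≤ 1 → t ^ 2 / 5 ≤ 1 - Real.cos t := by
    intro t ht
    have h1 := Real.cos_le_one_sub_mul_cos_sq (x := t) (by linarith [Real.pi_gt_three])
    have h2 : (1 : ℝ) / 5 ≤ 2 / Real.pi ^ 2 := by
      rw [div_le_div_iff₀ (by norm_num) (by positivity)]
      nlinarith [Real.pi_lt_d2, Real.pi_gt_three]
    nlinarith [sq_nonneg t]
  -- Induction on a number `j` of doublings sufficient to bring `n t²` into `[5, 20]`. The window
  -- has ratio `4`, so doubling `t` cannot jump over it. Inside it `n (1 - cos t) ≥ 1`, and `20/4000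
  -- = 1/200` is the known gap; `n ≥ 20` forces `|t| ≤ 1` there. A doubling multiplies `n t²` by
  -- `4`, as much as the gap can grow.
  have hind : ∀ n ≥ N + 20, ∀ j : ℕ, ∀ t : ℝ, 5 ≤ 4 ^ j * (n * t ^ 2) → n * t ^ 2 ≤ 20 →
      1 / 4000 * (n * t ^ 2) ≤ planarGap n (1 - Real.cos t) := by
    intro n hn j
    have hn20 : (20 : ℝ) ≤ n := by
      have : 20 ≤ n := by omega
      exact_mod_cast this
    have hbase : ∀ t : ℝ, 5 ≤ n * t ^ 2 → n * t ^ 2 ≤ 20 →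
        1 / 4000 * (n * t ^ 2) ≤ planarGap n (1 - Real.cos t) := by
      intro t h5 h20
      have ht1 : t ^ 2 ≤ 1 := by nlinarith [sq_nonneg t]
      have ht : |t| ≤ 1 := (sq_le_one_iff_abs_le_one t).1 ht1
      have h1 := Real.one_sub_sq_div_two_le_cos (x := t)
      have h2 := hgap n (by omega) (1 - Real.cos t) (by linarith [Real.cos_le_one t])
        (by linarith) (by nlinarith [hquad t ht])
      linarith
    induction j with
    | zero =>
      intro t h5 h20
      exact hbase t (by simpa using h5) h20
    | succ j ih =>
      intro t h5 h20
      rcases le_total 5 (n * t ^ 2) with h | h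
      · exact hbase t h h20
      · have h1 := ih (2 * t) (by rw [pow_succ] at h5; linarith) (by linarith)
        have h2 := planarGap_cos_two_mul_le n t
        linarith
  refine ⟨1 / 4000, by norm_num, N + 20, fun n hn s hs0 hs => ?_⟩
  have hn20 : (20 : ℝ) ≤ n := by
    have : 20 ≤ n := by omega
    exact_mod_cast this
  rcases le_total 1 (n * s) with h | h
  · rw [min_eq_left h]
    linarith [hgap n (by omega) s hs0 hs h]
  · rw [min_eq_right h]
    rcases hs0.eq_or_lt with rfl | hspos
    · simpa using planarGap_nonneg hs0 hs n
    · set t := Real.arccos (1 - s) with ht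
      have hst : 1 - Real.cos t = s := one_sub_cos_arccos hs0 hs
      have ht0 : 0 ≤ t := Real.arccos_nonneg _
      have hts : s ≤ t ^ 2 / 2 := by linarith [Real.one_sub_sq_div_two_le_cos (x := t)]
      have hs20 : s ≤ 1 / 20 := by
        by_contra hc
        push Not at hc
        nlinarith
      have htpi : t ≤ Real.pi := Real.arccos_le_pi _
      have hts2 : t ^ 2 ≤ 5 * s := by
        have h1 := Real.cos_le_one_sub_mul_cos_sq (x := t) (by rwa [abs_of_nonneg ht0])
        have h2 : (1 : ℝ) / 5 ≤ 2 / Real.pi ^ 2 := by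
          rw [div_le_div_iff₀ (by norm_num) (by positivity)]
          nlinarith [Real.pi_lt_d2, Real.pi_gt_three]
        nlinarith [sq_nonneg t]
      have hpos : 0 < n * t ^ 2 := by
        have : 0 < t ^ 2 := by linarith
        positivity
      obtain ⟨j, hj⟩ := pow_unbounded_of_one_lt (5 / (n * t ^ 2)) (by norm_num : (1 : ℝ) < 4)
      rw [div_lt_iff₀ hpos] at hj
      have h3 := hind n hn j t hj.le (by nlinarith)
      rw [hst] at h3
      nlinarith

end

end PlanarBounds

/-! ### Upper bound for the planar gap. -/

section PlanarUpper

open PowerSeries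

noncomputable section

/-- The quotient of two planar series. -/
def planarQuotient (s : ℝ) : ℝ⟦X⟧ :=
  ((1 - X) * lagSeries s) * ((1 + X) * altLagSeries (-s))

theorem coeff_zero_planarQuotient (s : ℝ) : coeff 0 (planarQuotient s) = 1 := by
  simp [planarQuotient, lagSeries, altLagSeries, lag_zero]

/-- The equation of `exp(-2sX / (1 - X²))`: the prefactors `1 - X` and `1 + X` cancel the poles in
front of the two Laguerre exponentials. -/
theorem planarQuotient_ode (s : ℝ) :
    (1 - X ^ 2) ^ 2 * d⁄dX ℝ (planarQuotient s)
      = -(2 * C s * (1 + X ^ 2)) * planarQuotient s := by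
  have hA := altLagSeries_ode (-s)
  have hB := lagSeries_ode s
  rw [map_neg] at hA
  rw [planarQuotient]
  simp only [Derivation.leibniz, smul_eq_mul, map_add, map_sub, Derivation.map_one_eq_zero,
    derivative_X]
  linear_combination (1 + X) ^ 2 * (1 - X) * (1 + X) * altLagSeries (-s) * hB
    + (1 - X) ^ 2 * (1 - X) * (1 + X) * lagSeries s * hA

theorem planarSeries_eq_mul_planarQuotient (s : ℝ) :
    planarSeries s = planarSeries 0 * planarQuotient s := by
  have h0 := planarSeries_ode 0
  have hZ := planarQuotient_ode s
  refine PowerSeries.eq_of_mul_derivative_eq (U := (1 - X ^ 2) ^ 2) ?_ ?_ (planarSeries_ode s) ?_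
  · simp
  · rw [map_mul, constantCoeff_planarSeries, constantCoeff_planarSeries,
      ← coeff_zero_eq_constantCoeff_apply, coeff_zero_planarQuotient, one_mul]
  · rw [Derivation.leibniz]
    simp only [smul_eq_mul]
    rw [map_zero] at h0
    linear_combination planarQuotient s * h0 + planarSeries 0 * hZ

/-- The series `∑ X^(2i+1) = X / (1 - X²)`. -/
def oddSeries : ℝ⟦X⟧ := mk fun k => if Odd k then 1 else 0

theorem one_sub_X_sq_mul_oddSeries : (1 - X ^ 2) * oddSeries = X := by
  have e : (1 - X ^ 2) * oddSeries = oddSeries - X * (X * oddSeries) := by ring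
  rw [e]
  ext n
  rcases n with _ | _ | n
  · simp [oddSeries]
  · simp [oddSeries, coeff_succ_X_mul, coeff_zero_X_mul]
  · simp only [map_sub, coeff_succ_X_mul, oddSeries, coeff_mk, coeff_X]
    have : Odd (n + 1 + 1) ↔ Odd n := by
      constructor <;> intro h <;> grind
    simp [this]

/-- With `oddSeries = X / (1 - X²)`, this is `Z' = -2s (X / (1 - X²))' Z`, a form without
denominators that suits a coefficient recursion. -/
theorem derivative_planarQuotient (s : ℝ) :
    d⁄dX ℝ (planarQuotient s) = -(C (2 * s) * (d⁄dX ℝ oddSeries * planarQuotient s)) := by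
  have h1 := planarQuotient_ode s
  have h2 := congrArg (d⁄dX ℝ) one_sub_X_sq_mul_oddSeries
  simp only [Derivation.leibniz, Derivation.leibniz_pow, smul_eq_mul, map_sub,
    Derivation.map_one_eq_zero, derivative_X, nsmul_eq_mul] at h2
  have h3 := one_sub_X_sq_mul_oddSeries
  have h4 : ((1 : ℝ⟦X⟧) - X ^ 2) ^ 2 ≠ 0 := by
    intro h
    simpa using congrArg (constantCoeff (R := ℝ)) h
  refine mul_left_cancel₀ h4 ?_
  rw [h1, map_mul, map_ofNat (C (R := ℝ)) 2]
  norm_num at h2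
  linear_combination -2 * C s * planarQuotient s * (-(1 - X ^ 2) * h2 - 2 * X * h3)

theorem abs_coeff_derivative_oddSeries_le (k : ℕ) :
    |coeff k (d⁄dX ℝ oddSeries)| ≤ (k : ℝ) + 1 := by
  rw [coeff_derivative, oddSeries, coeff_mk]
  have : (0 : ℝ) ≤ (k : ℝ) + 1 := by positivity
  split_ifs
  · rw [one_mul, abs_of_nonneg this]
  · simpa using this

/-- Bootstrap: in `Z' = -2s · oddSeries' · Z` the coefficients of `oddSeries'` up to degree `m` are
at most `m + 1`, and the earlier coefficients of `Z` sum to at most `1 + 4 n s ≤ 2`. Thus `(m +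
1)|z_{m+1}| ≤ 2s · 2(m + 1)`. -/
theorem abs_coeff_planarQuotient_le {s : ℝ} (hs0 : 0 ≤ s) {n : ℕ} (hn : 4 * (n * s) ≤ 1) :
    ∀ k, 1 ≤ k → k ≤ n → |coeff k (planarQuotient s)| ≤ 4 * s := by
  intro k
  induction k using Nat.strong_induction_on with
  | _ k ih =>
    intro hk1 hkn
    obtain ⟨m, rfl⟩ := Nat.exists_eq_add_of_le' hk1
    have h1 := congrArg (coeff m) (derivative_planarQuotient s)
    rw [coeff_derivative, map_neg, coeff_C_mul, coeff_mul] at h1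
    have h2 : |∑ p ∈ Finset.HasAntidiagonal.antidiagonal m,
        coeff p.1 (d⁄dX ℝ oddSeries) * coeff p.2 (planarQuotient s)| ≤ 2 * ((m : ℝ) + 1) := by
      calc _ ≤ ∑ p ∈ Finset.HasAntidiagonal.antidiagonal m,
            |coeff p.1 (d⁄dX ℝ oddSeries) * coeff p.2 (planarQuotient s)| :=
            Finset.abs_sum_le_sum_abs _ _
        _ ≤ ∑ p ∈ Finset.HasAntidiagonal.antidiagonal m,
            ((m : ℝ) + 1) * |coeff p.2 (planarQuotient s)| := by
            refine Finset.sum_le_sum fun p hp => ?_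
            have hp' : p.1 + p.2 = m := Finset.HasAntidiagonal.mem_antidiagonal.1 hp
            rw [abs_mul]
            gcongr
            refine (abs_coeff_derivative_oddSeries_le p.1).trans ?_
            gcongr
            omega
        _ = ((m : ℝ) + 1) * ∑ k ∈ Finset.range (m + 1), |coeff k (planarQuotient s)| := by
            rw [← Finset.mul_sum, ← Finset.Nat.sum_antidiagonal_swap,
              Finset.Nat.sum_antidiagonal_eq_sum_range_succ_mk]
            rfl
        _ ≤ ((m : ℝ) + 1) * (1 + m * (4 * s)) := by
            gcongr
            rw [Finset.sum_range_succ', coeff_zero_planarQuotient, abs_one, add_comm]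
            gcongr
            refine (Finset.sum_le_card_nsmul _ _ (4 * s) fun k hk => ?_).trans_eq ?_
            · rw [Finset.mem_range] at hk
              exact ih (k + 1) (by omega) (by omega) (by omega)
            · simp
        _ ≤ ((m : ℝ) + 1) * 2 := by
            have : (m : ℝ) ≤ n := by
              have : m ≤ n := by omega
              exact_mod_cast this
            gcongr
            nlinarith
        _ = _ := mul_comm _ _
    have h3 : |coeff (m + 1) (planarQuotient s)| * ((m : ℝ) + 1) ≤ 4 * s * ((m : ℝ) + 1) := by
      rw [← abs_of_nonneg (by positivity : (0 : ℝ) ≤ (m : ℝ) + 1), ← abs_mul, h1, abs_neg, abs_mul,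
        abs_of_nonneg (by positivity : (0 : ℝ) ≤ 2 * s),
        abs_of_nonneg (by positivity : (0 : ℝ) ≤ (m : ℝ) + 1)]
      nlinarith
    exact le_of_mul_le_mul_right h3 (by positivity)

theorem exists_planarGap_upper : ∃ M : ℝ, 0 < M ∧ ∀ n : ℕ, ∀ s : ℝ, 0 ≤ s → s ≤ 1 / 2 →
    planarGap n s ≤ M * min 1 (n * s) := by
  obtain ⟨M, hM, h⟩ := exists_coeff_planarSeries_zero_le
  refine ⟨8 * M, by positivity, fun n s hs0 hs => ?_⟩
  -- If `4 n s ≤ 1`, the constant term `1` of the quotient cancels the leading contribution and `n`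
  -- terms of size `4 M s` remain. Otherwise the trivial bound `2M` suffices, because the minimum is
  -- at least `1/4`.
  rcases le_total (4 * (n * s)) 1 with hn | hn
  · rw [min_eq_right (by linarith)]
    rw [planarGap, planarSeries_eq_mul_planarQuotient s, map_sub, coeff_mul,
      Finset.Nat.sum_antidiagonal_eq_sum_range_succ_mk, Finset.sum_range_succ, Nat.sub_self,
      coeff_zero_planarQuotient, mul_one]
    have h1 : -(n * (M * (4 * s))) ≤ ∑ k ∈ Finset.range n,
        coeff k (planarSeries 0) * coeff (n - k) (planarQuotient s) := by
      have h2 : |∑ k ∈ Finset.range n,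
          coeff k (planarSeries 0) * coeff (n - k) (planarQuotient s)| ≤ n * (M * (4 * s)) := by
        refine (Finset.abs_sum_le_sum_abs _ _).trans ?_
        refine (Finset.sum_le_card_nsmul _ _ (M * (4 * s)) fun k hk => ?_).trans_eq ?_
        · rw [Finset.mem_range] at hk
          rw [abs_mul, abs_of_nonneg (coeff_planarSeries_zero_nonneg k)]
          gcongr
          · exact h k
          · exact abs_coeff_planarQuotient_le hs0 hn _ (by omega) (by omega)
        · simp
      exact (abs_le.1 h2).1
    have h3 : 0 ≤ n * s * M := by positivity
    linarith
  · have h1 : (1 : ℝ) / 4 ≤ min 1 (n * s) := le_min (by norm_num) (by linarith)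
    have h2 := planarGap_le hs0 hs n
    have h3 := h n
    nlinarith

end

end PlanarUpper

/-! ### Partial sums of `(1 - X²)^(-m/2)` and the gap in every dimension. -/

section PartialSums

open PowerSeries

noncomputable section

/-- The sum of the coefficients of degree at most `n`. -/
def PowerSeries.partialSum (F : ℝ⟦X⟧) (n : ℕ) : ℝ := ∑ k ∈ Finset.range (n + 1), coeff k F

theorem PowerSeries.coeff_mul_nonneg {F G : ℝ⟦X⟧} (hF : ∀ k, 0 ≤ coeff k F)
    (hG : ∀ k, 0 ≤ coeff k G) (k : ℕ) : 0 ≤ coeff k (F * G) := by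
  rw [coeff_mul]
  exact Finset.sum_nonneg fun p _ => mul_nonneg (hF _) (hG _)

theorem PowerSeries.coeff_pow_nonneg {F : ℝ⟦X⟧} (hF : ∀ k, 0 ≤ coeff k F) (m k : ℕ) :
    0 ≤ coeff k (F ^ m) := by
  induction m generalizing k with
  | zero =>
    rw [pow_zero, coeff_one]
    split_ifs <;> norm_num
  | succ m ih =>
    rw [pow_succ]
    exact PowerSeries.coeff_mul_nonneg ih hF k

theorem PowerSeries.partialSum_mono {F : ℝ⟦X⟧} (hF : ∀ k, 0 ≤ coeff k F) {m n : ℕ} (h : m ≤ n) :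
    partialSum F m ≤ partialSum F n :=
  Finset.sum_le_sum_of_subset_of_nonneg (Finset.range_mono (by omega)) fun k _ _ => hF k

theorem PowerSeries.partialSum_nonneg {F : ℝ⟦X⟧} (hF : ∀ k, 0 ≤ coeff k F) (n : ℕ) :
    0 ≤ partialSum F n := Finset.sum_nonneg fun k _ => hF k

theorem PowerSeries.partialSum_mul (F G : ℝ⟦X⟧) (n : ℕ) :
    partialSum (F * G) n = ∑ i ∈ Finset.range (n + 1), coeff i F * partialSum G (n - i) := by
  simp only [partialSum, coeff_mul, Finset.Nat.sum_antidiagonal_eq_sum_range_succ_mk]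
  rw [Finset.sum_comm' (t' := Finset.range (n + 1)) (s' := fun i => Finset.Ico i (n + 1))
    (by simp only [Finset.mem_range, Finset.mem_Ico]; omega)]
  refine Finset.sum_congr rfl fun i hi => ?_
  rw [Finset.mem_range] at hi
  rw [Finset.sum_Ico_eq_sum_range, Finset.mul_sum, show n + 1 - i = n - i + 1 by omega]
  exact Finset.sum_congr rfl fun j _ => by rw [Nat.add_sub_cancel_left]

/-- The triangle `i + j ≤ n` lies in the square `i, j ≤ n`; conversely, for `partialSum_mul_ge`, the
square `i, j ≤ m` lies in the triangle when `2m ≤ n`. Together they give orders of magnitude for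
powers and square roots without coefficient asymptotics. -/
theorem PowerSeries.partialSum_mul_le {F G : ℝ⟦X⟧} (hF : ∀ k, 0 ≤ coeff k F)
    (hG : ∀ k, 0 ≤ coeff k G) (n : ℕ) :
    partialSum (F * G) n ≤ partialSum F n * partialSum G n := by
  rw [partialSum_mul, partialSum.eq_1 F, Finset.sum_mul]
  exact Finset.sum_le_sum fun i _ =>
    mul_le_mul_of_nonneg_left (partialSum_mono hG (Nat.sub_le _ _)) (hF i)

theorem PowerSeries.partialSum_mul_ge {F G : ℝ⟦X⟧} (hF : ∀ k, 0 ≤ coeff k F)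
    (hG : ∀ k, 0 ≤ coeff k G) {m n : ℕ} (h : 2 * m ≤ n) :
    partialSum F m * partialSum G m ≤ partialSum (F * G) n := by
  rw [partialSum_mul]
  nth_rw 1 [partialSum]
  rw [Finset.sum_mul]
  refine le_trans (Finset.sum_le_sum fun i hi => ?_)
    (Finset.sum_le_sum_of_subset_of_nonneg (Finset.range_mono (by omega : m + 1 ≤ n + 1))
      fun i _ _ => mul_nonneg (hF i) (partialSum_nonneg hG _))
  rw [Finset.mem_range] at hi
  exact mul_le_mul_of_nonneg_left (partialSum_mono hG (by omega)) (hF i)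

theorem coeff_mehlerSeries_zero_nonneg (k : ℕ) : 0 ≤ coeff k (mehlerSeries 0 0) := by
  rw [mehlerSeries, coeff_mk, mehlerCoeff]
  have := mul_self_nonneg ((hermiteH k).eval 0)
  positivity

/-- The diagonal series at the origin is `(1 - X²)^(-1/2)`: by its equation the product on the left
has derivative zero. -/
theorem one_sub_X_sq_mul_mehlerSeries_sq : (1 - X ^ 2) * mehlerSeries 0 0 ^ 2 = 1 := by
  have h := mehlerSeries_ode 0 0
  have h4 : ((1 : ℝ⟦X⟧) - X ^ 2) ≠ 0 := by
    intro h
    simpa using congrArg (constantCoeff (R := ℝ)) h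
  refine PowerSeries.eq_of_mul_derivative_eq (U := 1 - X ^ 2) (P := 0) (by simp)
    (by simp [constantCoeff_mehlerSeries]) ?_ (by simp)
  norm_num at h
  simp only [Derivation.leibniz, Derivation.leibniz_pow, smul_eq_mul, map_sub,
    Derivation.map_one_eq_zero, derivative_X, nsmul_eq_mul]
  refine mul_left_cancel₀ h4 ?_
  push_cast
  linear_combination 2 * (1 - X ^ 2) * mehlerSeries 0 0 * h

theorem coeff_mehlerSeries_sq (k : ℕ) :
    coeff k (mehlerSeries 0 0 ^ 2) = if Even k then 1 else 0 := by
  have e : mehlerSeries 0 0 ^ 2 - X * (X * mehlerSeries 0 0 ^ 2) = 1 := by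
    linear_combination one_sub_X_sq_mul_mehlerSeries_sq
  induction k using Nat.twoStepInduction with
  | zero =>
    have h := congrArg (coeff 0) e
    rw [map_sub, coeff_zero_X_mul, sub_zero, coeff_one] at h
    rw [h]
    simp
  | one =>
    have h := congrArg (coeff (0 + 1)) e
    rw [map_sub, coeff_succ_X_mul, coeff_zero_X_mul, sub_zero, coeff_one] at h
    rw [h]
    simp
  | more k ih _ =>
    have h := congrArg (coeff (k + 1 + 1)) e
    rw [map_sub, coeff_succ_X_mul, coeff_succ_X_mul, coeff_one, if_neg (by omega), sub_eq_zero,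
      ih] at h
    rw [show k + 2 = k + 1 + 1 from rfl, h]
    have : Even (k + 1 + 1) ↔ Even k := by grind
    simp [this]

theorem partialSum_mehlerSeries_sq_bounds (n : ℕ) :
    ((n : ℝ) + 1) / 2 ≤ partialSum (mehlerSeries 0 0 ^ 2) n ∧
      partialSum (mehlerSeries 0 0 ^ 2) n ≤ (n : ℝ) / 2 + 1 := by
  have key : partialSum (mehlerSeries 0 0 ^ 2) n = if Even n then (n : ℝ) / 2 + 1
      else ((n : ℝ) + 1) / 2 := by
    induction n with
    | zero => simp [partialSum, constantCoeff_mehlerSeries]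
    | succ n ih =>
      rw [partialSum, Finset.sum_range_succ, coeff_mehlerSeries_sq]
      rw [partialSum] at ih
      rw [ih]
      rcases Nat.even_or_odd n with h | h
      · have h' : ¬ Even (n + 1) := by grind
        rw [if_pos h, if_neg h', if_neg h']
        push_cast
        ring
      · have h' : Even (n + 1) := by grind
        rw [if_neg (Nat.not_even_iff_odd.2 h), if_pos h', if_pos h']
        push_cast
        ring
  rw [key]
  split_ifs <;> constructor <;> linarith

/-- The square of the series is `1 + X² + X⁴ + ⋯`, with partial sums about `n/2`;
submultiplicativity passes this to the series itself. -/
theorem sq_partialSum_mehlerSeries_ge (n : ℕ) :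
    ((n : ℝ) + 1) / 2 ≤ partialSum (mehlerSeries 0 0) n ^ 2 := by
  have h := partialSum_mul_le coeff_mehlerSeries_zero_nonneg coeff_mehlerSeries_zero_nonneg n
  rw [← sq, ← sq] at h
  exact (partialSum_mehlerSeries_sq_bounds n).1.trans h

theorem sq_partialSum_mehlerSeries_le (n : ℕ) :
    partialSum (mehlerSeries 0 0) n ^ 2 ≤ (n : ℝ) + 1 := by
  have h := partialSum_mul_ge coeff_mehlerSeries_zero_nonneg coeff_mehlerSeries_zero_nonneg
    (le_refl (2 * n))
  rw [← sq, ← sq] at h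
  refine h.trans ((partialSum_mehlerSeries_sq_bounds (2 * n)).2.trans_eq ?_)
  push_cast
  ring

theorem sq_partialSum_mehlerSeries_pow_le (m n : ℕ) :
    partialSum (mehlerSeries 0 0 ^ m) n ^ 2 ≤ ((n : ℝ) + 1) ^ m := by
  have hM := coeff_mehlerSeries_zero_nonneg
  induction m with
  | zero =>
    have : partialSum (1 : ℝ⟦X⟧) n = 1 := by
      simp [partialSum, coeff_one]
    rw [pow_zero, this]
    norm_num
  | succ m ih =>
    rw [pow_succ, pow_succ]
    have h := partialSum_mul_le (coeff_pow_nonneg hM m) hM n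
    calc _ ≤ (partialSum (mehlerSeries 0 0 ^ m) n * partialSum (mehlerSeries 0 0) n) ^ 2 :=
          pow_le_pow_left₀ (partialSum_nonneg
            (PowerSeries.coeff_mul_nonneg (coeff_pow_nonneg hM m) hM) n) h 2
      _ = partialSum (mehlerSeries 0 0 ^ m) n ^ 2 * partialSum (mehlerSeries 0 0) n ^ 2 :=
          mul_pow _ _ _
      _ ≤ _ := by
          exact mul_le_mul ih (sq_partialSum_mehlerSeries_le n) (sq_nonneg _)
            (pow_nonneg (by positivity) m)

theorem exists_sq_partialSum_mehlerSeries_pow_ge (m : ℕ) :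
    ∃ c : ℝ, 0 < c ∧ ∀ n : ℕ,
      c * ((n : ℝ) + 1) ^ m ≤ partialSum (mehlerSeries 0 0 ^ m) n ^ 2 := by
  have hM := coeff_mehlerSeries_zero_nonneg
  induction m with
  | zero =>
    refine ⟨1, one_pos, fun n => ?_⟩
    have : partialSum (1 : ℝ⟦X⟧) n = 1 := by
      simp [partialSum, coeff_one]
    rw [pow_zero, pow_zero, this]
    norm_num
  | succ m ih =>
    obtain ⟨c, hc, h⟩ := ih
    refine ⟨c / 2 / 2 ^ (m + 1), by positivity, fun n => ?_⟩
    have h1 := partialSum_mul_ge (coeff_pow_nonneg hM m) hM (m := n / 2) (n := n) (by omega)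
    have h2 : ((n : ℝ) + 1) / 2 ≤ ((n / 2 : ℕ) : ℝ) + 1 := by
      have : n + 1 ≤ 2 * (n / 2 + 1) := by omega
      have h3 : ((n + 1 : ℕ) : ℝ) ≤ ((2 * (n / 2 + 1) : ℕ) : ℝ) := by exact_mod_cast this
      push_cast at h3
      linarith
    rw [pow_succ]
    calc c / 2 / 2 ^ (m + 1) * (((n : ℝ) + 1) ^ (m + 1))
        = c / 2 * (((n : ℝ) + 1) / 2) ^ (m + 1) := by
          rw [div_pow]
          ring
      _ ≤ c / 2 * (((n / 2 : ℕ) : ℝ) + 1) ^ (m + 1) := by gcongr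
      _ = c * (((n / 2 : ℕ) : ℝ) + 1) ^ m * ((((n / 2 : ℕ) : ℝ) + 1) / 2) := by ring
      _ ≤ partialSum (mehlerSeries 0 0 ^ m) (n / 2) ^ 2
          * partialSum (mehlerSeries 0 0) (n / 2) ^ 2 :=
          mul_le_mul (h _) (sq_partialSum_mehlerSeries_ge _) (by positivity) (by positivity)
      _ = (partialSum (mehlerSeries 0 0 ^ m) (n / 2) * partialSum (mehlerSeries 0 0) (n / 2)) ^ 2 :=
          (mul_pow _ _ _).symm
      _ ≤ _ := pow_le_pow_left₀ (mul_nonneg (partialSum_nonneg (coeff_pow_nonneg hM m) _)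
            (partialSum_nonneg hM _)) h1 2

theorem coeff_gap_eq (m n : ℕ) (s : ℝ) :
    coeff n ((planarSeries 0 - planarSeries s) * mehlerSeries 0 0 ^ m)
      = ∑ k ∈ Finset.range (n + 1), coeff k (mehlerSeries 0 0 ^ m) * planarGap (n - k) s := by
  rw [mul_comm, coeff_mul, Finset.Nat.sum_antidiagonal_eq_sum_range_succ_mk]
  rfl

/-- The two-sided bound for the gap of the kernel in every dimension. -/
theorem exists_coeff_gap_bounds (m : ℕ) : ∃ c C : ℝ, 0 < c ∧ 0 < C ∧ ∃ N : ℕ, 1 ≤ N ∧ ∀ n ≥ N,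
    ∀ s : ℝ, 0 ≤ s → s ≤ 1 / 2 →
      c * (Real.sqrt ((n : ℝ) ^ m) * min 1 (n * s))
        ≤ coeff n ((planarSeries 0 - planarSeries s) * mehlerSeries 0 0 ^ m) ∧
      coeff n ((planarSeries 0 - planarSeries s) * mehlerSeries 0 0 ^ m)
        ≤ C * (Real.sqrt ((n : ℝ) ^ m) * min 1 (n * s)) := by
  have hM := coeff_pow_nonneg coeff_mehlerSeries_zero_nonneg m
  obtain ⟨c₁, hc₁, N, hlow⟩ := exists_planarGap_lower
  obtain ⟨C₁, hC₁, hup⟩ := exists_planarGap_upper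
  obtain ⟨c₂, hc₂, hps⟩ := exists_sq_partialSum_mehlerSeries_pow_ge m
  refine ⟨c₁ / 2 * Real.sqrt (c₂ / 2 ^ m), C₁ * Real.sqrt (2 ^ m), by positivity, by positivity,
    2 * N + 1, by omega, fun n hn s hs0 hs => ?_⟩
  have hn1 : (1 : ℝ) ≤ n := by
    have : 1 ≤ n := by omega
    exact_mod_cast this
  have hmin0 : 0 ≤ min 1 (n * s) := le_min zero_le_one (by positivity)
  rw [coeff_gap_eq]
  constructor
  · have h1 : Real.sqrt (c₂ / 2 ^ m) * Real.sqrt ((n : ℝ) ^ m)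
        ≤ partialSum (mehlerSeries 0 0 ^ m) (n / 2) := by
      rw [← Real.sqrt_mul (by positivity)]
      refine Real.sqrt_le_iff.2 ⟨partialSum_nonneg hM _, le_trans ?_ (hps (n / 2))⟩
      have h2 : (n : ℝ) / 2 ≤ ((n / 2 : ℕ) : ℝ) + 1 := by
        have : n ≤ 2 * (n / 2 + 1) := by omega
        have h3 : (n : ℝ) ≤ ((2 * (n / 2 + 1) : ℕ) : ℝ) := by exact_mod_cast this
        push_cast at h3
        linarith
      calc c₂ / 2 ^ m * (n : ℝ) ^ m = c₂ * ((n : ℝ) / 2) ^ m := by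
            rw [div_pow]
            ring
        _ ≤ _ := by gcongr
    calc c₁ / 2 * Real.sqrt (c₂ / 2 ^ m) * (Real.sqrt ((n : ℝ) ^ m) * min 1 (n * s))
        = (Real.sqrt (c₂ / 2 ^ m) * Real.sqrt ((n : ℝ) ^ m)) * (c₁ / 2 * min 1 (n * s)) := by ring
      _ ≤ partialSum (mehlerSeries 0 0 ^ m) (n / 2) * (c₁ / 2 * min 1 (n * s)) := by gcongr
      _ = ∑ k ∈ Finset.range (n / 2 + 1),
          coeff k (mehlerSeries 0 0 ^ m) * (c₁ / 2 * min 1 (n * s)) := by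
          rw [partialSum, Finset.sum_mul]
      -- Only `k ≤ n/2` is kept, so that `n - k ≥ n/2` is beyond the planar threshold `N` and the
      -- minimum drops by at most a factor `2`.
      _ ≤ ∑ k ∈ Finset.range (n / 2 + 1), coeff k (mehlerSeries 0 0 ^ m) * planarGap (n - k) s := by
          refine Finset.sum_le_sum fun k hk => mul_le_mul_of_nonneg_left ?_ (hM k)
          rw [Finset.mem_range] at hk
          refine le_trans ?_ (hlow (n - k) (by omega) s hs0 hs)
          have h2 : (n : ℝ) / 2 ≤ ((n - k : ℕ) : ℝ) := by
            have : n ≤ 2 * (n - k) := by omega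
            have h3 : (n : ℝ) ≤ ((2 * (n - k) : ℕ) : ℝ) := by exact_mod_cast this
            push_cast at h3
            linarith
          rw [div_mul_eq_mul_div, mul_div_assoc]
          gcongr
          refine le_min ?_ ?_
          · linarith [min_le_left 1 (n * s)]
          · have h4 := min_le_right 1 (n * s)
            nlinarith
      _ ≤ _ := by
          refine Finset.sum_le_sum_of_subset_of_nonneg (Finset.range_mono (by omega))
            fun k _ _ => mul_nonneg (hM k) (planarGap_nonneg hs0 hs _)
  · calc ∑ k ∈ Finset.range (n + 1), coeff k (mehlerSeries 0 0 ^ m) * planarGap (n - k) s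
        ≤ ∑ k ∈ Finset.range (n + 1), coeff k (mehlerSeries 0 0 ^ m) * (C₁ * min 1 (n * s)) := by
          refine Finset.sum_le_sum fun k _ => mul_le_mul_of_nonneg_left ?_ (hM k)
          refine (hup (n - k) s hs0 hs).trans ?_
          gcongr
          omega
      _ = partialSum (mehlerSeries 0 0 ^ m) n * (C₁ * min 1 (n * s)) := by
          rw [partialSum, Finset.sum_mul]
      _ ≤ (Real.sqrt (2 ^ m) * Real.sqrt ((n : ℝ) ^ m)) * (C₁ * min 1 (n * s)) := by
          gcongr
          rw [← Real.sqrt_mul (by positivity), ← mul_pow]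
          refine Real.le_sqrt_of_sq_le ((sq_partialSum_mehlerSeries_pow_le m n).trans ?_)
          gcongr
          linarith
      _ = _ := by ring

end

end PartialSums

/-! ### The Gaussian as a Schwartz function. -/

section GaussianSchwartz

noncomputable section

/-- Combine `(1 + t)^m ≤ m! e^(1 + t)` with `-t²/2 ≤ 3/2 - (1 + t)`, which is `(t - 1)² ≥ 0`. -/
theorem one_add_pow_mul_exp_neg_sq_le (m : ℕ) {t : ℝ} (ht : 0 ≤ t) :
    (1 + t) ^ m * Real.exp (-(t ^ 2 / 2)) ≤ m.factorial * Real.exp (3 / 2) := by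
  have h1 := Real.pow_div_factorial_le_exp (1 + t) (by positivity) m
  rw [div_le_iff₀ (by positivity)] at h1
  have h2 : Real.exp (-(t ^ 2 / 2)) ≤ Real.exp (3 / 2) * Real.exp (-(1 + t)) := by
    rw [← Real.exp_add]
    refine Real.exp_le_exp.2 ?_
    nlinarith [sq_nonneg (t - 1)]
  calc (1 + t) ^ m * Real.exp (-(t ^ 2 / 2))
      ≤ (Real.exp (1 + t) * m.factorial) * (Real.exp (3 / 2) * Real.exp (-(1 + t))) := by gcongr
    _ = m.factorial * Real.exp (3 / 2) * (Real.exp (1 + t) * Real.exp (-(1 + t))) := by ring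
    _ = _ := by rw [← Real.exp_add, add_neg_cancel, Real.exp_zero, mul_one]

variable {E : Type*} [NormedAddCommGroup E] [InnerProductSpace ℝ E]

/-- The Gaussian `exp (-‖x‖² / 2)` as a Schwartz function. -/
def gaussianSchwartz (E : Type*) [NormedAddCommGroup E] [InnerProductSpace ℝ E] : 𝓢(E, ℝ) where
  toFun x := Real.exp (-(‖x‖ ^ 2 / 2))
  smooth' := ((contDiff_norm_sq ℝ).div_const 2).neg.exp
  decay' := by
    intro j n
    have htg : Function.HasTemperateGrowth (fun x : E => ‖x‖ ^ 2 * (1 / 2)) := by fun_prop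
    obtain ⟨k, C, hC, hb⟩ := htg.norm_iteratedFDeriv_le_uniform n
    have hg : ContDiff ℝ (n : WithTop ℕ∞) (fun t : ℝ => Real.exp (-t)) := by fun_prop
    refine ⟨n.factorial * (1 + C) ^ n * ((j + k * n).factorial * Real.exp (3 / 2)), fun x => ?_⟩
    -- The bound for derivatives of a composition needs the `i`-th inner derivative below `D^i`; `D
    -- = (1 + C)(1 + ‖x‖)^k` is at least `1`, hence works for every `i ≥ 1`.
    have hcomp := norm_iteratedFDeriv_comp_le (g := fun t : ℝ => Real.exp (-t))
      (f := fun x : E => ‖x‖ ^ 2 * (1 / 2)) (n := n) (N := n) hg (htg.1.of_le (by exact_mod_cast le_top))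
      le_rfl x (C := Real.exp (-(‖x‖ ^ 2 * (1 / 2)))) (D := (1 + C) * (1 + ‖x‖) ^ k) ?_ ?_
    · have e : (fun x : E => Real.exp (-(‖x‖ ^ 2 / 2)))
          = (fun t : ℝ => Real.exp (-t)) ∘ fun x : E => ‖x‖ ^ 2 * (1 / 2) := by
        ext x
        simp [div_eq_mul_inv]
      rw [e]
      have h2 := one_add_pow_mul_exp_neg_sq_le (j + k * n) (norm_nonneg x)
      have h3 : ‖x‖ ^ j ≤ (1 + ‖x‖) ^ j := by
        gcongr
        linarith
      calc _ ≤ (1 + ‖x‖) ^ j * (n.factorial * Real.exp (-(‖x‖ ^ 2 * (1 / 2)))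
            * ((1 + C) * (1 + ‖x‖) ^ k) ^ n) := by gcongr
        _ = n.factorial * (1 + C) ^ n
            * ((1 + ‖x‖) ^ (j + k * n) * Real.exp (-(‖x‖ ^ 2 / 2))) := by
          rw [mul_pow, ← pow_mul, pow_add, show ‖x‖ ^ 2 * (1 / 2) = ‖x‖ ^ 2 / 2 by ring]
          ring
        _ ≤ _ := by gcongr
    · intro i _
      rw [norm_iteratedFDeriv_eq_norm_iteratedDeriv, iteratedDeriv_comp_neg (f := Real.exp)]
      simp [iteratedDeriv_eq_iterate]
    · intro i hi hin
      refine (hb i hin x).trans ?_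
      calc C * (1 + ‖x‖) ^ k ≤ (1 + C) * (1 + ‖x‖) ^ k := by
            gcongr
            linarith
        _ ≤ ((1 + C) * (1 + ‖x‖) ^ k) ^ i := by
            refine le_self_pow₀ ?_ (by omega)
            have h1 : (1 : ℝ) ≤ (1 + ‖x‖) ^ k := one_le_pow₀ (by linarith [norm_nonneg x])
            nlinarith

theorem gaussianSchwartz_apply (x : E) : gaussianSchwartz E x = Real.exp (-(‖x‖ ^ 2 / 2)) := rfl

end

end GaussianSchwartz

/-! ### Hermite functions as eigenfunctions of the oscillator. -/

section HermiteSchwartz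

noncomputable section

variable {d : ℕ}

theorem hasTemperateGrowth_coord (i : Fin d) :
    Function.HasTemperateGrowth (fun x : EuclideanSpace ℝ (Fin d) => x i) :=
  (EuclideanSpace.proj (𝕜 := ℝ) i : EuclideanSpace ℝ (Fin d) →L[ℝ] ℝ).hasTemperateGrowth

theorem hasTemperateGrowth_eval (p : Polynomial ℝ) (i : Fin d) :
    Function.HasTemperateGrowth (fun x : EuclideanSpace ℝ (Fin d) => p.eval (x i)) := by
  simp only [Polynomial.eval_eq_sum_range]
  exact Function.HasTemperateGrowth.sum fun k _ =>
    (Function.HasTemperateGrowth.const _).mul ((hasTemperateGrowth_coord i).pow k)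

theorem Function.HasTemperateGrowth.prod' {E ι : Type*} [NormedAddCommGroup E] [NormedSpace ℝ E]
    (t : Finset ι) {f : ι → E → ℝ} (hf : ∀ i ∈ t, Function.HasTemperateGrowth (f i)) :
    Function.HasTemperateGrowth (fun x => ∏ i ∈ t, f i x) := by
  classical
  induction t using Finset.induction_on with
  | empty => simp
  | insert i t hi ih =>
    simp only [Finset.prod_insert hi]
    exact (hf i (by simp)).mul (ih fun j hj => hf j (by simp [hj]))

theorem hasTemperateGrowth_hermiteFeature (a : Fin d →₀ ℕ) :
    Function.HasTemperateGrowth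
      (fun x : EuclideanSpace ℝ (Fin d) => hermiteFeature a x.ofLp) := by
  refine Function.HasTemperateGrowth.prod' _ fun i _ => ?_
  simp only [div_eq_mul_inv]
  exact (hasTemperateGrowth_eval _ i).mul (Function.HasTemperateGrowth.const _)

/-- The Hermite function with multi-index `a`, as a Schwartz function. -/
def hermiteFun (a : Fin d →₀ ℕ) : 𝓢(EuclideanSpace ℝ (Fin d), ℝ) :=
  SchwartzMap.smulLeftCLM ℝ (fun x : EuclideanSpace ℝ (Fin d) => hermiteFeature a x.ofLp)
    (gaussianSchwartz _)

theorem hermiteFun_apply (a : Fin d →₀ ℕ) (x : EuclideanSpace ℝ (Fin d)) :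
    hermiteFun a x = hermiteFeature a x.ofLp * Real.exp (-(‖x‖ ^ 2 / 2)) := by
  rw [hermiteFun, SchwartzMap.smulLeftCLM_apply_apply (hasTemperateGrowth_hermiteFeature a),
    gaussianSchwartz_apply, smul_eq_mul]

/-- The normalised (up to `π^(1/4)`) one-dimensional Hermite function. -/
def hermite1D (m : ℕ) (t : ℝ) : ℝ :=
  (hermiteH m).eval t / Real.sqrt (2 ^ m * m.factorial) * Real.exp (-(t ^ 2 / 2))

theorem hermiteFun_eq_prod (a : Fin d →₀ ℕ) (x : EuclideanSpace ℝ (Fin d)) :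
    hermiteFun a x = ∏ i, hermite1D (a i) (x i) := by
  simp only [hermite1D]
  rw [hermiteFun_apply, Finset.prod_mul_distrib, ← Real.exp_sum, hermiteFeature,
    EuclideanSpace.norm_sq_eq]
  simp [Finset.sum_div]

/-- The derivative of `hermite1D`. -/
def hermite1D' (m : ℕ) (t : ℝ) : ℝ :=
  ((Polynomial.derivative (hermiteH m)).eval t - t * (hermiteH m).eval t)
    / Real.sqrt (2 ^ m * m.factorial) * Real.exp (-(t ^ 2 / 2))

theorem hasDerivAt_exp_neg_sq_half (t : ℝ) :
    HasDerivAt (fun t : ℝ => Real.exp (-(t ^ 2 / 2))) (Real.exp (-(t ^ 2 / 2)) * (-t)) t := by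
  have h := (((hasDerivAt_pow 2 t).div_const 2).neg).exp
  refine h.congr_deriv ?_
  simp

theorem hasDerivAt_hermite1D (m : ℕ) (t : ℝ) :
    HasDerivAt (hermite1D m) (hermite1D' m t) t := by
  have h := (((hermiteH m).hasDerivAt t).div_const (Real.sqrt (2 ^ m * m.factorial))).mul
    (hasDerivAt_exp_neg_sq_half t)
  refine h.congr_deriv ?_
  rw [hermite1D']
  ring

theorem derivative_derivative_hermiteH (m : ℕ) :
    Polynomial.derivative (Polynomial.derivative (hermiteH m))
      = 2 * Polynomial.X * Polynomial.derivative (hermiteH m)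
        - 2 * (m : Polynomial ℝ) * hermiteH m := by
  rcases m with _ | m
  · simp [hermiteH]
  · rw [derivative_hermiteH_succ, hermiteH_succ m]
    simp only [Polynomial.derivative_mul, Polynomial.derivative_ofNat, Polynomial.derivative_add,
      Polynomial.derivative_natCast, Polynomial.derivative_one]
    push_cast
    ring

/-- Hermite's equation `H'' = 2tH' - 2mH`, conjugated by the Gaussian, becomes `h'' = (t² - (2m +
1)) h`. -/
theorem hasDerivAt_hermite1D' (m : ℕ) (t : ℝ) :
    HasDerivAt (hermite1D' m) ((t ^ 2 - (2 * m + 1)) * hermite1D m t) t := by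
  have h := ((((Polynomial.derivative (hermiteH m)).hasDerivAt t).sub
    ((hasDerivAt_id t).mul ((hermiteH m).hasDerivAt t))).div_const
    (Real.sqrt (2 ^ m * m.factorial))).mul (hasDerivAt_exp_neg_sq_half t)
  refine h.congr_deriv ?_
  rw [hermite1D, derivative_derivative_hermiteH]
  simp
  ring

theorem lineDeriv_prod_erase_mul {F : EuclideanSpace ℝ (Fin d) → ℝ} {u : Fin d → ℝ → ℝ}
    {v v' : ℝ → ℝ} (i : Fin d) (hv : ∀ t, HasDerivAt v (v' t) t)
    (hF : ∀ x, F x = (∏ j ∈ Finset.univ.erase i, u j (x j)) * v (x i))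
    (x : EuclideanSpace ℝ (Fin d)) :
    lineDeriv ℝ F x (EuclideanSpace.single i 1)
      = (∏ j ∈ Finset.univ.erase i, u j (x j)) * v' (x i) := by
  have e : (fun t : ℝ => F (x + t • EuclideanSpace.single i (1 : ℝ)))
      = fun t : ℝ => (∏ j ∈ Finset.univ.erase i, u j (x j)) * v (x i + t) := by
    ext t
    rw [hF]
    congr 1
    · refine Finset.prod_congr rfl fun j hj => ?_
      have : j ≠ i := Finset.ne_of_mem_erase hj
      simp [this]
    · simp
  rw [lineDeriv, e]
  have h1 : HasDerivAt (fun t : ℝ => v (x i + t)) (v' (x i)) 0 := by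
    have h2 : HasDerivAt v (v' (x i)) (x i + 0) := by simpa using hv (x i)
    exact h2.comp_const_add (x i) 0
  exact (h1.const_mul _).deriv

/-- Separation of variables: each coordinate contributes `x_i² - (2a_i + 1)` to the Laplacian, and
the `x_i²` cancel against the potential. -/
theorem harmonicOscillator_hermiteFun (a : Fin d →₀ ℕ) :
    harmonicOscillator (hermiteFun a) = (2 * ((∑ i, a i : ℕ) : ℝ) + d) • hermiteFun a := by
  have hprod : ∀ (i : Fin d) (x : EuclideanSpace ℝ (Fin d)), hermiteFun a x
      = (∏ j ∈ Finset.univ.erase i, hermite1D (a j) (x j)) * hermite1D (a i) (x i) := by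
    intro i x
    rw [hermiteFun_eq_prod, Finset.prod_erase_mul _ _ (Finset.mem_univ i)]
  ext x
  rw [harmonicOscillator_apply, ← SchwartzMap.laplacian_apply,
    SchwartzMap.laplacian_eq_sum (EuclideanSpace.basisFun (Fin d) ℝ)]
  have hsum : ∀ i : Fin d, (LineDeriv.lineDerivOp (EuclideanSpace.basisFun (Fin d) ℝ i)
      (LineDeriv.lineDerivOp (EuclideanSpace.basisFun (Fin d) ℝ i) (hermiteFun a))) x
      = (x i ^ 2 - (2 * (a i : ℝ) + 1)) * hermiteFun a x := by
    intro i
    rw [EuclideanSpace.basisFun_apply, SchwartzMap.lineDerivOp_apply,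
      lineDeriv_prod_erase_mul (u := fun j => hermite1D (a j)) i (hasDerivAt_hermite1D' (a i))
        fun y => ?_, hprod i x]
    · ring
    · rw [SchwartzMap.lineDerivOp_apply]
      exact lineDeriv_prod_erase_mul (u := fun j => hermite1D (a j)) i (hasDerivAt_hermite1D (a i))
        (hprod i) y
  rw [sum_apply, Finset.sum_congr rfl fun i _ => hsum i, ← Finset.sum_mul,
    EuclideanSpace.norm_sq_eq, smul_apply, smul_eq_mul, Finset.sum_sub_distrib,
    Finset.sum_add_distrib, ← Finset.mul_sum]
  simp
  ring

end

end HermiteSchwartz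

/-! ### Orthogonality of the Hermite functions. -/

section HermiteOrthogonality

noncomputable section

theorem integrable_eval_mul_exp_neg_sq (p : Polynomial ℝ) :
    Integrable (fun t : ℝ => p.eval t * Real.exp (-t ^ 2)) := by
  have h : ∀ k : ℕ, Integrable (fun t : ℝ => t ^ k * Real.exp (-t ^ 2)) := by
    intro k
    have h1 := integrable_rpow_mul_exp_neg_mul_sq (b := 1) one_pos (s := k)
      (by linarith [(Nat.cast_nonneg k : (0 : ℝ) ≤ k)])
    simpa [Real.rpow_natCast] using h1
  simp only [Polynomial.eval_eq_sum_range, Finset.sum_mul, mul_assoc]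
  exact integrable_finsetSum _ fun k _ => (h k).const_mul _

/-- Integration by parts against the Gaussian weight. -/
theorem integral_eval_mul_hermite_by_parts (p q : Polynomial ℝ) :
    ∫ t : ℝ, p.eval t * ((2 * Polynomial.X * q - Polynomial.derivative q).eval t
        * Real.exp (-t ^ 2))
      = ∫ t : ℝ, (Polynomial.derivative p).eval t * (q.eval t * Real.exp (-t ^ 2)) := by
  have hint : ∀ p q : Polynomial ℝ,
      Integrable (fun t : ℝ => p.eval t * (q.eval t * Real.exp (-t ^ 2))) := by
    intro p q
    refine (integrable_eval_mul_exp_neg_sq (p * q)).congr (Filter.Eventually.of_forall fun t => ?_)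
    simp [mul_assoc]
  have hexp : ∀ t : ℝ, HasDerivAt (fun t : ℝ => Real.exp (-t ^ 2))
      (Real.exp (-t ^ 2) * (-(2 * t))) t := by
    intro t
    simpa using (hasDerivAt_pow 2 t).neg.exp
  have hv : ∀ t : ℝ, HasDerivAt (fun t : ℝ => -(q.eval t * Real.exp (-t ^ 2)))
      ((2 * Polynomial.X * q - Polynomial.derivative q).eval t * Real.exp (-t ^ 2)) t := by
    intro t
    refine ((q.hasDerivAt t).mul (hexp t)).neg.congr_deriv ?_
    simp
    ring
  have h := integral_mul_deriv_eq_deriv_mul_of_integrable (fun t _ => p.hasDerivAt t)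
    (fun t _ => hv t) (hint _ _) ((hint (Polynomial.derivative p) q).neg.congr
      (Filter.Eventually.of_forall fun t => by simp))
    ((hint p q).neg.congr (Filter.Eventually.of_forall fun t => by simp))
  rw [h, ← integral_neg]
  exact integral_congr_ae (Filter.Eventually.of_forall fun t => by simp)

/-- The raising operator `q ↦ 2Xq - q'` is adjoint to differentiation for the Gaussian weight, and
`H_{m+1}' = 2(m + 1) H_m`. One integration by parts therefore lowers both degrees. -/
theorem integral_hermiteH_mul_hermiteH (m n : ℕ) :
    ∫ t : ℝ, (hermiteH m).eval t * ((hermiteH n).eval t * Real.exp (-t ^ 2))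
      = if m = n then 2 ^ m * m.factorial * Real.sqrt Real.pi else 0 := by
  have hzero : ∀ n : ℕ, ∫ t : ℝ, (hermiteH 0).eval t
      * ((hermiteH (n + 1)).eval t * Real.exp (-t ^ 2)) = 0 := by
    intro n
    rw [hermiteH_succ, integral_eval_mul_hermite_by_parts]
    simp [hermiteH]
  induction m generalizing n with
  | zero =>
    rcases n with _ | n
    · have := integral_gaussian 1
      simpa [hermiteH] using this
    · rw [hzero, if_neg (by omega)]
  | succ m ih =>
    rcases n with _ | n
    · rw [if_neg (by omega), ← hzero m]
      exact integral_congr_ae (Filter.Eventually.of_forall fun t => by ring)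
    · rw [hermiteH_succ n, integral_eval_mul_hermite_by_parts, derivative_hermiteH_succ]
      have e : ∀ t : ℝ, (2 * ((m : Polynomial ℝ) + 1) * hermiteH m).eval t
          * ((hermiteH n).eval t * Real.exp (-t ^ 2))
          = 2 * ((m : ℝ) + 1) * ((hermiteH m).eval t
            * ((hermiteH n).eval t * Real.exp (-t ^ 2))) := by
        intro t
        simp
        ring
      simp only [e]
      rw [integral_const_mul, ih]
      by_cases hmn : m = n
      · subst hmn
        simp only [if_true, Nat.factorial_succ]
        push_cast
        ring
      · rw [if_neg hmn, if_neg (by omega), mul_zero]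

theorem integral_hermite1D_mul (m n : ℕ) :
    ∫ t : ℝ, hermite1D m t * hermite1D n t = if m = n then Real.sqrt Real.pi else 0 := by
  have e : ∀ t : ℝ, hermite1D m t * hermite1D n t
      = (1 / (Real.sqrt (2 ^ m * m.factorial) * Real.sqrt (2 ^ n * n.factorial)))
        * ((hermiteH m).eval t * ((hermiteH n).eval t * Real.exp (-t ^ 2))) := by
    intro t
    have h1 : Real.exp (-t ^ 2) = Real.exp (-(t ^ 2 / 2)) * Real.exp (-(t ^ 2 / 2)) := by
      rw [← Real.exp_add]
      ring_nf
    rw [hermite1D, hermite1D, h1]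
    ring
  simp only [e]
  rw [integral_const_mul, integral_hermiteH_mul_hermiteH]
  by_cases h : m = n
  · subst h
    rw [if_pos rfl, if_pos rfl, Real.mul_self_sqrt (by positivity)]
    field_simp
  · rw [if_neg h, if_neg h, mul_zero]

theorem integral_hermiteFun_mul {d : ℕ} (a b : Fin d →₀ ℕ) :
    ∫ x, hermiteFun a x * hermiteFun b x = if a = b then Real.sqrt Real.pi ^ d else 0 := by
  have h := (EuclideanSpace.volume_preserving_symm_measurableEquiv_toLp (Fin d)).integral_comp'
    (fun y : Fin d → ℝ => ∏ i, (hermite1D (a i) (y i) * hermite1D (b i) (y i)))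
  rw [integral_fintype_prod_volume_eq_prod
    (fun i t => hermite1D (a i) t * hermite1D (b i) t)] at h
  simp only [integral_hermite1D_mul] at h
  have e : ∀ x : EuclideanSpace ℝ (Fin d), hermiteFun a x * hermiteFun b x
      = ∏ i, (hermite1D (a i) ((MeasurableEquiv.toLp 2 (Fin d → ℝ)).symm x i)
        * hermite1D (b i) ((MeasurableEquiv.toLp 2 (Fin d → ℝ)).symm x i)) := by
    intro x
    rw [hermiteFun_eq_prod, hermiteFun_eq_prod, ← Finset.prod_mul_distrib]
    rfl
  simp only [e]
  rw [h]
  split_ifs with hab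
  · subst hab
    simp
  · obtain ⟨i, hi⟩ := Finsupp.ne_iff.1 hab
    exact Finset.prod_eq_zero (Finset.mem_univ i) (if_neg hi)

end

end HermiteOrthogonality

/-! ### Completeness through characteristic functions. -/

section HermiteCompleteness

noncomputable section

/-- An integrable function all of whose characteristic integrals vanish is zero. -/
theorem ae_eq_zero_of_integral_exp_inner {E : Type*} [NormedAddCommGroup E]
    [InnerProductSpace ℝ E] [MeasurableSpace E] [BorelSpace E] [SecondCountableTopology E]
    [CompleteSpace E] {μ : Measure E} {h : E → ℝ} (hint : Integrable h μ)
    (h0 : ∀ t : E, ∫ x, (h x : ℂ) * Complex.exp ((inner ℝ x t : ℝ) * Complex.I) ∂μ = 0) :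
    h =ᵐ[μ] 0 := by
  have hm := hint.aestronglyMeasurable.aemeasurable
  have hm' : AEMeasurable (fun x => -h x) μ := hm.neg
  have f1 : IsFiniteMeasure (μ.withDensity fun x => ENNReal.ofReal (h x)) :=
    isFiniteMeasure_withDensity_ofReal hint.2
  have f2 : IsFiniteMeasure (μ.withDensity fun x => ENNReal.ofReal (-h x)) :=
    isFiniteMeasure_withDensity_ofReal hint.neg.2
  have hexp : ∀ t x : E, ‖Complex.exp ((inner ℝ x t : ℝ) * Complex.I)‖ = 1 := fun t x =>
    Complex.norm_exp_ofReal_mul_I _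
  have hmeas : ∀ t : E, AEStronglyMeasurable
      (fun x : E => Complex.exp ((inner ℝ x t : ℝ) * Complex.I)) μ := fun t =>
    Continuous.aestronglyMeasurable (by fun_prop)
  have hpos : ∀ g : E → ℝ, Integrable g μ → ∀ t : E, Integrable (fun x =>
      (ENNReal.ofReal (g x)).toReal • Complex.exp ((inner ℝ x t : ℝ) * Complex.I)) μ := by
    intro g hg t
    refine Integrable.mono' hg.norm ?_ (Filter.Eventually.of_forall fun x => ?_)
    · exact (hg.aestronglyMeasurable.aemeasurable.ennreal_ofReal.ennreal_toReal
        |>.aestronglyMeasurable).smul (hmeas t)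
    · rw [norm_smul, hexp, mul_one, ENNReal.toReal_ofReal', Real.norm_eq_abs, Real.norm_eq_abs,
        abs_of_nonneg (le_max_right _ _)]
      exact max_le (le_abs_self _) (abs_nonneg _)
  -- The positive and negative parts of `h` are densities of finite measures with equal
  -- characteristic functions, hence the measures agree.
  have hchar : charFun (μ.withDensity fun x => ENNReal.ofReal (h x))
      = charFun (μ.withDensity fun x => ENNReal.ofReal (-h x)) := by
    ext t
    rw [charFun_apply, charFun_apply,
      integral_withDensity_eq_integral_toReal_smul₀ hm.ennreal_ofReal
        (Filter.Eventually.of_forall fun x => ENNReal.ofReal_lt_top),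
      integral_withDensity_eq_integral_toReal_smul₀ hm'.ennreal_ofReal
        (Filter.Eventually.of_forall fun x => ENNReal.ofReal_lt_top), ← sub_eq_zero,
      ← integral_sub (hpos h hint t) (hpos (fun x => -h x) hint.neg t), ← h0 t]
    refine integral_congr_ae (Filter.Eventually.of_forall fun x => ?_)
    simp only [ENNReal.toReal_ofReal', ← sub_smul]
    rw [max_zero_sub_eq_self, Complex.real_smul]
  have heq := Measure.ext_of_charFun hchar
  rw [withDensity_eq_iff hm.ennreal_ofReal hm'.ennreal_ofReal
    hint.lintegral_lt_top.ne] at heq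
  filter_upwards [heq] with x hx
  rcases le_total 0 (h x) with h1 | h1
  · rw [ENNReal.ofReal_of_nonpos (by linarith : -h x ≤ 0), ENNReal.ofReal_eq_zero] at hx
    exact le_antisymm (show h x ≤ 0 from hx) h1
  · rw [ENNReal.ofReal_of_nonpos h1, eq_comm, ENNReal.ofReal_eq_zero] at hx
    exact le_antisymm h1 (show 0 ≤ h x by linarith)

variable {d : ℕ}

/-- The span of the (polynomial) Hermite features. -/
def hermiteSpan (d : ℕ) : Submodule ℝ (EuclideanSpace ℝ (Fin d) → ℝ) :=
  Submodule.span ℝ (Set.range fun (a : Fin d →₀ ℕ) x => hermiteFeature a x.ofLp)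

theorem one_mem_hermiteSpan : (fun _ => (1 : ℝ)) ∈ hermiteSpan d := by
  refine Submodule.subset_span ⟨0, ?_⟩
  ext x
  simp [hermiteFeature, hermiteH]

/-- The normalised form of `t H_m = H_{m+1}/2 + m H_{m-1}`; for `m = 0` the second term is absent,
so `c₂ = 0` and `k` is arbitrary. -/
theorem exists_mul_hermite_eq (m : ℕ) : ∃ (c₁ c₂ : ℝ) (k : ℕ), ∀ t : ℝ,
    t * ((hermiteH m).eval t / Real.sqrt (2 ^ m * m.factorial))
      = c₁ * ((hermiteH (m + 1)).eval t / Real.sqrt (2 ^ (m + 1) * (m + 1).factorial))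
        + c₂ * ((hermiteH k).eval t / Real.sqrt (2 ^ k * k.factorial)) := by
  have hN : ∀ m : ℕ, Real.sqrt (2 ^ m * m.factorial) ≠ 0 := fun m =>
    (Real.sqrt_pos.2 (by positivity)).ne'
  rcases m with _ | m
  · refine ⟨Real.sqrt (2 ^ (0 + 1) * (0 + 1).factorial) / 2, 0, 0, fun t => ?_⟩
    have := hN (0 + 1)
    field_simp
    simp [hermiteH]
    ring
  · refine ⟨Real.sqrt (2 ^ (m + 2) * (m + 2).factorial) / 2 / Real.sqrt (2 ^ (m + 1)
      * (m + 1).factorial), ((m : ℝ) + 1) * Real.sqrt (2 ^ m * m.factorial)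
      / Real.sqrt (2 ^ (m + 1) * (m + 1).factorial), m, fun t => ?_⟩
    have h1 := hN m
    have h2 := hN (m + 1)
    have h3 := hN (m + 2)
    rw [show m + 1 + 1 = m + 2 from rfl, eval_hermiteH_succ_succ]
    field_simp
    ring

theorem coord_mul_hermiteFeature_mem (i : Fin d) (a : Fin d →₀ ℕ) :
    (fun x : EuclideanSpace ℝ (Fin d) => x i * hermiteFeature a x.ofLp) ∈ hermiteSpan d := by
  obtain ⟨c₁, c₂, k, h⟩ := exists_mul_hermite_eq (a i)
  have hupd : ∀ (m : ℕ) (x : EuclideanSpace ℝ (Fin d)), hermiteFeature (a.update i m) x.ofLp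
      = (∏ j ∈ Finset.univ.erase i,
          (hermiteH (a j)).eval (x j) / Real.sqrt (2 ^ a j * (a j).factorial))
        * ((hermiteH m).eval (x i) / Real.sqrt (2 ^ m * m.factorial)) := by
    intro m x
    rw [hermiteFeature, ← Finset.prod_erase_mul _ _ (Finset.mem_univ i)]
    congr 1
    · refine Finset.prod_congr rfl fun j hj => ?_
      simp [Finset.ne_of_mem_erase hj]
    · simp
  have e : (fun x : EuclideanSpace ℝ (Fin d) => x i * hermiteFeature a x.ofLp)
      = c₁ • (fun x : EuclideanSpace ℝ (Fin d) => hermiteFeature (a.update i (a i + 1)) x.ofLp)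
        + c₂ • fun x : EuclideanSpace ℝ (Fin d) => hermiteFeature (a.update i k) x.ofLp := by
    ext x
    simp only [Pi.add_apply, Pi.smul_apply, smul_eq_mul]
    rw [hupd, hupd]
    have h2 := hupd (a i) x
    rw [Finsupp.update_self] at h2
    rw [h2]
    linear_combination (∏ j ∈ Finset.univ.erase i,
          (hermiteH (a j)).eval (x j) / Real.sqrt (2 ^ a j * (a j).factorial)) * h (x i)
  rw [e]
  exact add_mem (Submodule.smul_mem _ _ (Submodule.subset_span ⟨_, rfl⟩))
    (Submodule.smul_mem _ _ (Submodule.subset_span ⟨_, rfl⟩))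

theorem coord_mul_mem_hermiteSpan (i : Fin d) {P : EuclideanSpace ℝ (Fin d) → ℝ}
    (hP : P ∈ hermiteSpan d) : (fun x => x i * P x) ∈ hermiteSpan d := by
  rw [hermiteSpan] at hP
  induction hP using Submodule.span_induction with
  | mem P hP =>
    obtain ⟨a, rfl⟩ := hP
    exact coord_mul_hermiteFeature_mem i a
  | zero =>
    refine (congrArg (· ∈ hermiteSpan d) ?_).mp (zero_mem _)
    ext x
    simp
  | add P Q _ _ h1 h2 =>
    refine (congrArg (· ∈ hermiteSpan d) ?_).mp (add_mem h1 h2)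
    ext x
    simp [mul_add]
  | smul c P _ h =>
    refine (congrArg (· ∈ hermiteSpan d) ?_).mp (Submodule.smul_mem _ c h)
    ext x
    simp [mul_left_comm]

/-- The span contains `1` and is stable under multiplication by coordinates; powers of linear forms
are all that the exponential series needs. -/
theorem inner_pow_mem_hermiteSpan (t : EuclideanSpace ℝ (Fin d)) (k : ℕ) :
    (fun x : EuclideanSpace ℝ (Fin d) => (inner ℝ x t : ℝ) ^ k) ∈ hermiteSpan d := by
  induction k with
  | zero => simpa using one_mem_hermiteSpan
  | succ k ih =>
    have h : (∑ i : Fin d, t i • fun x : EuclideanSpace ℝ (Fin d) =>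
        x i * (inner ℝ x t : ℝ) ^ k) ∈ hermiteSpan d :=
      Submodule.sum_mem _ fun i _ => Submodule.smul_mem _ _ (coord_mul_mem_hermiteSpan i ih)
    refine (congrArg (· ∈ hermiteSpan d) ?_).mp h
    ext x
    simp only [Finset.sum_apply, Pi.smul_apply, smul_eq_mul, pow_succ']
    generalize (inner ℝ x t : ℝ) ^ k = r
    rw [PiLp.inner_apply, Finset.sum_mul]
    refine Finset.sum_congr rfl fun i _ => ?_
    simp
    ring

/-- The Hermite functions are complete in `L²`. -/
theorem eq_zero_of_forall_integral_mul_hermiteFun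
    (f : Lp ℝ 2 (volume : Measure (EuclideanSpace ℝ (Fin d))))
    (h : ∀ a : Fin d →₀ ℕ, ∫ x, f x * hermiteFun a x = 0) : f = 0 := by
  set g := gaussianSchwartz (EuclideanSpace ℝ (Fin d)) with hg
  have hspan : ∀ P ∈ hermiteSpan d, Integrable (fun x => f x * (P x * g x)) ∧
      ∫ x, f x * (P x * g x) = 0 := by
    intro P hP
    rw [hermiteSpan] at hP
    induction hP using Submodule.span_induction with
    | mem P hP =>
      obtain ⟨a, rfl⟩ := hP
      have e : ∀ x, f x * (hermiteFeature a x.ofLp * g x) = f x * hermiteFun a x := fun x => by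
        rw [hermiteFun_apply, hg, gaussianSchwartz_apply]
      simp only [e]
      exact ⟨integrable_Lp_two_mul_schwartz f _, h a⟩
    | zero => simp
    | add P Q _ _ h1 h2 =>
      have e : ∀ x, f x * ((P + Q) x * g x) = f x * (P x * g x) + f x * (Q x * g x) := fun x => by
        rw [Pi.add_apply]
        ring
      simp only [e]
      exact ⟨h1.1.add h2.1, by rw [integral_add h1.1 h2.1, h1.2, h2.2, add_zero]⟩
    | smul c P _ h1 =>
      have e : ∀ x, f x * ((c • P) x * g x) = c * (f x * (P x * g x)) := fun x => by
        rw [Pi.smul_apply, smul_eq_mul]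
        ring
      simp only [e]
      exact ⟨h1.1.const_mul c, by rw [integral_const_mul, h1.2, mul_zero]⟩
  have hshift : ∀ t : EuclideanSpace ℝ (Fin d),
      Integrable (fun x => |f x| * g (x - t)) := by
    intro t
    have h1 := (g.memLp 2 volume).comp_measurePreserving (measurePreserving_sub_right volume t)
    exact (Lp.memLp f).norm.integrable_mul h1
  -- Completing the square turns `g(x) e^(±⟨x,t⟩)` into a multiple of a translated Gaussian.
  -- Translates are in `L²`, which provides the integrable majorant for termwise integration.
  have hgexp : ∀ x t : EuclideanSpace ℝ (Fin d),
      g x * Real.exp |(inner ℝ x t : ℝ)| ≤ Real.exp (‖t‖ ^ 2 / 2) * (g (x - t) + g (x - -t)) := by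
    intro x t
    have h1 : ∀ u : EuclideanSpace ℝ (Fin d), Real.exp (‖u‖ ^ 2 / 2) * g (x - u)
        = g x * Real.exp (inner ℝ x u : ℝ) := by
      intro u
      rw [hg, gaussianSchwartz_apply, gaussianSchwartz_apply, ← Real.exp_add, ← Real.exp_add,
        norm_sub_sq_real]
      ring_nf
    have h2 := h1 t
    have h3 := h1 (-t)
    rw [norm_neg, inner_neg_right] at h3
    rw [mul_add, h2, h3, ← mul_add]
    have hg0 : 0 ≤ g x := by
      rw [hg, gaussianSchwartz_apply]
      positivity
    gcongr
    rcases abs_cases (inner ℝ x t : ℝ) with ⟨e, _⟩ | ⟨e, _⟩ <;> rw [e] <;>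
      linarith [Real.exp_pos (inner ℝ x t : ℝ), Real.exp_pos (-(inner ℝ x t : ℝ))]
  have hint : Integrable (fun x => f x * g x) := by
    simpa using (hspan _ one_mem_hermiteSpan).1
  have hzero : ∀ t : EuclideanSpace ℝ (Fin d),
      ∫ x, ((f x * g x : ℝ) : ℂ) * Complex.exp ((inner ℝ x t : ℝ) * Complex.I) = 0 := by
    intro t
    have hfm : AEStronglyMeasurable (fun x => ((f x * g x : ℝ) : ℂ)) volume :=
      hint.ofReal.aestronglyMeasurable
    have hg0 : ∀ x, 0 ≤ g x := fun x => by
      rw [hg, gaussianSchwartz_apply]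
      positivity
    have hexpsum : ∀ x : EuclideanSpace ℝ (Fin d), HasSum
        (fun k : ℕ => |f x| * g x * (|(inner ℝ x t : ℝ)| ^ k / k.factorial))
        (|f x| * g x * Real.exp |(inner ℝ x t : ℝ)|) := by
      intro x
      have := NormedSpace.expSeries_div_hasSum_exp |(inner ℝ x t : ℝ)|
      rw [← Real.exp_eq_exp_ℝ] at this
      exact this.mul_left _
    -- The exponential is expanded and integrated term by term; each term pairs `f` with a power of
    -- a linear form times the Gaussian, and vanishes.
    have hs := hasSum_integral_of_dominated_convergence
      (μ := (volume : Measure (EuclideanSpace ℝ (Fin d))))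
      (F := fun (k : ℕ) x => ((f x * g x : ℝ) : ℂ)
        * (((inner ℝ x t : ℝ) * Complex.I) ^ k / k.factorial))
      (f := fun x => ((f x * g x : ℝ) : ℂ) * Complex.exp ((inner ℝ x t : ℝ) * Complex.I))
      (fun k x => |f x| * g x * (|(inner ℝ x t : ℝ)| ^ k / k.factorial))
      (fun k => hfm.mul (Continuous.aestronglyMeasurable (by fun_prop)))
      (fun k => Filter.Eventually.of_forall fun x => ?_)
      (Filter.Eventually.of_forall fun x => (hexpsum x).summable) ?_
      (Filter.Eventually.of_forall fun x => ?_)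
    · have hterm : ∀ k : ℕ, ∫ x, ((f x * g x : ℝ) : ℂ)
          * (((inner ℝ x t : ℝ) * Complex.I) ^ k / k.factorial) = 0 := by
        intro k
        have e : ∀ x, ((f x * g x : ℝ) : ℂ) * (((inner ℝ x t : ℝ) * Complex.I) ^ k / k.factorial)
            = (Complex.I ^ k / k.factorial)
              * ((f x * ((inner ℝ x t : ℝ) ^ k * g x) : ℝ) : ℂ) := by
          intro x
          push_cast
          ring
        simp only [e]
        rw [integral_const_mul, integral_complex_ofReal,
          (hspan _ (inner_pow_mem_hermiteSpan t k)).2]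
        simp
      simp only [hterm] at hs
      exact hs.unique hasSum_zero
    · rw [norm_mul, norm_div, norm_pow, norm_mul, Complex.norm_I, mul_one, Complex.norm_real,
        Complex.norm_real, Real.norm_eq_abs, Real.norm_eq_abs, abs_mul, abs_of_nonneg (hg0 x),
        Complex.norm_natCast]
    · have e : ∀ x, ∑' k : ℕ, |f x| * g x * (|(inner ℝ x t : ℝ)| ^ k / k.factorial)
          = |f x| * g x * Real.exp |(inner ℝ x t : ℝ)| := fun x => (hexpsum x).tsum_eq
      simp only [e]
      refine Integrable.mono' (((hshift t).add (hshift (-t))).const_mul (Real.exp (‖t‖ ^ 2 / 2)))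
        ?_ (Filter.Eventually.of_forall fun x => ?_)
      · refine AEStronglyMeasurable.mul (AEStronglyMeasurable.mul
          (Lp.aestronglyMeasurable f).norm g.continuous.aestronglyMeasurable)
          (Continuous.aestronglyMeasurable (by fun_prop))
      · have h0 : 0 ≤ |f x| * g x * Real.exp |(inner ℝ x t : ℝ)| :=
          mul_nonneg (mul_nonneg (abs_nonneg _) (hg0 x)) (Real.exp_pos _).le
        rw [Real.norm_of_nonneg h0, mul_assoc]
        refine (mul_le_mul_of_nonneg_left (hgexp x t) (abs_nonneg _)).trans_eq ?_
        simp only [Pi.add_apply]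
        ring
    · have := NormedSpace.expSeries_div_hasSum_exp ((inner ℝ x t : ℝ) * Complex.I)
      rw [← Complex.exp_eq_exp_ℂ] at this
      exact this.mul_left _
  have hae := ae_eq_zero_of_integral_exp_inner hint hzero
  refine (Lp.eq_zero_iff_ae_eq_zero).2 ?_
  filter_upwards [hae] with x hx
  have hgx : g x ≠ 0 := by
    rw [hg, gaussianSchwartz_apply]
    exact (Real.exp_pos _).ne'
  exact (mul_eq_zero.1 hx).resolve_right hgx

end

end HermiteCompleteness

/-! ### The Hermite basis of the eigenspace and independence of the basis. -/

section OscillatorEigenspace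

noncomputable section

variable {d : ℕ}

theorem inner_Lp_two_eq (f g : Lp ℝ 2 (volume : Measure (EuclideanSpace ℝ (Fin d)))) :
    (inner ℝ f g : ℝ) = ∫ x, f x * g x := by
  rw [L2.inner_def]
  refine integral_congr_ae (Filter.Eventually.of_forall fun x => ?_)
  simp [mul_comm]

theorem integral_mul_harmonicOscillator_comm (f g : 𝓢(EuclideanSpace ℝ (Fin d), ℝ)) :
    ∫ x, f x * harmonicOscillator g x = ∫ x, harmonicOscillator f x * g x := by
  have ht : Function.HasTemperateGrowth (fun x : EuclideanSpace ℝ (Fin d) => ‖x‖ ^ 2) := by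
    fun_prop
  set M := SchwartzMap.smulLeftCLM ℝ (fun x : EuclideanSpace ℝ (Fin d) => ‖x‖ ^ 2) with hM
  have hint : ∀ u v : 𝓢(EuclideanSpace ℝ (Fin d), ℝ), Integrable (fun x => u x * v x) :=
    fun u v => (u.memLp 2).integrable_mul (v.memLp 2)
  have e1 : ∀ x, f x * harmonicOscillator g x = f x * M g x - f x * Δ g x := fun x => by
    simp only [harmonicOscillator, add_apply, neg_apply]
    ring
  have e2 : ∀ x, harmonicOscillator f x * g x = f x * M g x - Δ f x * g x := fun x => by
    simp only [harmonicOscillator, add_apply, neg_apply, hM,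
      SchwartzMap.smulLeftCLM_apply_apply ht, smul_eq_mul]
    ring
  simp only [e1, e2]
  rw [integral_sub (hint _ _) (hint _ _), integral_sub (hint _ _) (hint _ _),
    SchwartzMap.integral_mul_laplacian_right_eq_left]

/-- The `L²`-normalised Hermite functions. -/
def hermiteLp (a : Fin d →₀ ℕ) : Lp ℝ 2 (volume : Measure (EuclideanSpace ℝ (Fin d))) :=
  (Real.sqrt (Real.sqrt Real.pi ^ d))⁻¹ • (hermiteFun a).toLp 2 volume

theorem coeFn_hermiteLp (a : Fin d →₀ ℕ) :
    hermiteLp a =ᵐ[volume] fun x => (Real.sqrt (Real.sqrt Real.pi ^ d))⁻¹ * hermiteFun a x := by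
  filter_upwards [Lp.coeFn_smul (Real.sqrt (Real.sqrt Real.pi ^ d))⁻¹ ((hermiteFun a).toLp 2 volume),
    (hermiteFun a).coeFn_toLp 2] with x h1 h2
  rw [hermiteLp, h1, Pi.smul_apply, h2, smul_eq_mul]

theorem inner_hermiteLp (f : Lp ℝ 2 (volume : Measure (EuclideanSpace ℝ (Fin d))))
    (a : Fin d →₀ ℕ) : (inner ℝ (hermiteLp a) f : ℝ)
      = (Real.sqrt (Real.sqrt Real.pi ^ d))⁻¹ * ∫ x, f x * hermiteFun a x := by
  rw [inner_Lp_two_eq, ← integral_const_mul]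
  refine integral_congr_ae ?_
  filter_upwards [coeFn_hermiteLp a] with x hx
  rw [hx]
  ring

theorem orthonormal_hermiteLp : Orthonormal ℝ (hermiteLp (d := d)) := by
  rw [orthonormal_iff_ite]
  intro a b
  have e : ∫ x, hermiteLp b x * hermiteFun a x
      = (Real.sqrt (Real.sqrt Real.pi ^ d))⁻¹ * ∫ x, hermiteFun a x * hermiteFun b x := by
    rw [← integral_const_mul]
    refine integral_congr_ae ?_
    filter_upwards [coeFn_hermiteLp b] with x hx
    rw [hx]
    ring
  rw [inner_hermiteLp, e, integral_hermiteFun_mul]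
  split_ifs
  · have h : 0 < Real.sqrt Real.pi ^ d := by positivity
    rw [← mul_assoc, ← mul_inv, Real.mul_self_sqrt h.le, inv_mul_cancel₀ h.ne']
  · simp

theorem hermiteLp_mem {n : ℕ} {a : Fin d →₀ ℕ} (ha : ∑ i, a i = n) :
    hermiteLp a ∈ oscEigenspace d n := by
  refine Submodule.smul_mem _ _ fun φ => ?_
  have h : ∀ ψ : 𝓢(EuclideanSpace ℝ (Fin d), ℝ),
      ∫ x, ((hermiteFun a).toLp 2 : Lp ℝ 2 volume) x * ψ x = ∫ x, hermiteFun a x * ψ x := by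
    intro ψ
    refine integral_congr_ae ?_
    filter_upwards [(hermiteFun a).coeFn_toLp 2] with x hx
    rw [hx]
  rw [h, h, integral_mul_harmonicOscillator_comm, harmonicOscillator_hermiteFun, ha,
    ← integral_const_mul]
  refine integral_congr_ae (Filter.Eventually.of_forall fun x => ?_)
  simp only [smul_apply, smul_eq_mul]
  ring

/-- Testing the distributional equation on a Hermite function of another degree gives two different
eigenvalues for the same pairing. -/
theorem integral_mul_hermiteFun_eq_zero {n : ℕ}
    {f : Lp ℝ 2 (volume : Measure (EuclideanSpace ℝ (Fin d)))} (hf : f ∈ oscEigenspace d n)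
    {a : Fin d →₀ ℕ} (ha : ∑ i, a i ≠ n) : ∫ x, f x * hermiteFun a x = 0 := by
  have h := hf (hermiteFun a)
  rw [harmonicOscillator_hermiteFun] at h
  have e : ∀ x, f x * ((2 * ((∑ i, a i : ℕ) : ℝ) + d) • hermiteFun a) x
      = (2 * ((∑ i, a i : ℕ) : ℝ) + d) * (f x * hermiteFun a x) := fun x => by
    simp only [smul_apply, smul_eq_mul]
    ring
  simp only [e] at h
  rw [integral_const_mul] at h
  have hne : ((∑ i, a i : ℕ) : ℝ) - n ≠ 0 := sub_ne_zero.2 (Nat.cast_injective.ne ha)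
  exact (mul_eq_zero.1 (by linear_combination h / 2 :
    (((∑ i, a i : ℕ) : ℝ) - n) * ∫ x, f x * hermiteFun a x = 0)).resolve_left hne

/-- The multi-indices of weight `n`. -/
abbrev MultiIndex (d n : ℕ) : Type :=
  {a : Fin d →₀ ℕ // a ∈ Finset.finsuppAntidiag (Finset.univ : Finset (Fin d)) n}

theorem MultiIndex.sum_eq {n : ℕ} (a : MultiIndex d n) : ∑ i, a.1 i = n :=
  (Finset.mem_finsuppAntidiag.1 a.2).1

/-- The difference of the two sides is orthogonal to every Hermite function: by orthonormality in
degree `n`, by the eigenvalue mismatch in the others. Completeness concludes. -/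
theorem eq_sum_inner_hermiteLp {n : ℕ}
    {f : Lp ℝ 2 (volume : Measure (EuclideanSpace ℝ (Fin d)))} (hf : f ∈ oscEigenspace d n) :
    f = ∑ a : MultiIndex d n, (inner ℝ (hermiteLp a.1) f : ℝ) • hermiteLp a.1 := by
  rw [← sub_eq_zero]
  refine eq_zero_of_forall_integral_mul_hermiteFun _ fun b => ?_
  have hK : (Real.sqrt (Real.sqrt Real.pi ^ d))⁻¹ ≠ 0 :=
    inv_ne_zero (Real.sqrt_pos.2 (by positivity)).ne'
  refine (mul_eq_zero.1 ?_).resolve_left hK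
  rw [← inner_hermiteLp, inner_sub_right, inner_sum]
  simp only [inner_smul_right, orthonormal_iff_ite.1 orthonormal_hermiteLp]
  by_cases hb : ∑ i, b i = n
  · have hb' : b ∈ Finset.finsuppAntidiag (Finset.univ : Finset (Fin d)) n :=
      Finset.mem_finsuppAntidiag.2 ⟨hb, Finset.subset_univ _⟩
    rw [Finset.sum_eq_single (⟨b, hb'⟩ : MultiIndex d n)]
    · simp
    · intro c _ hc
      rw [if_neg, mul_zero]
      rintro rfl
      exact hc rfl
    · simp
  · rw [inner_hermiteLp, integral_mul_hermiteFun_eq_zero hf hb, Finset.sum_eq_zero]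
    · simp
    · intro c _
      rw [if_neg, mul_zero]
      rintro rfl
      exact hb c.sum_eq

/-- The Hermite functions of degree `n` as an orthonormal basis of the eigenspace. -/
def hermiteBasis (d n : ℕ) : OrthonormalBasis (MultiIndex d n) ℝ (oscEigenspace d n) :=
  OrthonormalBasis.mk (v := fun a => ⟨hermiteLp a.1, hermiteLp_mem a.sum_eq⟩)
    (by
      rw [orthonormal_iff_ite]
      intro a b
      rw [Submodule.coe_inner, orthonormal_iff_ite.1 orthonormal_hermiteLp]
      exact if_congr Subtype.ext_iff.symm rfl rfl)
    (by
      rintro ⟨f, hf⟩ -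
      have h : (⟨f, hf⟩ : oscEigenspace d n) = ∑ a : MultiIndex d n,
          (inner ℝ (hermiteLp a.1) f : ℝ) • ⟨hermiteLp a.1, hermiteLp_mem a.sum_eq⟩ := by
        ext1
        rw [Submodule.coe_sum]
        exact eq_sum_inner_hermiteLp hf
      rw [h]
      exact Submodule.sum_mem _ fun a _ =>
        Submodule.smul_mem _ _ (Submodule.subset_span ⟨a, rfl⟩))

theorem coe_hermiteBasis {n : ℕ} (a : MultiIndex d n) :
    (hermiteBasis d n a : Lp ℝ 2 (volume : Measure (EuclideanSpace ℝ (Fin d))))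
      = hermiteLp a.1 := by
  simp [hermiteBasis]

theorem finiteDimensional_oscEigenspace (d n : ℕ) : FiniteDimensional ℝ (oscEigenspace d n) :=
  (hermiteBasis d n).toBasis.finiteDimensional_of_finite

theorem oscDim_eq_choose (d n : ℕ) : oscDim d n = (d + n - 1).choose n := by
  rw [oscDim, Module.finrank_eq_card_basis (hermiteBasis d n).toBasis, Fintype.card_coe,
    Finset.card_finsuppAntidiag_nat_eq_choose, Finset.card_fin]

theorem exists_isOscEigenbasis (d n : ℕ) :
    ∃ φ : Fin (oscDim d n) → EuclideanSpace ℝ (Fin d) → ℝ, IsOscEigenbasis d n φ := by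
  have hcard : Fintype.card (MultiIndex d n) = oscDim d n := by
    rw [oscDim, Module.finrank_eq_card_basis (hermiteBasis d n).toBasis]
  set e : MultiIndex d n ≃ Fin (oscDim d n) := Fintype.equivFinOfCardEq hcard
  refine ⟨fun k x => (Real.sqrt (Real.sqrt Real.pi ^ d))⁻¹ * hermiteFun (e.symm k).1 x,
    fun k => continuous_const.mul (hermiteFun _).continuous, (hermiteBasis d n).reindex e,
    fun k => ?_⟩
  rw [OrthonormalBasis.reindex_apply, coe_hermiteBasis]
  exact coeFn_hermiteLp _

/-- Evaluation differences are represented by a vector: `φ_k(x) - φ_k(y) = ⟨b_k, v⟩` with `v` in the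
eigenspace independent of `k`. Parseval in the two bases computes `‖v‖²` twice. -/
theorem IsOscEigenbasis.sum_sub_sq {n : ℕ}
    {φ : Fin (oscDim d n) → EuclideanSpace ℝ (Fin d) → ℝ} (hφ : IsOscEigenbasis d n φ)
    (x y : EuclideanSpace ℝ (Fin d)) :
    ∑ k, (φ k x - φ k y) ^ 2 = (Real.sqrt Real.pi ^ d)⁻¹
      * ∑ a ∈ Finset.finsuppAntidiag (Finset.univ : Finset (Fin d)) n,
          (hermiteFun a x - hermiteFun a y) ^ 2 := by
  obtain ⟨hc, b, hb⟩ := hφ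
  set κ := (Real.sqrt (Real.sqrt Real.pi ^ d))⁻¹ with hκ
  set B := hermiteBasis d n
  have hrep : ∀ k x, φ k x
      = ∑ a : MultiIndex d n, (inner ℝ (B a) (b k) : ℝ) * (κ * hermiteFun a.1 x) := by
    intro k
    -- Both sides are continuous, so equality almost everywhere for Lebesgue measure holds at every
    -- point.
    refine congrFun ((Continuous.ae_eq_iff_eq (volume : Measure (EuclideanSpace ℝ (Fin d)))
      (hc k) (continuous_finsetSum _ fun a _ => continuous_const.mul
        (continuous_const.mul (hermiteFun a.1).continuous))).1 ((hb k).symm.trans ?_))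
    have h1 : (b k : Lp ℝ 2 (volume : Measure (EuclideanSpace ℝ (Fin d))))
        = ∑ a : MultiIndex d n, (inner ℝ (B a) (b k) : ℝ) • hermiteLp a.1 := by
      conv_lhs => rw [← B.sum_repr' (b k)]
      rw [Submodule.coe_sum]
      refine Finset.sum_congr rfl fun a _ => ?_
      rw [Submodule.coe_smul, coe_hermiteBasis]
    rw [h1]
    have h2 : ∀ᵐ x ∂(volume : Measure (EuclideanSpace ℝ (Fin d))), ∀ a : MultiIndex d n,
        ((inner ℝ (B a) (b k) : ℝ) • hermiteLp a.1) x
          = (inner ℝ (B a) (b k) : ℝ) * (κ * hermiteFun a.1 x) := by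
      rw [ae_all_iff]
      intro a
      filter_upwards [Lp.coeFn_smul (inner ℝ (B a) (b k) : ℝ) (hermiteLp a.1),
        coeFn_hermiteLp a.1] with x h3 h4
      rw [h3, Pi.smul_apply, h4, smul_eq_mul]
    filter_upwards [h2, Lp.coeFn_finsetSum (Finset.univ : Finset (MultiIndex d n))
      fun a => (inner ℝ (B a) (b k) : ℝ) • hermiteLp a.1] with x h5 h6
    rw [h6, Finset.sum_apply]
    exact Finset.sum_congr rfl fun a _ => h5 a
  set v : oscEigenspace d n :=
    ∑ a : MultiIndex d n, (κ * (hermiteFun a.1 x - hermiteFun a.1 y)) • B a with hv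
  have hin : ∀ k, φ k x - φ k y = inner ℝ (b k) v := by
    intro k
    rw [hrep, hrep, ← Finset.sum_sub_distrib, hv, inner_sum]
    refine Finset.sum_congr rfl fun a _ => ?_
    have h := real_inner_smul_right (b k) (B a) (κ * (hermiteFun a.1 x - hermiteFun a.1 y))
    refine Eq.trans ?_ h.symm
    rw [real_inner_comm (B a)]
    ring
  have hBv : ∀ a, (inner ℝ (B a) v : ℝ) = κ * (hermiteFun a.1 x - hermiteFun a.1 y) := by
    intro a
    rw [hv, B.orthonormal.inner_right_fintype]
  simp only [hin]
  rw [b.sum_sq_inner_right, ← B.sum_sq_inner_right]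
  simp only [hBv, mul_pow]
  rw [← Finset.mul_sum, Finset.sum_coe_sort (Finset.finsuppAntidiag Finset.univ n)
    fun a => (hermiteFun a x - hermiteFun a y) ^ 2, hκ, inv_pow,
    Real.sq_sqrt (by positivity)]

end

end OscillatorEigenspace

/-! ### Dimension count and the final comparison. -/

section DudleyDistance

theorem oscDim_bounds {d : ℕ} (hd : 1 ≤ d) {n : ℕ} (hn : 1 ≤ n) :
    ((d - 1).factorial : ℝ)⁻¹ * (n : ℝ) ^ (d - 1) ≤ oscDim d n ∧
      (oscDim d n : ℝ) ≤ (d : ℝ) ^ (d - 1) * (n : ℝ) ^ (d - 1) := by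
  obtain ⟨k, rfl⟩ : ∃ k, d = k + 1 := ⟨d - 1, by omega⟩
  have hD : oscDim (k + 1) n = (n + k).choose k := by
    rw [oscDim_eq_choose, show k + 1 + n - 1 = n + k by omega, Nat.choose_symm_add]
  rw [hD, Nat.add_sub_cancel]
  constructor
  · rw [inv_mul_le_iff₀ (by positivity)]
    have h := Nat.pow_sub_le_descFactorial (n + k) k
    rw [Nat.descFactorial_eq_factorial_mul_choose] at h
    refine (pow_le_pow_left₀ (Nat.cast_nonneg _) (?_ : (n : ℝ) ≤ (n + k + 1 - k : ℕ)) k).trans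
      (by exact_mod_cast h)
    exact_mod_cast (by omega : n ≤ n + k + 1 - k)
  · rw [← mul_pow]
    refine (Nat.choose_le_pow_div (α := ℝ) k (n + k)).trans
      ((div_le_self (by positivity) (by exact_mod_cast Nat.factorial_pos k)).trans
        (pow_le_pow_left₀ (Nat.cast_nonneg _) ?_ k))
    exact_mod_cast (by nlinarith : n + k ≤ (k + 1) * n)

theorem inner_eq_one_sub_of_mem_sphere {d : ℕ} {x y : EuclideanSpace ℝ (Fin d)}
    (hx : ‖x‖ = 1) (hy : ‖y‖ = 1) : ∑ i, x i * y i = 1 - ‖x - y‖ ^ 2 / 2 := by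
  have h : (inner ℝ x y : ℝ) = ∑ i, x i * y i := by
    rw [PiLp.inner_apply]
    simp [mul_comm]
  rw [← h, norm_sub_sq_real, hx, hy]
  ring

theorem sum_hermiteFun_sub_sq {d : ℕ} (hd : 2 ≤ d) {x y : EuclideanSpace ℝ (Fin d)}
    (hx : ‖x‖ = 1) (hy : ‖y‖ = 1) (n : ℕ) :
    ∑ a ∈ Finset.finsuppAntidiag (Finset.univ : Finset (Fin d)) n,
        (hermiteFun a x - hermiteFun a y) ^ 2
      = Real.exp (-1) * (2 * PowerSeries.coeff n
        ((planarSeries 0 - planarSeries (‖x - y‖ ^ 2 / 2)) * mehlerSeries 0 0 ^ (d - 2))) := by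
  have hsq : ∀ z : EuclideanSpace ℝ (Fin d), ‖z‖ = 1 → ∑ i, z.ofLp i ^ 2 = 1 := fun z hz => by
    rw [← EuclideanSpace.real_norm_sq_eq, hz, one_pow]
  rw [← sum_hermiteFeature_sub_sq hd (hsq x hx) (hsq y hy)
    (inner_eq_one_sub_of_mem_sphere hx hy), Finset.mul_sum]
  refine Finset.sum_congr rfl fun a _ => ?_
  rw [hermiteFun_apply, hermiteFun_apply, hx, hy, ← sub_mul, mul_pow, ← Real.exp_nat_mul, mul_comm]
  norm_num

/-- Exponent bookkeeping: `-d/2 + (d - 1) = (d - 2)/2`, the order of the kernel gap. -/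
theorem rpow_mul_min_sq {d : ℕ} (hd : 2 ≤ d) {n : ℕ} (hn : 1 ≤ n) {r : ℝ} (hr : 0 ≤ r) :
    ((n : ℝ) ^ (-(d : ℝ) / 4) * min 1 (Real.sqrt n * r)) ^ 2 * (n : ℝ) ^ (d - 1)
      = Real.sqrt ((n : ℝ) ^ (d - 2)) * min 1 (n * r ^ 2) := by
  have hn0 : (0 : ℝ) < n := by exact_mod_cast hn
  have h1 : (min 1 (Real.sqrt n * r)) ^ 2 = min 1 (n * r ^ 2) := by
    have h0 : 0 ≤ Real.sqrt n * r := by positivity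
    have h2 : (Real.sqrt n * r) ^ 2 = n * r ^ 2 := by rw [mul_pow, Real.sq_sqrt hn0.le]
    rcases le_total 1 (Real.sqrt n * r) with h | h
    · rw [min_eq_left h, min_eq_left, one_pow]
      rw [← h2]
      exact one_le_pow₀ h
    · rw [min_eq_right h, h2, min_eq_right]
      rw [← h2]
      exact pow_le_one₀ h0 h
  have h3 : ((n : ℝ) ^ (-(d : ℝ) / 4)) ^ 2 * (n : ℝ) ^ (d - 1) = Real.sqrt ((n : ℝ) ^ (d - 2)) := by
    rw [Real.sqrt_eq_rpow, ← Real.rpow_natCast, ← Real.rpow_natCast, ← Real.rpow_natCast,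
      ← Real.rpow_mul hn0.le, ← Real.rpow_mul hn0.le, ← Real.rpow_add hn0]
    congr 1
    push_cast [Nat.cast_sub hd, Nat.cast_sub (show 1 ≤ d by omega)]
    ring
  rw [mul_pow, h1, mul_right_comm, h3]

theorem min_one_half_bounds {t : ℝ} (ht : 0 ≤ t) :
    min 1 t ≤ 2 * min 1 (t / 2) ∧ min 1 (t / 2) ≤ min 1 t := by
  refine ⟨?_, min_le_min_left _ (by linarith)⟩
  rw [mul_min_of_nonneg _ _ (by norm_num : (0 : ℝ) ≤ 2)]
  exact min_le_min (by norm_num) (by linarith)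

theorem exists_dudleyDist_bounds {d : ℕ} (hd : 2 ≤ d) :
    ∃ c C : ℝ, 0 < c ∧ 0 < C ∧ ∃ N : ℕ, ∀ n : ℕ, N ≤ n →
      ∀ φ : Fin (oscDim d n) → EuclideanSpace ℝ (Fin d) → ℝ, IsOscEigenbasis d n φ →
        ∀ x y : EuclideanSpace ℝ (Fin d), ‖x‖ = 1 → ‖y‖ = 1 → ‖x - y‖ ≤ 1 →
          c * ((n : ℝ) ^ (-(d : ℝ) / 4) * min 1 (Real.sqrt n * ‖x - y‖)) ≤ dudleyDist d n φ x y ∧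
          dudleyDist d n φ x y ≤
            C * ((n : ℝ) ^ (-(d : ℝ) / 4) * min 1 (Real.sqrt n * ‖x - y‖)) := by
  obtain ⟨c₀, C₀, hc₀, hC₀, N, hN, hgap⟩ := exists_coeff_gap_bounds (d - 2)
  set K : ℝ := (Real.sqrt Real.pi ^ d)⁻¹ * (Real.exp (-1) * 2) with hK
  have hK0 : 0 < K := by positivity
  set c₁ : ℝ := ((d - 1).factorial : ℝ)⁻¹ with hc₁
  set C₁ : ℝ := (d : ℝ) ^ (d - 1) with hC₁
  have hc₁0 : 0 < c₁ := by positivity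
  have hd0 : (0 : ℝ) < d := by exact_mod_cast (by omega : 0 < d)
  have hC₁0 : 0 < C₁ := by positivity
  -- `δ_n² = K g / dim E_n` with `c₁ n^(d-1) ≤ dim E_n ≤ C₁ n^(d-1)`. The extra `2` in the lower
  -- constant pays for `s = |x - y|²/2` inside the minimum.
  refine ⟨Real.sqrt (K * c₀ / (2 * C₁)), Real.sqrt (K * C₀ / c₁), Real.sqrt_pos.2 (by positivity),
    Real.sqrt_pos.2 (by positivity), N, fun n hn φ hφ x y hx hy hxy => ?_⟩
  have hn1 : 1 ≤ n := hN.trans hn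
  have hn0 : (0 : ℝ) < n := by exact_mod_cast hn1
  obtain ⟨hD1, hD2⟩ := oscDim_bounds (by omega : 1 ≤ d) hn1
  have hr := norm_nonneg (x - y)
  -- The condition `|x - y| ≤ 1` is exactly `s ≤ 1/2`, the range of the planar estimates.
  obtain ⟨hg1, hg2⟩ := hgap n hn (‖x - y‖ ^ 2 / 2) (by positivity)
    (by nlinarith [pow_le_one₀ (n := 2) hr hxy])
  have hw := rpow_mul_min_sq hd hn1 hr
  set w : ℝ := (n : ℝ) ^ (-(d : ℝ) / 4) * min 1 (Real.sqrt n * ‖x - y‖) with hwdef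
  have hw0 : 0 ≤ w := mul_nonneg (by positivity) (le_min zero_le_one (by positivity))
  set D : ℝ := (oscDim d n : ℝ) with hD
  set P : ℝ := (n : ℝ) ^ (d - 1) with hP
  have hP0 : 0 < P := by positivity
  have hD0 : 0 < D := (mul_pos hc₁0 hP0).trans_le hD1
  set g := PowerSeries.coeff n
    ((planarSeries 0 - planarSeries (‖x - y‖ ^ 2 / 2)) * mehlerSeries 0 0 ^ (d - 2)) with hg
  have hδ : dudleyDist d n φ x y = Real.sqrt (K * g / D) := by
    rw [dudleyDist, hφ.sum_sub_sq, sum_hermiteFun_sub_sq hd hx hy]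
    congr 1
    rw [hK]
    ring
  obtain ⟨hm1, hm2⟩ := min_one_half_bounds (by positivity : 0 ≤ (n : ℝ) * ‖x - y‖ ^ 2)
  rw [← mul_div_assoc] at hg1 hg2
  have hS : 0 ≤ Real.sqrt ((n : ℝ) ^ (d - 2)) := Real.sqrt_nonneg _
  have hlow : c₀ * (w ^ 2 * P) ≤ 2 * g := by
    rw [hw]
    nlinarith [mul_le_mul_of_nonneg_left (mul_le_mul_of_nonneg_left hm1 hS) hc₀.le]
  have hup : g ≤ C₀ * (w ^ 2 * P) := by
    rw [hw]
    exact hg2.trans (mul_le_mul_of_nonneg_left (mul_le_mul_of_nonneg_left hm2 hS) hC₀.le)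
  have hsq : ∀ B : ℝ, 0 ≤ B → Real.sqrt B * w = Real.sqrt (B * w ^ 2) := fun B hB => by
    rw [Real.sqrt_mul hB, Real.sqrt_sq hw0]
  rw [hδ, hsq _ (by positivity), hsq _ (by positivity)]
  refine ⟨Real.sqrt_le_sqrt ?_, Real.sqrt_le_sqrt ?_⟩
  · rw [le_div_iff₀ hD0, div_mul_eq_mul_div, div_mul_eq_mul_div, div_le_iff₀ (by positivity)]
    calc K * c₀ * w ^ 2 * D ≤ K * c₀ * w ^ 2 * (C₁ * P) :=
          mul_le_mul_of_nonneg_left hD2 (by positivity)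
      _ = K * C₁ * (c₀ * (w ^ 2 * P)) := by ring
      _ ≤ K * C₁ * (2 * g) := mul_le_mul_of_nonneg_left hlow (by positivity)
      _ = K * g * (2 * C₁) := by ring
  · rw [div_le_iff₀ hD0, div_mul_eq_mul_div, div_mul_eq_mul_div, le_div_iff₀ hc₁0]
    calc K * g * c₁ = K * c₁ * g := by ring
      _ ≤ K * c₁ * (C₀ * (w ^ 2 * P)) := mul_le_mul_of_nonneg_left hup (by positivity)
      _ = K * C₀ * w ^ 2 * (c₁ * P) := by ring
      _ ≤ K * C₀ * w ^ 2 * D := mul_le_mul_of_nonneg_left hD1 (by positivity)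

end DudleyDistance

theorem mainTheorem3 (d : ℕ) (hd : 2 ≤ d) :
    (∀ n : ℕ, FiniteDimensional ℝ (oscEigenspace d n) ∧
      ∃ φ : Fin (oscDim d n) → EuclideanSpace ℝ (Fin d) → ℝ, IsOscEigenbasis d n φ) ∧
    ∃ c C : ℝ, 0 < c ∧ 0 < C ∧ ∃ N : ℕ, ∀ n : ℕ, N ≤ n →
      ∀ φ : Fin (oscDim d n) → EuclideanSpace ℝ (Fin d) → ℝ, IsOscEigenbasis d n φ →
        ∀ x ∈ Metric.sphere (0 : EuclideanSpace ℝ (Fin d)) 1,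
        ∀ y ∈ Metric.sphere (0 : EuclideanSpace ℝ (Fin d)) 1, ‖x - y‖ ≤ 1 →
          c * ((n : ℝ) ^ (-(d : ℝ) / 4) * min 1 (Real.sqrt n * ‖x - y‖)) ≤ dudleyDist d n φ x y ∧
          dudleyDist d n φ x y ≤
            C * ((n : ℝ) ^ (-(d : ℝ) / 4) * min 1 (Real.sqrt n * ‖x - y‖)) := by
  refine ⟨fun n => ⟨finiteDimensional_oscEigenspace d n, exists_isOscEigenbasis d n⟩, ?_⟩
  obtain ⟨c, C, hc, hC, N, h⟩ := exists_dudleyDist_bounds hd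
  exact ⟨c, C, hc, hC, N, fun n hn φ hφ x hx y hy hxy =>
    h n hn φ hφ x y (mem_sphere_zero_iff_norm.1 hx) (mem_sphere_zero_iff_norm.1 hy) hxy⟩
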